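/- Let $r\ge 2$, $\varepsilon>0$, let $d_1\ge 2$ and $d_2,\dots,d_r\ge 1$ be integers, $n=\sum_{i=1}^r d_i$, and let $\mu_1=d_1-1$ and $\mu_2=\dots=\mu_r=0$ (the Einstein constants of the unit sphere $S^{d_1}$ and of Ricci flat manifolds $(M_i,g_i)$ of dimension $d_i$). For the metric $dt^2+\sum_{i=1}^r f_i(t)^2g_i$ on $(0,\infty)\times S^{d_1}\times M_2\times\dots\times M_r$ and a potential $u=u(t)$, with $f_i>0$ and $u$ smooth on $(0,\infty)$, put $\ell_i=\dot f_i/f_i$ and $\operatorname{tr}L=\sum_i d_i\ell_i$. The gradient Ricci soliton equation $\mathrm{Ric}+\mathrm{Hess}\,u+\frac{\varepsilon}{2}g=0$ becomes, for $t>0$, $$\frac{d}{dt}\left(-\dot u+\operatorname{tr}L\right)=-\sum_i d_i\ell_i^2+\frac{\varepsilon}{2},\qquad \dot\ell_i=-\left(-\dot u+\operatorname{tr}L\right)\ell_i+\frac{\mu_i}{f_i^2}+\frac{\varepsilon}{2}\quad(1\le i\le r).$$ For $\bar f_2,\dots,\bar f_r>0$ and $C<0$, a solution on $(0,\infty)$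 has initial data $(\bar f_2,\dots,\bar f_r,C)$ if, as $t\to0^+$, $f_1\to0$, $\dot f_1\to1$, $f_i\to\bar f_i$, $\dot f_i\to0$ for $i\ge2$, and $u\to0$, $\dot u\to0$, $\ddot u\to\frac{C}{d_1+1}$. The trajectory corresponding to it is the curve $(\mathcal L,X_i,Y_i)$ given by $$\mathcal L=\frac{1}{-\dot u+\operatorname{tr}L},\qquad X_i=\mathcal L\,\frac{\dot f_i}{f_i},\qquad Y_i=\frac{\mathcal L}{f_i},$$ in a time parameter $s\in\mathbb R$ with $\frac{dt}{ds}=\mathcal L$, where $t\to0$ as $s\to-\infty$ and $t\to\infty$ as $s\to\infty$. A curve $(\mathcal L,X_i,Y_i)$, $s\in\mathbb R$, is called a regular trajectory if it solves $$\mathcal L'=\mathcal L\Big(\sum_j d_jX_j^2-\tfrac{\varepsilon}{2}\mathcal L^2\Big),\quad X_i'=X_i\Big(\sum_j d_jX_j^2-\tfrac{\varepsilon}{2}\mathcal L^2-1\Big)+\mu_iY_i^2+\tfrac{\varepsilon}{2}\mathcal L^2,\quad Y_i'=Y_i\Big(\sum_j d_jX_j^2-\tfrac{\varepsilon}{2}\mathcal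 L^2-X_i\Big),$$ converges as $s\to-\infty$ to the stationary point $\mathcal L=0$, $X_1=Y_1=\frac1{d_1}$, $X_i=Y_i=0$ $(i\ge2)$, and satisfies $\mathcal L,X_i,Y_i>0$, $\sum_i d_iX_i^2+\sum_i d_i\mu_iY_i^2+(n-1)\frac{\varepsilon}{2}\mathcal L^2<1$ and $\sum_i d_iX_i<1$ for all $s$. Put $\sigma_1^{-1}=\lim_{t\to\infty}\dot f_1=\lim_{s\to\infty}\frac{X_1}{Y_1}$. Fix $\bar f_2,\dots,\bar f_r>0$. Then as $C$ ranges over $(-\infty,0)$, the trajectories with initial data $(\bar f_2,\dots,\bar f_r,C)$ realize every value $\sigma_1\in(0,\infty)$. Precisely: for every $\sigma\in(0,\infty)$ there is $C<0$ such that a solution on $(0,\infty)$ with initial data $(\bar f_2,\dots,\bar f_r,C)$ and a corresponding trajectory exist, and every trajectory corresponding to a solution with these initial data is regular and has $\sigma_1=\sigma$, i.e. $\lim_{t\to\infty}\dot f_1(t)=\lim_{s\to\infty}\frac{X_1(s)}{Y_1(s)}=\sigma^{-1}$. -/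

import Mathlib

open Set Filter Topology
open scoped ContDiff

/-! Multiple warped product gradient Ricci solitons
`dt² + ∑ i, f i (t)² g_i` on `(0, ∞) × S^{d 0} × M_1 × ⋯ × M_m`.
The index `0` is the round unit sphere, the indices `1, …, m` are the Einstein factors with
`Ric g_i = μ i • g_i` and `dim M_i = d i`; there are `m + 1` factors in total. -/

namespace WarpedSoliton

noncomputable section

/-- The eigenvalue `f_i' / f_i` of the shape operator of the hypersurface `{t} × S^{d 0} × ⋯`
on the `i`-th factor. -/
def shape {m : ℕ} (f : Fin (m + 1) → ℝ → ℝ) (i : Fin (m + 1)) (t : ℝ) : ℝ :=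
  deriv (f i) t / f i t

/-- The trace of the shape operator. -/
def trShape {m : ℕ} (d : Fin (m + 1) → ℕ) (f : Fin (m + 1) → ℝ → ℝ) (t : ℝ) : ℝ :=
  ∑ i, (d i : ℝ) * shape f i t

/-- The trace of the square of the shape operator. -/
def trShapeSq {m : ℕ} (d : Fin (m + 1) → ℕ) (f : Fin (m + 1) → ℝ → ℝ) (t : ℝ) : ℝ :=
  ∑ i, (d i : ℝ) * shape f i t ^ 2

/-- The generalized mean curvature `-u' + tr L`. -/
def genMean {m : ℕ} (d : Fin (m + 1) → ℕ) (f : Fin (m + 1) → ℝ → ℝ) (u : ℝ → ℝ) (t : ℝ) : ℝ :=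
  -deriv u t + trShape d f t

/-- `(f, u)` is a smooth solution, on the whole of `(0, ∞)`, of the gradient Ricci soliton
equation `Ric + Hess u + (ε/2) g = 0` for the metric `dt² + ∑ f_i² g_i` and the potential
`u = u(t)`. -/
structure IsSoliton {m : ℕ} (d : Fin (m + 1) → ℕ) (μ : Fin (m + 1) → ℝ) (ε : ℝ)
    (f : Fin (m + 1) → ℝ → ℝ) (u : ℝ → ℝ) : Prop where
  smooth_f : ∀ i, ContDiffOn ℝ ∞ (f i) (Ioi 0)
  smooth_u : ContDiffOn ℝ ∞ u (Ioi 0)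
  pos : ∀ i, ∀ t, 0 < t → 0 < f i t
  eq_mean : ∀ t, 0 < t → deriv (genMean d f u) t = -trShapeSq d f t + ε / 2
  eq_shape : ∀ i, ∀ t, 0 < t →
    deriv (shape f i) t = -genMean d f u t * shape f i t + μ i / f i t ^ 2 + ε / 2

/-- The initial conditions with parameters `(fbar, C)`: the sphere collapses smoothly,
`f_0(0) = 0`, `f_0'(0) = 1`, the other factors satisfy `f_i(0) = fbar_i`, `f_i'(0) = 0`, and
`u(0) = 0`, `u'(0) = 0`, `u''(0) = C / (d 0 + 1)`. -/
structure HasInitialData {m : ℕ} (d : Fin (m + 1) → ℕ) (fbar : Fin m → ℝ) (C : ℝ)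
    (f : Fin (m + 1) → ℝ → ℝ) (u : ℝ → ℝ) : Prop where
  sphere : Tendsto (f 0) (𝓝[>] 0) (𝓝 0)
  sphere_deriv : Tendsto (deriv (f 0)) (𝓝[>] 0) (𝓝 1)
  factor : ∀ i : Fin m, Tendsto (f i.succ) (𝓝[>] 0) (𝓝 (fbar i))
  factor_deriv : ∀ i : Fin m, Tendsto (deriv (f i.succ)) (𝓝[>] 0) (𝓝 0)
  potential : Tendsto u (𝓝[>] 0) (𝓝 0)
  potential_deriv : Tendsto (deriv u) (𝓝[>] 0) (𝓝 0)
  potential_deriv_two : Tendsto (deriv (deriv u)) (𝓝[>] 0) (𝓝 (C / ((d 0 : ℝ) + 1)))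

/-- The curve `s ↦ (Λ, X_i, Y_i)(s)`, `s ∈ ℝ`, is induced by `(f, u)`: after a change of time
`t = τ(s)` from `ℝ` onto `(0, ∞)` with `dt/ds = Λ`, it is given by `Λ = 1 / (-u' + tr L)`,
`X_i = Λ f_i' / f_i` and `Y_i = Λ / f_i`. -/
def Induces {m : ℕ} (d : Fin (m + 1) → ℕ) (f : Fin (m + 1) → ℝ → ℝ) (u : ℝ → ℝ)
    (Λ : ℝ → ℝ) (X Y : Fin (m + 1) → ℝ → ℝ) : Prop :=
  ∃ τ : ℝ → ℝ, (∀ s, 0 < τ s) ∧ Tendsto τ atBot (𝓝 0) ∧ Tendsto τ atTop atTop ∧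
    (∀ s, HasDerivAt τ (Λ s) s) ∧
    (∀ s, Λ s = 1 / genMean d f u (τ s)) ∧
    (∀ i s, X i s = Λ s * shape f i (τ s)) ∧
    (∀ i s, Y i s = Λ s / f i (τ s))

/-- `(Λ, X, Y)` is a trajectory, defined for all `s ∈ ℝ`, of the rescaled Ricci soliton ODE. -/
structure IsTrajectory {m : ℕ} (d : Fin (m + 1) → ℕ) (μ : Fin (m + 1) → ℝ) (ε : ℝ)
    (Λ : ℝ → ℝ) (X Y : Fin (m + 1) → ℝ → ℝ) : Prop where
  ode_L : ∀ s, HasDerivAt Λ (Λ s * (∑ j, (d j : ℝ) * X j s ^ 2 - ε / 2 * Λ s ^ 2)) s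
  ode_X : ∀ i s, HasDerivAt (X i)
    (X i s * (∑ j, (d j : ℝ) * X j s ^ 2 - ε / 2 * Λ s ^ 2 - 1)
      + μ i * Y i s ^ 2 + ε / 2 * Λ s ^ 2) s
  ode_Y : ∀ i s, HasDerivAt (Y i)
    (Y i s * (∑ j, (d j : ℝ) * X j s ^ 2 - ε / 2 * Λ s ^ 2 - X i s)) s

/-- `S₁ = ∑ d_i X_i² + ∑ d_i μ_i Y_i² + (n - 1) (ε/2) Λ² - 1`, where `n = ∑ d_i`. -/
def S1 {m : ℕ} (d : Fin (m + 1) → ℕ) (μ : Fin (m + 1) → ℝ) (ε : ℝ)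
    (Λ : ℝ → ℝ) (X Y : Fin (m + 1) → ℝ → ℝ) (s : ℝ) : ℝ :=
  ∑ i, (d i : ℝ) * X i s ^ 2 + ∑ i, (d i : ℝ) * μ i * Y i s ^ 2
    + ((∑ i, (d i : ℝ)) - 1) * (ε / 2) * Λ s ^ 2 - 1

/-- `S₂ = ∑ d_i X_i - 1`. -/
def S2 {m : ℕ} (d : Fin (m + 1) → ℕ) (X : Fin (m + 1) → ℝ → ℝ) (s : ℝ) : ℝ :=
  ∑ i, (d i : ℝ) * X i s - 1

/-- Regular trajectories: trajectories in the unstable manifold of the stationary point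
`Λ = 0`, `X_0 = Y_0 = 1 / d 0`, `X_i = Y_i = 0` for `i ≠ 0`, with all coordinates positive,
along which `S₁ < 0` and `S₂ < 0`. -/
structure IsRegular {m : ℕ} (d : Fin (m + 1) → ℕ) (μ : Fin (m + 1) → ℝ) (ε : ℝ)
    (Λ : ℝ → ℝ) (X Y : Fin (m + 1) → ℝ → ℝ) : Prop where
  trajectory : IsTrajectory d μ ε Λ X Y
  lim_L : Tendsto Λ atBot (𝓝 0)
  lim_X_zero : Tendsto (X 0) atBot (𝓝 (1 / (d 0 : ℝ)))
  lim_Y_zero : Tendsto (Y 0) atBot (𝓝 (1 / (d 0 : ℝ)))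
  lim_X : ∀ i : Fin m, Tendsto (X i.succ) atBot (𝓝 0)
  lim_Y : ∀ i : Fin m, Tendsto (Y i.succ) atBot (𝓝 0)
  pos_L : ∀ s, 0 < Λ s
  pos_X : ∀ i s, 0 < X i s
  pos_Y : ∀ i s, 0 < Y i s
  S1_neg : ∀ s, S1 d μ ε Λ X Y s < 0
  S2_neg : ∀ s, S2 d X s < 0

end

end WarpedSoliton

/-!
For solutions with this initial data the logarithmic derivatives of `f_2, …, f_r` enter the other
equations only through their weighted mean, which reduces the system to one for `(f, y, p, h, v)`,
where `f = f_1`, `y = f'`, `p = -u'`, `v = -u` and `h` is the mean. Solving the conservation law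

`(-u' + tr L)² = ∑ d_i ℓ_i² + μ_1 d_1 / f² + (n - 1) ε / 2 + K - ε u`, where `K = -C`,

for `u''` makes this an initial value problem which is singular at `t = 0` only through factors
`1 / t`. It has a unique solution, which depends continuously on `K` and exists for all times.

Let `R = (d_1 - 1 + (ε / 2) f²) / (K - ε u)`. It is nondecreasing, and it becomes nonincreasing if
a sufficiently large constant `c`, depending on a bound for `f'`, is added to the numerator. Hence
`R` converges to a limit `S(K)`, and as `-u' ~ √(K - ε u)`, also `f'` converges, to `√(ε S(K) / 2)`.
The two monotone quotients differ by `c / (K - ε u)`, which tends to `0`; since `c` can be chosen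
locally uniformly in `K`, the function `S` is continuous. Moreover `(d_1 - 1) / K ≤ S(K)`, and
`S(K) = O(1 / K)` as `K → ∞`, because `f' < 2` for large `K`. So `S` takes all positive values.
-/

namespace WarpedSoliton

/-! ### Differential inequalities on an interval -/

section Calculus

variable {g g' M : ℝ → ℝ} {a b l : ℝ}

lemma nonneg_of_neg_mul_le_deriv (hg : ∀ t ∈ Ioo a b, HasDerivAt g (g' t) t)
    (hM : ∀ t ∈ Ioo a b, 0 ≤ M t) (hle : ∀ t ∈ Ioo a b, -M t * g t ≤ g' t)
    (ha : Tendsto g (𝓝[>] a) (𝓝 0)) {t : ℝ} (ht : t ∈ Ioo a b) : 0 ≤ g t := by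
  suffices hbarrier : ∀ η > 0, -g t ≤ η * (1 + (t - a)) by
    have hta : 0 < 1 + (t - a) := by linarith [ht.1]
    refine neg_nonpos.1 (le_of_forall_pos_le_add fun δ hδ => ?_)
    simpa [div_mul_cancel₀ _ hta.ne'] using hbarrier (δ / (1 + (t - a))) (div_pos hδ hta)
  intro η hη
  obtain ⟨c, hc, hct⟩ : ∃ c, -g c < η ∧ c ∈ Ioo a t :=
    ((ha.neg.eventually (gt_mem_nhds (by simpa using hη))).and (Ioo_mem_nhdsGT ht.1)).exists
  have hsub : ∀ s ∈ Icc c t, s ∈ Ioo a b := fun s hs => ⟨hct.1.trans_le hs.1, hs.2.trans_lt ht.2⟩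
  refine image_le_of_deriv_right_lt_deriv_boundary (f := fun s => -g s) (f' := fun s => -g' s)
    (B := fun s => η * (1 + (s - a))) (B' := fun _ => η)
    (fun s hs => (hg s (hsub s hs)).neg.continuousAt.continuousWithinAt)
    (fun s hs => (hg s (hsub s (Ico_subset_Icc_self hs))).neg.hasDerivWithinAt)
    (by nlinarith [hct.1])
    (fun s => by simpa using (((hasDerivAt_id s).sub_const a).const_add 1).const_mul η)
    (fun s hs hEq => ?_) (right_mem_Icc.2 hct.2.le)
  have hs' := hsub s (Ico_subset_Icc_self hs)
  have hpos : 0 < η * (1 + (s - a)) := mul_pos hη (by linarith [hs'.1])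
  nlinarith [hle s hs', mul_nonneg (hM s hs') hpos.le]

lemma pos_of_neg_mul_lt_deriv (hg : ∀ t ∈ Ioo a b, HasDerivAt g (g' t) t)
    (hM : ∀ t ∈ Ioo a b, 0 ≤ M t) (hlt : ∀ t ∈ Ioo a b, -M t * g t < g' t)
    (ha : Tendsto g (𝓝[>] a) (𝓝 0)) {t : ℝ} (ht : t ∈ Ioo a b) : 0 < g t := by
  have hnn : ∀ s ∈ Ioo a b, 0 ≤ g s := fun s hs =>
    nonneg_of_neg_mul_le_deriv hg hM (fun r hr => (hlt r hr).le) ha hs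
  refine (hnn t ht).lt_of_ne fun hzero => ?_
  have hmin : IsLocalMin g t := by
    filter_upwards [Ioo_mem_nhds ht.1 ht.2] with s hs using hzero ▸ hnn s hs
  have hlt' := hlt t ht
  rw [hmin.hasDerivAt_eq_zero (hg t ht), ← hzero, mul_zero] at hlt'
  exact hlt'.false

lemma monotoneOn_of_hasDerivAt_nonneg {s : Set ℝ} (hs : Convex ℝ s)
    (hg : ∀ t ∈ s, HasDerivAt g (g' t) t) (h : ∀ t ∈ s, 0 ≤ g' t) : MonotoneOn g s :=
  monotoneOn_of_hasDerivWithinAt_nonneg hs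
    (fun t ht => (hg t ht).continuousAt.continuousWithinAt)
    (fun t ht => (hg t (interior_subset ht)).hasDerivWithinAt)
    fun t ht => h t (interior_subset ht)

lemma le_of_hasDerivAt_nonneg (hab : a ≤ b) (hg : ∀ t ∈ Icc a b, HasDerivAt g (g' t) t)
    (h : ∀ t ∈ Ioo a b, 0 ≤ g' t) : g a ≤ g b :=
  monotoneOn_of_hasDerivWithinAt_nonneg (convex_Icc a b)
    (fun t ht => (hg t ht).continuousAt.continuousWithinAt)
    (fun t ht => (hg t (interior_subset ht)).hasDerivWithinAt)
    (fun t ht => h t (interior_Icc (a := a) (b := b) ▸ ht)) (left_mem_Icc.2 hab)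
    (right_mem_Icc.2 hab) hab

lemma le_of_monotoneOn_of_tendsto (hg : MonotoneOn g (Ioo a b))
    (ha : Tendsto g (𝓝[>] a) (𝓝 l)) {t : ℝ} (ht : t ∈ Ioo a b) : l ≤ g t := by
  refine le_of_tendsto ha ?_
  filter_upwards [Ioo_mem_nhdsGT ht.1] with s hs
  exact hg ⟨hs.1, hs.2.trans ht.2⟩ ht hs.2.le

lemma le_of_hasDerivAt_nonneg_of_tendsto (hg : ∀ t ∈ Ioo a b, HasDerivAt g (g' t) t)
    (h : ∀ t ∈ Ioo a b, 0 ≤ g' t) (ha : Tendsto g (𝓝[>] a) (𝓝 l)) {t : ℝ} (ht : t ∈ Ioo a b) :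
    l ≤ g t :=
  le_of_monotoneOn_of_tendsto (monotoneOn_of_hasDerivAt_nonneg (convex_Ioo a b) hg h) ha ht

lemma eq_zero_of_hasDerivAt_neg_mul (hg : ∀ t ∈ Ioo a b, HasDerivAt g (-M t * g t) t)
    (hM : ∀ t ∈ Ioo a b, 0 ≤ M t) (ha : Tendsto g (𝓝[>] a) (𝓝 0)) {t : ℝ} (ht : t ∈ Ioo a b) :
    g t = 0 := by
  have hsq : 0 ≤ -g t ^ 2 := le_of_hasDerivAt_nonneg_of_tendsto
    (g := fun s => -g s ^ 2) (fun s hs => ((hg s hs).pow 2).neg)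
    (fun s hs => by simpa using! by nlinarith [mul_nonneg (hM s hs) (sq_nonneg (g s))])
    (by simpa using (ha.pow 2).neg) ht
  exact pow_eq_zero_iff two_ne_zero |>.1 (le_antisymm (neg_nonneg.1 hsq) (sq_nonneg _))

lemma nonpos_deriv_of_nonneg_left {t : ℝ} {c : ℝ} (hg : HasDerivAt g c t) (h0 : g t = 0)
    (hat : a < t) (hpos : ∀ s ∈ Ioo a t, 0 ≤ g s) : c ≤ 0 := by
  have hslope : Tendsto (slope g t) (𝓝[<] t) (𝓝 c) := (hasDerivAt_iff_tendsto_slope.1 hg).mono_left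
    (nhdsWithin_mono t fun s hs => (mem_Iio.1 hs).ne)
  refine le_of_tendsto hslope ?_
  filter_upwards [Ioo_mem_nhdsLT hat] with s hs
  rw [slope_def_field, h0, sub_zero]
  exact div_nonpos_of_nonneg_of_nonpos (hpos s hs) (sub_nonpos.2 hs.2.le)

lemma exists_first_zero {ι : Type*} [Finite ι] {φ : ι → ℝ → ℝ}
    (hφ : ∀ i, ContinuousOn (φ i) (Icc a b)) (hab : a ≤ b) (ha : ∀ i, 0 < φ i a)
    (hb : ∃ i, φ i b ≤ 0) :
    ∃ t ∈ Ioc a b, (∀ s ∈ Ico a t, ∀ i, 0 < φ i s) ∧ (∀ i, 0 ≤ φ i t) ∧ ∃ i, φ i t = 0 := by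
  have hcompact : IsCompact (⋃ i, Icc a b ∩ φ i ⁻¹' Iic 0) := isCompact_iUnion fun i =>
    isCompact_Icc.of_isClosed_subset
      ((hφ i).preimage_isClosed_of_isClosed isClosed_Icc isClosed_Iic) inter_subset_left
  obtain ⟨t, ht, hleast⟩ := hcompact.exists_isLeast
    (hb.elim fun i hi => ⟨b, mem_iUnion.2 ⟨i, right_mem_Icc.2 hab, hi⟩⟩)
  obtain ⟨i, hti, hi⟩ := mem_iUnion.1 ht
  have hat : a < t := hti.1.lt_of_ne fun h => (ha i).not_ge (h ▸ hi)
  have hbefore : ∀ s ∈ Ico a t, ∀ j, 0 < φ j s := fun s hs j => not_le.1 fun hj =>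
    hs.2.not_ge (hleast (mem_iUnion.2 ⟨j, ⟨hs.1, hs.2.le.trans hti.2⟩, hj⟩))
  have hnonneg : ∀ j, 0 ≤ φ j t := fun j => by
    have hcont : Tendsto (φ j) (𝓝[Ico a t] t) (𝓝 (φ j t)) :=
      (hφ j t hti).mono fun s hs => ⟨hs.1, hs.2.le.trans hti.2⟩
    have := right_nhdsWithin_Ico_neBot hat
    exact ge_of_tendsto hcont (eventually_mem_nhdsWithin.mono fun s hs => (hbefore s hs j).le)
  exact ⟨t, ⟨hat, hti.2⟩, hbefore, hnonneg, i, le_antisymm hi (hnonneg i)⟩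

lemma forall_pos_of_deriv_pos_at_first_zero {ι : Type*} [Finite ι] {φ φ' : ι → ℝ → ℝ}
    (hφ : ∀ i, ∀ t ∈ Ico a b, HasDerivAt (φ i) (φ' i t) t) (ha : ∀ i, 0 < φ i a)
    (h : ∀ t ∈ Ioo a b, (∀ s ∈ Ico a t, ∀ i, 0 < φ i s) → (∀ i, 0 ≤ φ i t) →
      ∀ i, φ i t = 0 → 0 < φ' i t) :
    ∀ t ∈ Ico a b, ∀ i, 0 < φ i t := by
  by_contra! hcon
  obtain ⟨T, hT, hneg⟩ := hcon
  obtain ⟨t, ht, hbefore, hnonneg, i, hzero⟩ := exists_first_zero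
    (fun i t ht => (hφ i t ⟨ht.1, ht.2.trans_lt hT.2⟩).continuousAt.continuousWithinAt) hT.1 ha hneg
  have htb : t < b := ht.2.trans_lt hT.2
  exact (h t ⟨ht.1, htb⟩ hbefore hnonneg i hzero).not_ge <|
    nonpos_deriv_of_nonneg_left (hφ i t ⟨ht.1.le, htb⟩) hzero ht.1
      fun s hs => (hbefore s (Ioo_subset_Ico_self hs) i).le

end Calculus

/-! ### Singular initial value problems `t w' + (k + 1) w = Q(t, K, w)` -/

section Singular

open MeasureTheory
open scoped BoundedContinuousFunction NNReal

lemma integral_pow_mul_comp_mul (k : ℕ) (g : ℝ → ℝ) {s : ℝ} (hs : s ≠ 0) :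
    ∫ r in (0 : ℝ)..1, r ^ k * g (r * s) = (∫ r in (0 : ℝ)..s, r ^ k * g r) / s ^ (k + 1) := by
  have hscale := intervalIntegral.integral_comp_mul_right (a := 0) (b := 1)
    (fun r => r ^ k * g r) hs
  simp only [mul_pow, zero_mul, one_mul, smul_eq_mul, mul_right_comm _ (s ^ k)] at hscale
  rw [intervalIntegral.integral_mul_const] at hscale
  rw [eq_div_iff (pow_ne_zero _ hs), pow_succ, ← mul_assoc, hscale]
  field_simp

lemma hasDerivAt_integral_div_pow (k : ℕ) {g : ℝ → ℝ} (hg : Continuous g) {t : ℝ} (ht : t ≠ 0) :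
    HasDerivAt (fun s => (∫ r in (0 : ℝ)..s, r ^ k * g r) / s ^ (k + 1))
      ((g t - (k + 1) * ((∫ r in (0 : ℝ)..t, r ^ k * g r) / t ^ (k + 1))) / t) t := by
  have hcont : Continuous fun r => r ^ k * g r := by fun_prop
  refine ((hcont.integral_hasStrictDerivAt 0 t).hasDerivAt.fun_div
    (hasDerivAt_pow (k + 1) t) (pow_ne_zero _ ht)).congr_deriv ?_
  push_cast [add_tsub_cancel_right]
  field_simp
  ring

lemma abs_integral_pow_mul_le (k : ℕ) {g : ℝ → ℝ} {C : ℝ} (hC : ∀ r, |g r| ≤ C) :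
    |∫ r in (0 : ℝ)..1, r ^ k * g r| ≤ C := by
  simpa using intervalIntegral.norm_integral_le_of_norm_le_const (a := 0) (b := 1) (C := C)
    (f := fun r : ℝ => r ^ k * g r) fun r hr => by
      rw [uIoc_of_le zero_le_one] at hr
      rw [Real.norm_eq_abs, abs_mul, abs_pow, abs_of_pos hr.1]
      exact (mul_le_of_le_one_left (abs_nonneg _) (pow_le_one₀ hr.1.le hr.2)).trans (hC r)

variable {ι P : Type*}

/-- The integral operator whose fixed points `w(t, K)` solve the singular equation
`t w' + (k + 1) w = Q(t, K, w)` on `t > 0`. The integral from `0` to `t` is rescaled to `[0, 1]`,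
so that the operator also makes sense at `t = 0`. -/
noncomputable def singularOp (k : ι → ℕ) (Q : (ℝ × P) × (ι → ℝ) → ι → ℝ)
    (w : ℝ × P → ι → ℝ) (z : ℝ × P) : ι → ℝ :=
  fun i => ∫ r in (0 : ℝ)..1, r ^ k i * Q ((r * z.1, z.2), w (r * z.1, z.2)) i

variable {k : ι → ℕ} {Q : (ℝ × P) × (ι → ℝ) → ι → ℝ} {w : ℝ × P → ι → ℝ}

lemma norm_singularOp_le [Fintype ι] (w : ℝ × P → ι → ℝ) {z : ℝ × P} {C : ℝ}
    (hC : ∀ r, ‖Q ((r * z.1, z.2), w (r * z.1, z.2))‖ ≤ C) : ‖singularOp k Q w z‖ ≤ C :=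
  (pi_norm_le_iff_of_nonneg ((norm_nonneg _).trans (hC 0))).2 fun i =>
    abs_integral_pow_mul_le (k i) fun r => (norm_le_pi_norm _ i).trans (hC r)

lemma eq_zero_of_singularOp_eq [Fintype ι] (hfix : singularOp k Q w = w) {c : ℝ≥0} (hc : c < 1)
    (hL : ∀ z w w', ‖Q (z, w) - Q (z, w')‖ ≤ c * ‖w - w'‖) {K : P} (h0 : Q ((0, K), 0) = 0) :
    w (0, K) = 0 := by
  have hle : ‖w (0, K)‖ ≤ c * ‖w (0, K)‖ := by
    nth_rw 1 [← hfix]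
    refine norm_singularOp_le w fun r => ?_
    simpa [h0] using hL (0, K) (w (0, K)) 0
  have hc' : (c : ℝ) < 1 := hc
  exact norm_le_zero_iff.1 (by nlinarith [norm_nonneg (w (0, K)), hc'])

variable [TopologicalSpace P]

lemma continuous_singularOp (k : ι → ℕ) (hQ : Continuous Q) (hw : Continuous w) :
    Continuous (singularOp k Q w) :=
  continuous_pi fun i => by
    have hintegrand : Continuous fun p : (ℝ × P) × ℝ =>
        p.2 ^ k i * Q ((p.2 * p.1.1, p.1.2), w (p.2 * p.1.1, p.1.2)) i := by fun_prop
    exact intervalIntegral.continuous_parametric_intervalIntegral_of_continuous' hintegrand 0 1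

lemma hasDerivAt_of_singularOp_eq (hQ : Continuous Q) (hw : Continuous w)
    (hfix : singularOp k Q w = w) {t : ℝ} (ht : t ≠ 0) (K : P) (i : ι) :
    HasDerivAt (fun t => w (t, K) i)
      ((Q ((t, K), w (t, K)) i - (k i + 1) * w (t, K) i) / t) t := by
  have hform : ∀ s ≠ 0, w (s, K) i
      = (∫ r in (0 : ℝ)..s, r ^ k i * Q ((r, K), w (r, K)) i) / s ^ (k i + 1) := fun s hs => by
    rw [← integral_pow_mul_comp_mul (k i) (fun r => Q ((r, K), w (r, K)) i) hs]
    exact (congrFun (congrFun hfix (s, K)) i).symm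
  rw [hform t ht]
  have hcont : Continuous fun r => Q ((r, K), w (r, K)) i := by fun_prop
  refine (hasDerivAt_integral_div_pow (k i) hcont ht).congr_of_eventuallyEq ?_
  filter_upwards [eventually_ne_nhds ht] with s hs using hform s hs

lemma singularOp_sub (hQ : Continuous Q) {w' : ℝ × P → ι → ℝ} (hw : Continuous w)
    (hw' : Continuous w') (z : ℝ × P) :
    singularOp k Q w z - singularOp k Q w' z
      = singularOp k (fun y => Q (y.1, w y.1) - Q (y.1, w' y.1)) w z := by
  ext i
  have hint : ∀ w : ℝ × P → ι → ℝ, Continuous w → IntervalIntegrable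
      (fun r => r ^ k i * Q ((r * z.1, z.2), w (r * z.1, z.2)) i) volume 0 1 :=
    fun w hw => Continuous.intervalIntegrable (by fun_prop) _ _
  simp only [singularOp, Pi.sub_apply, mul_sub]
  exact (intervalIntegral.integral_sub (hint w hw) (hint w' hw')).symm

variable [Fintype ι]

theorem exists_singularOp_fixedPoint (k : ι → ℕ) (hQ : Continuous Q) {C : ℝ} (hC : ∀ z, ‖Q z‖ ≤ C)
    {c : ℝ≥0} (hc : c < 1) (hL : ∀ z w w', ‖Q (z, w) - Q (z, w')‖ ≤ c * ‖w - w'‖) :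
    ∃ w : ℝ × P → ι → ℝ, Continuous w ∧ singularOp k Q w = w := by
  let Φ : ((ℝ × P) →ᵇ (ι → ℝ)) → ((ℝ × P) →ᵇ (ι → ℝ)) := fun w =>
    BoundedContinuousFunction.ofNormedAddCommGroup (singularOp k Q w)
      (continuous_singularOp k hQ w.continuous) C fun z => norm_singularOp_le w fun r => hC _
  have hΦ : ContractingWith c Φ := by
    refine ⟨hc, LipschitzWith.of_dist_le_mul fun w w' => ?_⟩
    refine (BoundedContinuousFunction.dist_le (by positivity)).2 fun z => ?_
    rw [dist_eq_norm]
    change ‖singularOp k Q w z - singularOp k Q w' z‖ ≤ _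
    rw [singularOp_sub hQ w.continuous w'.continuous]
    refine norm_singularOp_le _ fun r => (hL _ _ _).trans ?_
    rw [← dist_eq_norm]
    gcongr
    exact BoundedContinuousFunction.dist_coe_le_dist _
  have hfix : Φ hΦ.fixedPoint = hΦ.fixedPoint := hΦ.fixedPoint_isFixedPt
  exact ⟨hΦ.fixedPoint, hΦ.fixedPoint.continuous, congrArg DFunLike.coe hfix⟩

end Singular

section SingularLocal

open scoped NNReal

lemma exists_closedBall_partial_lipschitz {E F G : Type*} [NormedAddCommGroup E]
    [NormedSpace ℝ E] [NormedAddCommGroup F] [NormedSpace ℝ F] [NormedAddCommGroup G]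
    [NormedSpace ℝ G] {Q : E × F → G} {z₀ : E × F} (hQ : ContDiffAt ℝ 1 Q z₀) {b c : ℝ}
    (hbc : b < c) (hb : ∀ w, ‖fderiv ℝ Q z₀ (0, w)‖ ≤ b * ‖w‖) :
    ∃ ρ > 0, ContinuousOn Q (Metric.closedBall z₀ ρ) ∧
      ∀ z w w', (z, w) ∈ Metric.closedBall z₀ ρ → (z, w') ∈ Metric.closedBall z₀ ρ →
        ‖Q (z, w) - Q (z, w')‖ ≤ c * ‖w - w'‖ := by
  obtain ⟨s, hs, happ⟩ := (hQ.hasStrictFDerivAt one_ne_zero).approximates_deriv_on_nhds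
    (c := (c - b).toNNReal) (Or.inr (by simpa using hbc))
  obtain ⟨ρ, hρ, hsub⟩ := Metric.nhds_basis_closedBall.mem_iff.1
    (inter_mem hs ((hQ.eventually (by simp)).mono fun z hz => hz.continuousAt))
  refine ⟨ρ, hρ, fun z hz => (hsub hz).2.continuousWithinAt, fun z w w' hw hw' => ?_⟩
  have happrox := happ _ (hsub hw).1 _ (hsub hw').1
  rw [Prod.mk_sub_mk, sub_self, Real.coe_toNNReal _ (sub_nonneg.2 hbc.le), Prod.norm_def,
    norm_zero, max_eq_right (norm_nonneg _)] at happrox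
  linarith [hb (w - w'), norm_le_insert' (Q (z, w) - Q (z, w')) (fderiv ℝ Q z₀ (0, w - w'))]

/-- The nearest point retraction of the line onto the closed interval of radius `ρ` around `c`. -/
def clamp (c ρ a : ℝ) : ℝ := max (c - ρ) (min a (c + ρ))

@[fun_prop]
lemma continuous_clamp (c ρ : ℝ) : Continuous (clamp c ρ) := by unfold clamp; fun_prop

lemma clamp_mem_closedBall (c a : ℝ) {ρ : ℝ} (hρ : 0 ≤ ρ) :
    clamp c ρ a ∈ Metric.closedBall c ρ := by
  rw [Real.closedBall_eq_Icc]
  exact ⟨le_max_left _ _, max_le (by linarith) (min_le_right _ _)⟩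

lemma clamp_of_mem_closedBall {c ρ a : ℝ} (ha : a ∈ Metric.closedBall c ρ) : clamp c ρ a = a := by
  rw [Real.closedBall_eq_Icc] at ha
  rw [clamp, min_eq_left ha.2, max_eq_right ha.1]

lemma abs_clamp_sub_clamp_le (c ρ a b : ℝ) : |clamp c ρ a - clamp c ρ b| ≤ |a - b| := by
  refine (abs_max_sub_max_le_max _ _ _ _).trans ?_
  rw [sub_self, abs_zero, max_eq_right (abs_nonneg _)]
  exact (abs_min_sub_min_le_max _ _ _ _).trans (by simp)

variable {ι : Type*} [Fintype ι] {Q : (ℝ × ℝ) × (ι → ℝ) → ι → ℝ} {K₀ ρ : ℝ} {c : ℝ≥0}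

lemma exists_truncation (hρ : 0 ≤ ρ) (hQ : ContinuousOn Q (Metric.closedBall ((0, K₀), 0) ρ))
    (hL : ∀ z w w', (z, w) ∈ Metric.closedBall ((0, K₀), 0) ρ →
      (z, w') ∈ Metric.closedBall ((0, K₀), 0) ρ → ‖Q (z, w) - Q (z, w')‖ ≤ c * ‖w - w'‖) :
    ∃ R : (ℝ × ℝ) × (ι → ℝ) → ι → ℝ, Continuous R ∧ (∃ C, ∀ z, ‖R z‖ ≤ C) ∧
      (∀ z w w', ‖R (z, w) - R (z, w')‖ ≤ c * ‖w - w'‖) ∧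
      EqOn R Q (Metric.closedBall ((0, K₀), 0) ρ) := by
  let π : (ℝ × ℝ) × (ι → ℝ) → (ℝ × ℝ) × (ι → ℝ) := fun z =>
    ((clamp 0 ρ z.1.1, clamp K₀ ρ z.1.2), fun i => clamp 0 ρ (z.2 i))
  have hπ : Continuous π := by fun_prop
  have hball : ∀ z : (ℝ × ℝ) × (ι → ℝ), z ∈ Metric.closedBall ((0, K₀), 0) ρ ↔
      (z.1.1 ∈ Metric.closedBall 0 ρ ∧ z.1.2 ∈ Metric.closedBall K₀ ρ) ∧
        ∀ i, z.2 i ∈ Metric.closedBall 0 ρ := fun z => by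
    rw [← closedBall_prod_same, ← closedBall_prod_same, closedBall_pi _ hρ]
    simp
  have hmem : ∀ z, π z ∈ Metric.closedBall ((0, K₀), 0) ρ := fun z => (hball _).2
    ⟨⟨clamp_mem_closedBall _ _ hρ, clamp_mem_closedBall _ _ hρ⟩,
      fun i => clamp_mem_closedBall _ _ hρ⟩
  obtain ⟨C, hC⟩ := (isCompact_closedBall _ _).exists_bound_of_continuousOn hQ
  refine ⟨Q ∘ π, hQ.comp_continuous hπ hmem, ⟨C, fun z => hC _ (hmem z)⟩, fun z w w' => ?_,
    fun z hz => congrArg Q ?_⟩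
  · refine (hL _ _ _ (hmem (z, w)) (hmem (z, w'))).trans ?_
    gcongr
    exact (pi_norm_le_iff_of_nonneg (norm_nonneg _)).2 fun i =>
      (abs_clamp_sub_clamp_le _ _ _ _).trans (norm_le_pi_norm (w - w') i)
  · have hz' := (hball z).1 hz
    exact Prod.ext (Prod.ext (clamp_of_mem_closedBall hz'.1.1) (clamp_of_mem_closedBall hz'.1.2))
      (funext fun i => clamp_of_mem_closedBall (hz'.2 i))

theorem exists_singular_solution (k : ι → ℕ) (hρ : 0 < ρ) (hc : c < 1)
    (hQ : ContinuousOn Q (Metric.closedBall ((0, K₀), 0) ρ))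
    (hL : ∀ z w w', (z, w) ∈ Metric.closedBall ((0, K₀), 0) ρ →
      (z, w') ∈ Metric.closedBall ((0, K₀), 0) ρ → ‖Q (z, w) - Q (z, w')‖ ≤ c * ‖w - w'‖)
    (h0 : ∀ K, Q ((0, K), 0) = 0) :
    ∃ δ > 0, ∃ w : ℝ × ℝ → ι → ℝ, Continuous w ∧
      (∀ K ∈ Metric.closedBall K₀ δ, w (0, K) = 0) ∧
      ∀ t ∈ Ioc 0 δ, ∀ K ∈ Metric.closedBall K₀ δ, ∀ i, HasDerivAt (fun t => w (t, K) i)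
        ((Q ((t, K), w (t, K)) i - (k i + 1) * w (t, K) i) / t) t := by
  obtain ⟨R, hR, ⟨C, hC⟩, hRL, hRQ⟩ := exists_truncation hρ.le hQ hL
  obtain ⟨w, hw, hfix⟩ := exists_singularOp_fixedPoint k hR hC hc hRL
  have hzero : ∀ K ∈ Metric.closedBall K₀ ρ, w (0, K) = 0 := fun K hK =>
    eq_zero_of_singularOp_eq hfix hc hRL <| (hRQ (by simpa [Prod.dist_eq, hρ.le] using hK)).trans
      (h0 K)
  have hgraph : ∀ᶠ z in 𝓝 ((0 : ℝ), K₀), (z, w z) ∈ Metric.closedBall ((0, K₀), 0) ρ := by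
    have hcont : Tendsto (fun z => (z, w z)) (𝓝 ((0 : ℝ), K₀)) (𝓝 ((0, K₀), 0)) := by
      rw [← hzero K₀ (Metric.mem_closedBall_self hρ.le)]
      exact (by fun_prop : Continuous fun z => (z, w z)).tendsto _
    exact hcont.eventually (Metric.closedBall_mem_nhds _ hρ)
  obtain ⟨δ, hδ, hsub⟩ := Metric.nhds_basis_closedBall.mem_iff.1 hgraph
  refine ⟨min δ ρ, lt_min hδ hρ, w, hw,
    fun K hK => hzero K (Metric.closedBall_subset_closedBall (min_le_right _ _) hK),
    fun t ht K hK i => ?_⟩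
  have htK : (t, K) ∈ Metric.closedBall ((0 : ℝ), K₀) δ := by
    rw [← closedBall_prod_same]
    exact ⟨by simpa [abs_of_pos ht.1] using ht.2.trans (min_le_left _ _),
      Metric.closedBall_subset_closedBall (min_le_left _ _) hK⟩
  rw [← hRQ (hsub htK)]
  exact hasDerivAt_of_singularOp_eq hR hw hfix ht.1.ne' K i

lemma le_of_singular_hasDerivAt {e p : ℝ → ℝ} {k : ℕ} {m T : ℝ} (hm : 0 ≤ m)
    (hp : ∀ t ∈ Ioo 0 T, p t ≤ m)
    (he : ∀ t ∈ Ioo 0 T, HasDerivAt e ((p t - (k + 1) * e t) / t) t)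
    (h0 : Tendsto e (𝓝[>] 0) (𝓝 0)) {t : ℝ} (ht : t ∈ Ioo 0 T) : e t ≤ m := by
  have hderiv : ∀ s ∈ Ioo 0 T, HasDerivAt (fun s => s ^ (k + 1) * (m - e s))
      (s ^ k * ((k + 1) * m - p s)) s := fun s hs => by
    refine ((hasDerivAt_pow (k + 1) s).fun_mul ((he s hs).const_sub m)).congr_deriv ?_
    have hs0 : s ≠ 0 := hs.1.ne'
    push_cast [add_tsub_cancel_right]
    field_simp
    ring
  have hlim : Tendsto (fun s => s ^ (k + 1) * (m - e s)) (𝓝[>] 0) (𝓝 0) := by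
    have hpow : Tendsto (fun s : ℝ => s ^ (k + 1)) (𝓝[>] 0) (𝓝 (0 ^ (k + 1))) :=
      ((continuous_pow (k + 1)).tendsto 0).mono_left nhdsWithin_le_nhds
    simpa using hpow.mul (h0.const_sub m)
  have hnonneg := le_of_hasDerivAt_nonneg_of_tendsto hderiv (fun s hs => mul_nonneg
    (pow_nonneg hs.1.le k) (by nlinarith [hp s hs, mul_nonneg (Nat.cast_nonneg (α := ℝ) k) hm]))
    hlim ht
  exact sub_nonneg.1 (nonneg_of_mul_nonneg_right hnonneg (pow_pos ht.1 _))

lemma norm_le_of_singular_hasDerivAt {k : ι → ℕ} {p e : ℝ → ι → ℝ} {m T : ℝ}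
    (hp : ∀ t ∈ Ioo 0 T, ‖p t‖ ≤ m)
    (he : ∀ t ∈ Ioo 0 T, ∀ i, HasDerivAt (fun t => e t i) ((p t i - (k i + 1) * e t i) / t) t)
    (h0 : Tendsto e (𝓝[>] 0) (𝓝 0)) {t : ℝ} (ht : t ∈ Ioo 0 T) : ‖e t‖ ≤ m := by
  have hm : 0 ≤ m := (norm_nonneg _).trans (hp t ht)
  have hpi : ∀ s ∈ Ioo 0 T, ∀ i, |p s i| ≤ m := fun s hs i => (norm_le_pi_norm _ i).trans (hp s hs)
  refine (pi_norm_le_iff_of_nonneg hm).2 fun i => abs_le'.2 ⟨?_, ?_⟩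
  · exact le_of_singular_hasDerivAt hm (fun s hs => (abs_le'.1 (hpi s hs i)).1)
      (fun s hs => he s hs i) (tendsto_pi_nhds.1 h0 i) ht
  · exact le_of_singular_hasDerivAt (e := fun s => -e s i) hm
      (fun s hs => (abs_le'.1 (hpi s hs i)).2)
      (fun s hs => (he s hs i).neg.congr_deriv (by ring))
      (by simpa using (tendsto_pi_nhds.1 h0 i).neg) ht

lemma exists_bound_of_continuousOn_of_tendsto {E : Type*} [NormedAddCommGroup E] {e : ℝ → E}
    {a b : ℝ} {l : E} (he : ContinuousOn e (Ioc a b)) (ha : Tendsto e (𝓝[>] a) (𝓝 l)) :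
    ∃ C, ∀ t ∈ Ioo a b, ‖e t‖ ≤ C := by
  have hcont : ContinuousOn (Function.update e a l) (Icc a b) := by
    refine continuousOn_update_iff.2 ⟨?_, fun _ => ?_⟩ <;> rw [Icc_sdiff_left]
    · exact he
    · exact ha.mono_left (nhdsWithin_mono a Ioc_subset_Ioi_self)
  obtain ⟨C, hC⟩ := isCompact_Icc.exists_bound_of_continuousOn hcont
  exact ⟨C, fun t ht => by simpa [ht.1.ne'] using hC t (Ioo_subset_Icc_self ht)⟩

theorem singular_solution_unique {k : ι → ℕ} {q q' : ℝ → ι → ℝ} {δ : ℝ} {w w' : ℝ → ι → ℝ}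
    (hc : c < 1) (hL : ∀ t ∈ Ioo 0 δ, ‖q t - q' t‖ ≤ c * ‖w t - w' t‖)
    (hw : ∀ t ∈ Ioo 0 δ, ∀ i, HasDerivAt (fun t => w t i) ((q t i - (k i + 1) * w t i) / t) t)
    (hw' : ∀ t ∈ Ioo 0 δ, ∀ i,
      HasDerivAt (fun t => w' t i) ((q' t i - (k i + 1) * w' t i) / t) t)
    (h0 : Tendsto w (𝓝[>] 0) (𝓝 0)) (h0' : Tendsto w' (𝓝[>] 0) (𝓝 0)) {t : ℝ}
    (ht : t ∈ Ioo 0 δ) : w t = w' t := by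
  have hlim : Tendsto (w - w') (𝓝[>] 0) (𝓝 0) := by simpa using! h0.sub h0'
  obtain ⟨T, htT, hTδ⟩ := exists_between ht.2
  have hsub : Ioc 0 T ⊆ Ioo 0 δ := fun s hs => ⟨hs.1, hs.2.trans_lt hTδ⟩
  obtain ⟨C, hC⟩ : ∃ C, ∀ s ∈ Ioo 0 T, ‖w s - w' s‖ ≤ C := by
    refine exists_bound_of_continuousOn_of_tendsto (ContinuousOn.sub ?_ ?_) hlim
    · exact fun s hs => (continuousAt_pi.2 fun i =>
        (hw s (hsub hs) i).continuousAt).continuousWithinAt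
    · exact fun s hs => (continuousAt_pi.2 fun i =>
        (hw' s (hsub hs) i).continuousAt).continuousWithinAt
  have hpow : ∀ n : ℕ, ∀ s ∈ Ioo 0 T, ‖w s - w' s‖ ≤ c ^ n * C := fun n => by
    induction n with
    | zero => simpa using hC
    | succ n ih =>
      refine fun s hs => norm_le_of_singular_hasDerivAt (k := k) (p := q - q') (e := w - w')
        (fun r hr => (hL r (hsub (Ioo_subset_Ioc_self hr))).trans ?_)
        (fun r hr i => ((hw r (hsub (Ioo_subset_Ioc_self hr)) i).sub
          (hw' r (hsub (Ioo_subset_Ioc_self hr)) i)).congr_deriv ?_) hlim hs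
      · rw [pow_succ', mul_assoc]
        gcongr
        exact ih r hr
      · simp only [Pi.sub_apply]
        ring
  have hvanish : Tendsto (fun n : ℕ => (c : ℝ) ^ n * C) atTop (𝓝 0) := by
    simpa using (tendsto_pow_atTop_nhds_zero_of_lt_one c.2 hc).mul_const C
  exact sub_eq_zero.1 <| norm_le_zero_iff.1 <| ge_of_tendsto' hvanish fun n => hpow n t ⟨ht.1, htT⟩

end SingularLocal

/-! ### The reduced system -/

/-- The coordinates of the reduced system: the warping function `f` of the sphere, `y = f'`,
`p = -u'`, the common logarithmic derivative `h` of the other warping functions, and `v = -u`. -/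
inductive Coord
  | f | y | p | h | v
  deriving DecidableEq

instance : Fintype Coord where
  elems := {.f, .y, .p, .h, .v}
  complete i := by cases i <;> decide

/-- The phase space of the reduced system. -/
abbrev State : Type := Coord → ℝ

/-- The generalized mean curvature `-u' + tr L` in reduced coordinates, for a sphere of dimension
`N` and flat factors of total dimension `D`. -/
noncomputable def reducedMean (N : ℕ) (D : ℝ) (x : State) : ℝ :=
  x .p + N * (x .y / x .f) + D * x .h

lemma reducedMean_mul_f (N : ℕ) (D : ℝ) {x : State} (hf : x .f ≠ 0) :
    reducedMean N D x * x .f = x .p * x .f + N * x .y + D * (x .h * x .f) := by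
  unfold reducedMean
  field_simp

/-- The soliton equation in reduced coordinates. The second order equation for `u` is solved for
`u''` by means of the first integral, whose value at `t = 0` is encoded in `K = -C`. -/
noncomputable def reducedField (N : ℕ) (D ε K : ℝ) (x : State) : State
  | .f => x .y
  | .y => -(x .p + D * x .h) * x .y + (N - 1) * (1 - x .y ^ 2) / x .f + ε / 2 * x .f
  | .p => -reducedMean N D x * x .p + (K + ε * x .v)
  | .h => -reducedMean N D x * x .h + ε / 2
  | .v => x .p

/-- Solutions on `(0, T)` of the reduced system with a smoothly collapsing sphere at `0`. -/
structure IsReducedSolution (N : ℕ) (D ε K T : ℝ) (x : ℝ → State) : Prop where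
  ode : ∀ t ∈ Ioo 0 T, HasDerivAt x (reducedField N D ε K (x t)) t
  pos_f : ∀ t ∈ Ioo 0 T, 0 < x t .f
  tendsto : Tendsto x (𝓝[>] 0) (𝓝 (Pi.single .y 1))

/-- The admissible parameters of the reduced system. -/
structure Params (N : ℕ) (D ε K : ℝ) : Prop where
  two_le : 2 ≤ N
  D_nonneg : 0 ≤ D
  ε_pos : 0 < ε
  K_pos : 0 < K

lemma Params.two_le_cast {N : ℕ} {D ε K : ℝ} (P : Params N D ε K) : (2 : ℝ) ≤ N :=
  Nat.ofNat_le_cast.2 P.two_le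

lemma Params.of_pos {N : ℕ} {D ε K K' : ℝ} (P : Params N D ε K) (hK' : 0 < K') :
    Params N D ε K' :=
  ⟨P.two_le, P.D_nonneg, P.ε_pos, hK'⟩

namespace IsReducedSolution

variable {N : ℕ} {D ε K T t : ℝ} {x : ℝ → State}

lemma mono {T' : ℝ} (hx : IsReducedSolution N D ε K T x) (h : T' ≤ T) :
    IsReducedSolution N D ε K T' x :=
  ⟨fun t ht => hx.ode t (Ioo_subset_Ioo_right h ht),
    fun t ht => hx.pos_f t (Ioo_subset_Ioo_right h ht), hx.tendsto⟩

lemma hasDerivAt_f (hx : IsReducedSolution N D ε K T x) (ht : t ∈ Ioo 0 T) :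
    HasDerivAt (fun t => x t .f) (x t .y) t :=
  hasDerivAt_pi.1 (hx.ode t ht) .f

lemma hasDerivAt_y (hx : IsReducedSolution N D ε K T x) (ht : t ∈ Ioo 0 T) :
    HasDerivAt (fun t => x t .y) (-(x t .p + D * x t .h) * x t .y
      + (N - 1) * (1 - x t .y ^ 2) / x t .f + ε / 2 * x t .f) t :=
  hasDerivAt_pi.1 (hx.ode t ht) .y

lemma hasDerivAt_p (hx : IsReducedSolution N D ε K T x) (ht : t ∈ Ioo 0 T) :
    HasDerivAt (fun t => x t .p) (-reducedMean N D (x t) * x t .p + (K + ε * x t .v)) t :=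
  hasDerivAt_pi.1 (hx.ode t ht) .p

lemma hasDerivAt_h (hx : IsReducedSolution N D ε K T x) (ht : t ∈ Ioo 0 T) :
    HasDerivAt (fun t => x t .h) (-reducedMean N D (x t) * x t .h + ε / 2) t :=
  hasDerivAt_pi.1 (hx.ode t ht) .h

lemma hasDerivAt_v (hx : IsReducedSolution N D ε K T x) (ht : t ∈ Ioo 0 T) :
    HasDerivAt (fun t => x t .v) (x t .p) t :=
  hasDerivAt_pi.1 (hx.ode t ht) .v

lemma tendsto_f (hx : IsReducedSolution N D ε K T x) :
    Tendsto (fun t => x t .f) (𝓝[>] 0) (𝓝 0) := by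
  simpa using tendsto_pi_nhds.1 hx.tendsto .f

lemma tendsto_y (hx : IsReducedSolution N D ε K T x) :
    Tendsto (fun t => x t .y) (𝓝[>] 0) (𝓝 1) := by
  simpa using tendsto_pi_nhds.1 hx.tendsto .y

lemma tendsto_p (hx : IsReducedSolution N D ε K T x) :
    Tendsto (fun t => x t .p) (𝓝[>] 0) (𝓝 0) := by
  simpa using tendsto_pi_nhds.1 hx.tendsto .p

lemma tendsto_h (hx : IsReducedSolution N D ε K T x) :
    Tendsto (fun t => x t .h) (𝓝[>] 0) (𝓝 0) := by
  simpa using tendsto_pi_nhds.1 hx.tendsto .h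

lemma tendsto_v (hx : IsReducedSolution N D ε K T x) :
    Tendsto (fun t => x t .v) (𝓝[>] 0) (𝓝 0) := by
  simpa using tendsto_pi_nhds.1 hx.tendsto .v

lemma tendsto_p_add_mul_h (hx : IsReducedSolution N D ε K T x) :
    Tendsto (fun t => x t .p + D * x t .h) (𝓝[>] 0) (𝓝 0) := by
  simpa using hx.tendsto_p.add (hx.tendsto_h.const_mul D)

lemma exists_reducedMean_pos (hx : IsReducedSolution N D ε K T x) (P : Params N D ε K)
    (hT : 0 < T) :
    ∃ δ ∈ Ioc 0 T, ∀ t ∈ Ioo 0 δ,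
      0 < reducedMean N D (x t) ∧ 0 < x t .y ∧ 0 < K + ε * x t .v := by
  have hK : Tendsto (fun t => K + ε * x t .v) (𝓝[>] 0) (𝓝 K) := by
    simpa using (hx.tendsto_v.const_mul ε).const_add K
  obtain ⟨δ, hδ, hsub⟩ := (mem_nhdsGT_iff_exists_mem_Ioc_Ioo_subset hT).1 <|
    (hx.tendsto_f.eventually_lt_const (by norm_num : (0 : ℝ) < 1 / 2)).and <|
    (hx.tendsto_y.eventually_const_lt (by norm_num : (1 / 2 : ℝ) < 1)).and <|
    (hx.tendsto_p_add_mul_h.eventually_const_lt (by norm_num : (-1 : ℝ) < 0)).and <|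
    hK.eventually_const_lt P.K_pos
  refine ⟨δ, hδ, fun t ht => ?_⟩
  obtain ⟨hf, hy, hph, hK⟩ := hsub ht
  have hyf : 1 ≤ x t .y / x t .f :=
    (one_le_div (hx.pos_f t (Ioo_subset_Ioo_right hδ.2 ht))).2 (by linarith)
  refine ⟨?_, by linarith, hK⟩
  unfold reducedMean
  nlinarith [P.two_le_cast]

lemma exists_pos (hx : IsReducedSolution N D ε K T x) (P : Params N D ε K) (hT : 0 < T) :
    ∃ δ ∈ Ioc 0 T, ∀ t ∈ Ioo 0 δ, 0 < x t .y ∧ 0 < x t .p ∧ 0 < x t .h ∧ 0 < x t .v := by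
  obtain ⟨δ, hδ, hM⟩ := hx.exists_reducedMean_pos P hT
  have hxδ := hx.mono hδ.2
  have hp : ∀ t ∈ Ioo 0 δ, 0 < x t .p := fun t ht =>
    pos_of_neg_mul_lt_deriv (fun t ht => hxδ.hasDerivAt_p ht) (fun t ht => (hM t ht).1.le)
      (fun t ht => by linarith [(hM t ht).2.2]) hx.tendsto_p ht
  have hh : ∀ t ∈ Ioo 0 δ, 0 < x t .h := fun t ht =>
    pos_of_neg_mul_lt_deriv (fun t ht => hxδ.hasDerivAt_h ht) (fun t ht => (hM t ht).1.le)
      (fun _ _ => by linarith [P.ε_pos]) hx.tendsto_h ht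
  have hv : ∀ t ∈ Ioo 0 δ, 0 < x t .v := fun t ht =>
    pos_of_neg_mul_lt_deriv (M := fun _ => 0) (fun t ht => hxδ.hasDerivAt_v ht)
      (fun _ _ => le_rfl) (fun t ht => by simpa using hp t ht) hx.tendsto_v ht
  exact ⟨δ, hδ, fun t ht => ⟨(hM t ht).2.1, hp t ht, hh t ht, hv t ht⟩⟩

lemma pos_v_of_pos_p {a : ℝ} (hx : IsReducedSolution N D ε K T x) (ha : 0 < a) (hv : 0 < x a .v)
    (ht : t ∈ Ico a T) (hp : ∀ s ∈ Ioo a t, 0 < x s .p) : 0 < x t .v :=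
  hv.trans_le <| le_of_hasDerivAt_nonneg ht.1
    (fun _ hs => hx.hasDerivAt_v ⟨ha.trans_le hs.1, hs.2.trans_lt ht.2⟩) fun s hs => (hp s hs).le

lemma pos_of_pos_at {a : ℝ} (hx : IsReducedSolution N D ε K T x) (P : Params N D ε K)
    (ha : 0 < a) (hy : 0 < x a .y) (hp : 0 < x a .p) (hh : 0 < x a .h) (hv : 0 < x a .v)
    (ht : t ∈ Ico a T) : 0 < x t .y ∧ 0 < x t .p ∧ 0 < x t .h ∧ 0 < x t .v := by
  have hsub : ∀ s ∈ Ico a T, s ∈ Ioo 0 T := fun s hs => ⟨ha.trans_le hs.1, hs.2⟩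
  let φ : Fin 3 → Coord := ![.y, .p, .h]
  have hpos := forall_pos_of_deriv_pos_at_first_zero (b := T) (φ := fun i t => x t (φ i))
    (φ' := fun i t => reducedField N D ε K (x t) (φ i))
    (fun i s hs => hasDerivAt_pi.1 (hx.ode s (hsub s hs)) _)
    (by simpa [φ, Fin.forall_fin_succ] using ⟨hy, hp, hh⟩) fun s hs hbefore _ i hzero => by
      have hs' : s ∈ Ico a T := Ioo_subset_Ico_self hs
      have hf := hx.pos_f s (hsub s hs')
      fin_cases i <;> simp only [φ, Fin.zero_eta, Fin.mk_one, Fin.reduceFinMk, Matrix.cons_val] at *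
        <;> simp only [reducedField, hzero, mul_zero, zero_add]
      · have : 0 < (N - 1 : ℝ) * (1 - 0 ^ 2) / x s .f :=
          div_pos (by linarith [P.two_le_cast]) hf
        linarith [mul_pos P.ε_pos hf]
      · have := hx.pos_v_of_pos_p ha hv hs' fun r hr => by simpa using! hbefore r ⟨hr.1.le, hr.2⟩ 1
        linarith [P.K_pos, mul_pos P.ε_pos this]
      · exact half_pos P.ε_pos
  exact ⟨hpos t ht 0, hpos t ht 1, hpos t ht 2,
    hx.pos_v_of_pos_p ha hv ht fun s hs => hpos s ⟨hs.1.le, hs.2.trans ht.2⟩ 1⟩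

lemma pos (hx : IsReducedSolution N D ε K T x) (P : Params N D ε K) (ht : t ∈ Ioo 0 T) :
    0 < x t .y ∧ 0 < x t .p ∧ 0 < x t .h ∧ 0 < x t .v := by
  obtain ⟨δ, hδ, hpos⟩ := hx.exists_pos P (ht.1.trans ht.2)
  obtain ⟨a, ha, haδt⟩ := exists_between (lt_min hδ.1 ht.1)
  obtain ⟨hy, hp, hh, hv⟩ := hpos a ⟨ha, haδt.trans_le (min_le_left _ _)⟩
  exact hx.pos_of_pos_at P ha hy hp hh hv ⟨haδt.le.trans (min_le_right _ _), ht.2⟩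

lemma pos_y (hx : IsReducedSolution N D ε K T x) (P : Params N D ε K) (ht : t ∈ Ioo 0 T) :
    0 < x t .y := (hx.pos P ht).1

lemma pos_p (hx : IsReducedSolution N D ε K T x) (P : Params N D ε K) (ht : t ∈ Ioo 0 T) :
    0 < x t .p := (hx.pos P ht).2.1

lemma pos_h (hx : IsReducedSolution N D ε K T x) (P : Params N D ε K) (ht : t ∈ Ioo 0 T) :
    0 < x t .h := (hx.pos P ht).2.2.1

lemma pos_v (hx : IsReducedSolution N D ε K T x) (P : Params N D ε K) (ht : t ∈ Ioo 0 T) :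
    0 < x t .v := (hx.pos P ht).2.2.2

lemma pos_add_mul_v (hx : IsReducedSolution N D ε K T x) (P : Params N D ε K)
    (ht : t ∈ Ioo 0 T) : 0 < K + ε * x t .v :=
  add_pos P.K_pos (mul_pos P.ε_pos (hx.pos_v P ht))

lemma y_div_f_lt_reducedMean (hx : IsReducedSolution N D ε K T x) (P : Params N D ε K)
    (ht : t ∈ Ioo 0 T) : x t .y / x t .f < reducedMean N D (x t) := by
  have hyf : 0 < x t .y / x t .f := div_pos (hx.pos_y P ht) (hx.pos_f t ht)
  unfold reducedMean
  nlinarith [hx.pos_p P ht, mul_nonneg P.D_nonneg (hx.pos_h P ht).le, P.two_le_cast]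

lemma pos_reducedMean (hx : IsReducedSolution N D ε K T x) (P : Params N D ε K)
    (ht : t ∈ Ioo 0 T) : 0 < reducedMean N D (x t) :=
  (div_pos (hx.pos_y P ht) (hx.pos_f t ht)).trans (hx.y_div_f_lt_reducedMean P ht)

end IsReducedSolution

/-- The defect of the first integral `IsReducedSolution.conservation` of the reduced system,
multiplied by `f²` so that it extends to the singular time `t = 0`. -/
noncomputable def conservationDefect (N : ℕ) (D ε K : ℝ) (x : State) : ℝ :=
  (N * x .y + (x .p + D * x .h) * x .f) ^ 2 - N * x .y ^ 2 - D * (x .h ^ 2 * x .f ^ 2)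
    - N * (N - 1) - ((N + D - 1) * (ε / 2) + (K + ε * x .v)) * x .f ^ 2

lemma conservationDefect_eq (N : ℕ) (D ε K : ℝ) {x : State} (hf : x .f ≠ 0) :
    conservationDefect N D ε K x = (reducedMean N D x ^ 2 - (N * (x .y / x .f) ^ 2 + D * x .h ^ 2
      + N * (N - 1) / x .f ^ 2 + (N + D - 1) * (ε / 2) + (K + ε * x .v))) * x .f ^ 2 := by
  have hMf : reducedMean N D x * x .f = N * x .y + (x .p + D * x .h) * x .f := by
    rw [reducedMean_mul_f N D hf]
    ring
  rw [conservationDefect, ← hMf]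
  field_simp
  ring

namespace IsReducedSolution

variable {N : ℕ} {D ε K T t : ℝ} {x : ℝ → State}

lemma tendsto_conservationDefect (hx : IsReducedSolution N D ε K T x) :
    Tendsto (fun t => conservationDefect N D ε K (x t)) (𝓝[>] 0) (𝓝 0) := by
  have hcont : ContinuousAt (conservationDefect N D ε K) (Pi.single .y 1) := by
    unfold conservationDefect
    fun_prop
  have hzero : conservationDefect N D ε K (Pi.single .y 1) = 0 := by
    simp [conservationDefect]
    ring
  simpa only [hzero] using! hcont.tendsto.comp hx.tendsto

lemma hasDerivAt_conservationDefect (hx : IsReducedSolution N D ε K T x) (ht : t ∈ Ioo 0 T) :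
    HasDerivAt (fun t => conservationDefect N D ε K (x t))
      (-(2 * (reducedMean N D (x t) - x t .y / x t .f)) * conservationDefect N D ε K (x t)) t := by
  have hf := hx.hasDerivAt_f ht
  have hy := hx.hasDerivAt_y ht
  have hph := (hx.hasDerivAt_p ht).fun_add ((hx.hasDerivAt_h ht).const_mul D)
  refine (((((((hy.const_mul (N : ℝ)).fun_add (hph.fun_mul hf)).fun_pow 2).fun_sub
    ((hy.fun_pow 2).const_mul (N : ℝ))).fun_sub
    ((((hx.hasDerivAt_h ht).fun_pow 2).fun_mul (hf.fun_pow 2)).const_mul D)).sub_const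
    ((N : ℝ) * (N - 1))).fun_sub (((((hx.hasDerivAt_v ht).const_mul ε).const_add K).const_add
    ((N + D - 1) * (ε / 2))).fun_mul (hf.fun_pow 2))).congr_deriv ?_
  have hf0 := (hx.pos_f t ht).ne'
  simp only [conservationDefect, reducedMean]
  field_simp
  ring

lemma conservation (hx : IsReducedSolution N D ε K T x) (P : Params N D ε K) (ht : t ∈ Ioo 0 T) :
    reducedMean N D (x t) ^ 2 = N * (x t .y / x t .f) ^ 2 + D * x t .h ^ 2
      + N * (N - 1) / x t .f ^ 2 + (N + D - 1) * (ε / 2) + (K + ε * x t .v) := by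
  have hzero : conservationDefect N D ε K (x t) = 0 := eq_zero_of_hasDerivAt_neg_mul
    (fun s hs => hx.hasDerivAt_conservationDefect hs)
    (fun s hs => by linarith [hx.y_div_f_lt_reducedMean P hs]) hx.tendsto_conservationDefect ht
  have hf := (hx.pos_f t ht).ne'
  rw [conservationDefect_eq N D ε K hf] at hzero
  exact sub_eq_zero.1 ((mul_eq_zero_iff_right (pow_ne_zero 2 hf)).1 hzero)

lemma hasDerivAt_y_div_f (hx : IsReducedSolution N D ε K T x) (ht : t ∈ Ioo 0 T) :
    HasDerivAt (fun t => x t .y / x t .f)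
      (-reducedMean N D (x t) * (x t .y / x t .f) + (N - 1) / x t .f ^ 2 + ε / 2) t := by
  have hf := (hx.pos_f t ht).ne'
  refine ((hx.hasDerivAt_y ht).fun_div (hx.hasDerivAt_f ht) hf).congr_deriv ?_
  simp only [reducedMean]
  field_simp
  ring

lemma hasDerivAt_reducedMean (hx : IsReducedSolution N D ε K T x) (P : Params N D ε K)
    (ht : t ∈ Ioo 0 T) :
    HasDerivAt (fun t => reducedMean N D (x t))
      (ε / 2 - (N * (x t .y / x t .f) ^ 2 + D * x t .h ^ 2)) t := by
  refine (((hx.hasDerivAt_p ht).fun_add ((hx.hasDerivAt_y_div_f ht).const_mul (N : ℝ))).fun_add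
    ((hx.hasDerivAt_h ht).const_mul D)).congr_deriv ?_
  have hsq : reducedMean N D (x t) ^ 2
    = reducedMean N D (x t) * (x t .p + N * (x t .y / x t .f) + D * x t .h) := sq _
  linear_combination hsq - hx.conservation P ht

end IsReducedSolution

/-! ### A priori bounds and the trapping region -/

/-- The region in which `f' < B` persists. Its thresholds are chosen so that each of the first
three inequalities can only be lost if another one, or the last one, is lost before. -/
structure Trapped (N : ℕ) (D ε K B : ℝ) (z : State) : Prop where
  y_lt : z .y < B
  lt_p : ε / (2 * B) * z .f < z .p
  h_mul_f_lt : z .h * z .f < B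
  lt_add_mul_v : (N + D + 1) * (ε / 2) < K + ε * z .v - (ε / (2 * B)) ^ 2 * z .f ^ 2

section BoundaryOfTrappingRegion

variable {N : ℕ} {D ε K B : ℝ} {z : State}

lemma reducedField_y_neg_of_y_eq (P : Params N D ε K) (hB : 1 < B) (hf : 0 < z .f) (hh : 0 ≤ z .h)
    (hp : ε / (2 * B) * z .f ≤ z .p) (hy : z .y = B) : reducedField N D ε K z .y < 0 := by
  have hpB : ε / 2 * z .f ≤ z .p * B := by
    calc ε / 2 * z .f = ε / (2 * B) * z .f * B := by field_simp
      _ ≤ z .p * B := by gcongr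
  have hcurv : (N - 1 : ℝ) * (1 - B ^ 2) / z .f < 0 :=
    div_neg_of_neg_of_pos (mul_neg_of_pos_of_neg (by linarith [P.two_le_cast]) (by nlinarith)) hf
  have hDh : 0 ≤ D * z .h * B := mul_nonneg (mul_nonneg P.D_nonneg hh) (by linarith)
  simp only [reducedField, hy]
  linarith

lemma reducedField_p_gt_of_p_eq (P : Params N D ε K) (hB : 0 < B) (hf : 0 < z .f)
    (hp : z .p = ε / (2 * B) * z .f) (hy : z .y ≤ B) (hhf : z .h * z .f ≤ B)
    (hv : (N + D + 1) * (ε / 2) < K + ε * z .v - (ε / (2 * B)) ^ 2 * z .f ^ 2) :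
    ε / (2 * B) * z .y < reducedField N D ε K z .p := by
  have hε := P.ε_pos
  have hD := P.D_nonneg
  set lam := ε / (2 * B)
  have hlam : lam * B = ε / 2 := by simp only [lam]; field_simp
  have hMp : reducedMean N D z * z .p
      = lam ^ 2 * z .f ^ 2 + N * (lam * z .y) + D * (lam * (z .h * z .f)) := by
    rw [hp, mul_left_comm, reducedMean_mul_f N D hf.ne', hp]
    ring
  have hly : lam * z .y ≤ ε / 2 := hlam ▸ (by gcongr)
  have hlh : lam * (z .h * z .f) ≤ ε / 2 := hlam ▸ (by gcongr)
  have hNy : N * (lam * z .y) ≤ N * (ε / 2) := by gcongr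
  have hDh : D * (lam * (z .h * z .f)) ≤ D * (ε / 2) := by gcongr
  simp only [reducedField, neg_mul, hMp]
  linarith

lemma deriv_h_mul_f_neg_of_eq (P : Params N D ε K) (hB : 0 < B) (hf : 0 < z .f) (hy : 0 < z .y)
    (hh : 0 < z .h) (hp : ε / (2 * B) * z .f ≤ z .p) (hhf : z .h * z .f = B) :
    reducedField N D ε K z .h * z .f + z .h * reducedField N D ε K z .f < 0 := by
  have hpB : ε / 2 * z .f ≤ z .p * B := by
    calc ε / 2 * z .f = ε / (2 * B) * z .f * B := by field_simp
      _ ≤ z .p * B := by gcongr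
  have hMhf : reducedMean N D z * z .h * z .f
      = z .p * B + N * (z .y * z .h) + D * (B * z .h) := by
    rw [mul_right_comm, reducedMean_mul_f N D hf.ne', hhf, ← hhf]
    ring
  have hDh : 0 ≤ D * (B * z .h) := mul_nonneg P.D_nonneg (by positivity)
  simp only [reducedField]
  nlinarith [mul_pos hy hh, P.two_le_cast]

end BoundaryOfTrappingRegion

namespace IsReducedSolution

variable {N : ℕ} {D ε K T t : ℝ} {x : ℝ → State}

lemma lt_add_mul_v_sub_of_trapped {B c t₀ : ℝ} (hx : IsReducedSolution N D ε K T x)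
    (hε : 0 < ε) (hB : 0 < B) (ht₀ : 0 < t₀)
    (h₀ : c < K + ε * x t₀ .v - (ε / (2 * B)) ^ 2 * x t₀ .f ^ 2) (ht : t ∈ Ico t₀ T)
    (hy : ∀ s ∈ Ioo t₀ t, x s .y ≤ B) (hp : ∀ s ∈ Ioo t₀ t, ε / (2 * B) * x s .f ≤ x s .p) :
    c < K + ε * x t .v - (ε / (2 * B)) ^ 2 * x t .f ^ 2 := by
  have hsub : ∀ s ∈ Icc t₀ t, s ∈ Ioo 0 T := fun s hs =>
    ⟨ht₀.trans_le hs.1, hs.2.trans_lt ht.2⟩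
  refine h₀.trans_le (le_of_hasDerivAt_nonneg
    (g := fun s => K + ε * x s .v - (ε / (2 * B)) ^ 2 * x s .f ^ 2) ht.1 (fun s hs =>
      (((hx.hasDerivAt_v (hsub s hs)).const_mul ε).const_add K).fun_sub
        (((hx.hasDerivAt_f (hsub s hs)).fun_pow 2).const_mul _)) fun s hs => ?_)
  have hf := hx.pos_f s (hsub s (Ioo_subset_Icc_self hs))
  have hle : (ε / (2 * B)) ^ 2 * (2 * x s .f * x s .y) ≤ ε * x s .p := by
    calc (ε / (2 * B)) ^ 2 * (2 * x s .f * x s .y)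
        ≤ (ε / (2 * B)) ^ 2 * (2 * x s .f * B) := by gcongr; exact hy s hs
      _ = ε * (ε / (2 * B) * x s .f) := by field_simp
      _ ≤ ε * x s .p := by gcongr; exact hp s hs
  simpa using hle

lemma trapped_of_trapped {B t₀ : ℝ} (hx : IsReducedSolution N D ε K T x) (P : Params N D ε K)
    (hB : 1 < B) (ht₀ : 0 < t₀) (h : Trapped N D ε K B (x t₀)) (ht : t ∈ Ico t₀ T) :
    Trapped N D ε K B (x t) := by
  have hB0 : 0 < B := zero_lt_one.trans hB
  have hsub : ∀ s ∈ Ico t₀ T, s ∈ Ioo 0 T := fun s hs => ⟨ht₀.trans_le hs.1, hs.2⟩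
  have hpos := forall_pos_of_deriv_pos_at_first_zero (a := t₀) (b := T)
    (φ := ![fun s => B - x s .y, fun s => x s .p - ε / (2 * B) * x s .f,
      fun s => B - x s .h * x s .f])
    (φ' := let F := fun s => reducedField N D ε K (x s)
      ![fun s => -F s .y, fun s => F s .p - ε / (2 * B) * x s .y,
        fun s => -(F s .h * x s .f + x s .h * F s .f)])
    (Fin.forall_fin_succ.2 ⟨fun s hs => (hx.hasDerivAt_y (hsub s hs)).const_sub B,
      Fin.forall_fin_two.2 ⟨fun s hs => (hx.hasDerivAt_p (hsub s hs)).fun_sub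
        ((hx.hasDerivAt_f (hsub s hs)).const_mul _), fun s hs =>
      ((hx.hasDerivAt_h (hsub s hs)).fun_mul (hx.hasDerivAt_f (hsub s hs))).const_sub B⟩⟩)
    (Fin.forall_fin_succ.2 ⟨sub_pos.2 h.y_lt,
      Fin.forall_fin_two.2 ⟨sub_pos.2 h.lt_p, sub_pos.2 h.h_mul_f_lt⟩⟩)
    fun s hs hbefore hnonneg => by
      have hs' := hsub s (Ioo_subset_Ico_self hs)
      have hf := hx.pos_f s hs'
      have hp : ε / (2 * B) * x s .f ≤ x s .p := sub_nonneg.1 (hnonneg 1)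
      refine Fin.forall_fin_succ.2 ⟨fun hzero => ?_, Fin.forall_fin_two.2
        ⟨fun hzero => ?_, fun hzero => ?_⟩⟩
      · exact neg_pos.2 (reducedField_y_neg_of_y_eq P hB hf (hx.pos_h P hs').le hp
          (sub_eq_zero.1 hzero).symm)
      · exact sub_pos.2 (reducedField_p_gt_of_p_eq P hB0 hf (sub_eq_zero.1 hzero)
          (sub_nonneg.1 (hnonneg 0)) (sub_nonneg.1 (hnonneg 2))
          (hx.lt_add_mul_v_sub_of_trapped P.ε_pos hB0 ht₀ h.lt_add_mul_v (Ioo_subset_Ico_self hs)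
            (fun r hr => sub_nonneg.1 (hbefore r (Ioo_subset_Ico_self hr) 0).le)
            fun r hr => sub_nonneg.1 (hbefore r (Ioo_subset_Ico_self hr) 1).le))
      · exact neg_pos.2 (deriv_h_mul_f_neg_of_eq P hB0 hf (hx.pos_y P hs') (hx.pos_h P hs') hp
          (sub_eq_zero.1 hzero).symm)
  have hIco : Ioo t₀ t ⊆ Ico t₀ T := fun s hs => ⟨hs.1.le, hs.2.trans ht.2⟩
  exact ⟨sub_pos.1 (hpos t ht 0), sub_pos.1 (hpos t ht 1), sub_pos.1 (hpos t ht 2),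
    hx.lt_add_mul_v_sub_of_trapped P.ε_pos hB0 ht₀ h.lt_add_mul_v ht
      (fun s hs => (sub_pos.1 (hpos s (hIco hs) 0)).le)
      fun s hs => (sub_pos.1 (hpos s (hIco hs) 1)).le⟩

lemma exists_mul_f_lt_p (hx : IsReducedSolution N D ε K T x) (P : Params N D ε K) (hT : 0 < T)
    {c : ℝ} (hK : c * (N + 1) < K) :
    ∃ δ ∈ Ioc 0 T, ∀ t ∈ Ioo 0 δ, c * x t .f < x t .p := by
  have hlim : Tendsto (fun t => K + ε * x t .v - c * x t .y - c * (x t .p * x t .f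
      + N * x t .y + D * (x t .h * x t .f))) (𝓝[>] 0) (𝓝 (K - c * (N + 1))) := by
    convert (((hx.tendsto_v.const_mul ε).const_add K).sub (hx.tendsto_y.const_mul c)).sub
      ((((hx.tendsto_p.mul hx.tendsto_f).add (hx.tendsto_y.const_mul (N : ℝ))).add
      ((hx.tendsto_h.mul hx.tendsto_f).const_mul D)).const_mul c) using 2
    ring
  obtain ⟨δ, hδ, hpos⟩ := (mem_nhdsGT_iff_exists_mem_Ioc_Ioo_subset hT).1
    (hlim.eventually_const_lt (sub_pos.2 hK))
  have hsub : ∀ s ∈ Ioo 0 δ, s ∈ Ioo 0 T := fun s hs => ⟨hs.1, hs.2.trans_le hδ.2⟩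
  refine ⟨δ, hδ, fun t ht => sub_pos.1 ?_⟩
  refine pos_of_neg_mul_lt_deriv (g := fun t => x t .p - c * x t .f)
    (M := fun t => reducedMean N D (x t)) (fun s hs => (hx.hasDerivAt_p (hsub s hs)).fun_sub
      ((hx.hasDerivAt_f (hsub s hs)).const_mul c))
    (fun s hs => (hx.pos_reducedMean P (hsub s hs)).le) (fun s hs => ?_)
    (by simpa using hx.tendsto_p.sub (hx.tendsto_f.const_mul c)) ht
  have hderiv := hpos hs
  rw [mem_ofPred_eq, ← reducedMean_mul_f N D (hx.pos_f s (hsub s hs)).ne'] at hderiv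
  linarith

lemma y_lt_two (hx : IsReducedSolution N D ε K T x) (P : Params N D ε K)
    (hK : (N + D + 1) * (ε / 2) < K) (ht : t ∈ Ioo 0 T) : x t .y < 2 := by
  have hT : 0 < T := ht.1.trans ht.2
  obtain ⟨δ, hδ, hp⟩ := hx.exists_mul_f_lt_p P hT (c := ε / (2 * 2))
    (by nlinarith [P.ε_pos, mul_nonneg P.D_nonneg P.ε_pos.le, P.two_le_cast])
  have hv : Tendsto (fun t => K + ε * x t .v - (ε / (2 * 2)) ^ 2 * x t .f ^ 2) (𝓝[>] 0) (𝓝 K) := by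
    simpa using ((hx.tendsto_v.const_mul ε).const_add K).sub
      ((hx.tendsto_f.pow 2).const_mul ((ε / (2 * 2)) ^ 2))
  have hhf : Tendsto (fun t => x t .h * x t .f) (𝓝[>] 0) (𝓝 0) := by
    simpa using hx.tendsto_h.mul hx.tendsto_f
  have hsmall : ∀ᶠ a in 𝓝[>] 0, a ∈ Ioo 0 (min δ t) := Ioo_mem_nhdsGT (lt_min hδ.1 ht.1)
  obtain ⟨a, hya, hhfa, hva, ha⟩ :=
    ((hx.tendsto_y.eventually_lt_const one_lt_two).and <| (hhf.eventually_lt_const two_pos).and <|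
      (hv.eventually_const_lt hK).and hsmall).exists
  have haδ : a ∈ Ioo 0 δ := ⟨ha.1, ha.2.trans_le (min_le_left _ _)⟩
  have hat : a ∈ Ioo 0 t := ⟨ha.1, ha.2.trans_le (min_le_right _ _)⟩
  exact (hx.trapped_of_trapped P one_lt_two hat.1 ⟨hya, hp a haδ, hhfa, hva⟩
    ⟨hat.2.le, ht.2⟩).y_lt

lemma f_le_of_y_le {a A c : ℝ} (hx : IsReducedSolution N D ε K T x) (hc : c ≠ 0) (ha : 0 < a)
    (hfa : x a .f ≤ A / c * Real.exp (c * a)) (ht : t ∈ Ico a T)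
    (hy : ∀ s ∈ Ioo a t, x s .y ≤ A * Real.exp (c * s)) : x t .f ≤ A / c * Real.exp (c * t) := by
  have hmono := le_of_hasDerivAt_nonneg (g := fun s => A / c * Real.exp (c * s) - x s .f) ht.1
    (fun s hs => ((hasDerivAt_const_mul c).exp.const_mul (A / c)).fun_sub
      (hx.hasDerivAt_f ⟨ha.trans_le hs.1, hs.2.trans_lt ht.2⟩))
    fun s hs => by
      calc 0 ≤ A * Real.exp (c * s) - x s .y := sub_nonneg.2 (hy s hs)
        _ = A / c * (Real.exp (c * s) * c) - x s .y := by field_simp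
  exact sub_nonneg.1 ((sub_nonneg.2 hfa).trans hmono)

lemma reducedField_y_lt_of_y_eq {z : State} (P : Params N D ε K) (ht : 0 < t) (hf : 0 < z .f)
    (hp : 0 < z .p) (hh : 0 < z .h) (hy : z .y = 2 * Real.exp ((1 + ε) * t))
    (hle : z .f ≤ 2 / (1 + ε) * Real.exp ((1 + ε) * t)) :
    reducedField N D ε K z .y < 2 * (Real.exp ((1 + ε) * t) * (1 + ε)) := by
  have hε := P.ε_pos
  have hexp : 1 < Real.exp ((1 + ε) * t) := Real.one_lt_exp_iff.2 (by positivity)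
  have hdrift : 0 ≤ (z .p + D * z .h) * z .y :=
    mul_nonneg (add_nonneg hp.le (mul_nonneg P.D_nonneg hh.le)) (by rw [hy]; positivity)
  have hcurv : (N - 1 : ℝ) * (1 - z .y ^ 2) / z .f ≤ 0 :=
    div_nonpos_of_nonpos_of_nonneg (mul_nonpos_of_nonneg_of_nonpos (by linarith [P.two_le_cast])
      (by rw [hy]; nlinarith)) hf.le
  have hgrowth : ε / 2 * z .f ≤ Real.exp ((1 + ε) * t) := by
    calc ε / 2 * z .f ≤ ε / 2 * (2 / (1 + ε) * Real.exp ((1 + ε) * t)) := by gcongr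
      _ = ε / (1 + ε) * Real.exp ((1 + ε) * t) := by field_simp
      _ ≤ Real.exp ((1 + ε) * t) := mul_le_of_le_one_left (Real.exp_pos _).le
        ((div_le_one (by positivity)).2 (by linarith))
  simp only [reducedField]
  nlinarith

lemma y_lt_exp_and_f_le_exp (hx : IsReducedSolution N D ε K T x) (P : Params N D ε K)
    (ht : t ∈ Ioo 0 T) :
    x t .y < 2 * Real.exp ((1 + ε) * t) ∧ x t .f ≤ 2 / (1 + ε) * Real.exp ((1 + ε) * t) := by
  have hε := P.ε_pos
  have hsmall : ∀ᶠ a in 𝓝[>] 0, a ∈ Ioo 0 t := Ioo_mem_nhdsGT ht.1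
  obtain ⟨a, hya, hfa, ha⟩ := ((hx.tendsto_y.eventually_lt_const one_lt_two).and <|
    (hx.tendsto_f.eventually_lt_const (show 0 < 2 / (1 + ε) by positivity)).and hsmall).exists
  have hexp : 1 ≤ Real.exp ((1 + ε) * a) :=
    Real.one_le_exp (mul_nonneg (by positivity) ha.1.le)
  have hsub : ∀ s ∈ Ico a T, s ∈ Ioo 0 T := fun s hs => ⟨ha.1.trans_le hs.1, hs.2⟩
  have hf_le : ∀ s ∈ Ico a T, (∀ r ∈ Ico a s, 0 < 2 * Real.exp ((1 + ε) * r) - x r .y) →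
      x s .f ≤ 2 / (1 + ε) * Real.exp ((1 + ε) * s) := fun s hs hr =>
    hx.f_le_of_y_le (by positivity) ha.1
      (hfa.le.trans (le_mul_of_one_le_right (by positivity) hexp)) hs
      fun r hr' => (sub_pos.1 (hr r (Ioo_subset_Ico_self hr'))).le
  have hy := forall_pos_of_deriv_pos_at_first_zero (ι := Unit)
    (φ := fun _ s => 2 * Real.exp ((1 + ε) * s) - x s .y)
    (fun _ s hs => ((hasDerivAt_const_mul (1 + ε)).exp.const_mul 2).fun_sub
      (hx.hasDerivAt_y (hsub s hs))) (fun _ => by linarith) fun s hs hbefore _ _ hzero => by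
      have hs' := hsub s (Ioo_subset_Ico_self hs)
      exact sub_pos.2 (reducedField_y_lt_of_y_eq P hs'.1 (hx.pos_f s hs') (hx.pos_p P hs')
        (hx.pos_h P hs') (sub_eq_zero.1 hzero).symm
        (hf_le s (Ioo_subset_Ico_self hs) fun r hr => hbefore r hr ()))
  have hta : t ∈ Ico a T := ⟨ha.2.le, ht.2⟩
  exact ⟨sub_pos.1 (hy t hta ()), hf_le t hta fun r hr => hy r ⟨hr.1, hr.2.trans ht.2⟩ ()⟩

lemma h_le (hx : IsReducedSolution N D ε K T x) (P : Params N D ε K) (ht : t ∈ Ioo 0 T) :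
    x t .h ≤ ε / 2 * t := by
  have hid : Tendsto (fun t : ℝ => ε / 2 * t) (𝓝[>] 0) (𝓝 0) := by
    simpa using (tendsto_nhdsWithin_of_tendsto_nhds (tendsto_id (x := 𝓝 (0 : ℝ)))).const_mul (ε / 2)
  refine sub_nonneg.1 (le_of_hasDerivAt_nonneg_of_tendsto (g := fun t => ε / 2 * t - x t .h)
    (fun s hs => (hasDerivAt_const_mul (ε / 2)).fun_sub (hx.hasDerivAt_h hs)) (fun s hs => ?_)
    (by simpa using hid.sub hx.tendsto_h) ht)
  linarith [mul_pos (hx.pos_reducedMean P hs) (hx.pos_h P hs)]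

lemma p_add_v_le (hx : IsReducedSolution N D ε K T x) (P : Params N D ε K) (ht : t ∈ Ioo 0 T) :
    x t .p + x t .v ≤ K * Real.exp ((1 + ε) * t) := by
  have hderiv : ∀ s, HasDerivAt (fun s => Real.exp (-(1 + ε) * s))
      (Real.exp (-(1 + ε) * s) * -(1 + ε)) s := fun s => (hasDerivAt_const_mul (-(1 + ε))).exp
  have hlim : Tendsto (fun t => -(Real.exp (-(1 + ε) * t) * (K + (x t .p + x t .v)))) (𝓝[>] 0)
      (𝓝 (-K)) := by
    have hexp : Tendsto (fun t => Real.exp (-(1 + ε) * t)) (𝓝[>] 0)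
        (𝓝 (Real.exp (-(1 + ε) * 0))) :=
      (hderiv 0).continuousAt.tendsto.mono_left nhdsWithin_le_nhds
    simpa using (hexp.mul ((hx.tendsto_p.add hx.tendsto_v).const_add K)).neg
  have hle : Real.exp (-(1 + ε) * t) * (K + (x t .p + x t .v)) ≤ K := neg_le_neg_iff.1 <|
    le_of_hasDerivAt_nonneg_of_tendsto (fun s hs => ((hderiv s).fun_mul
      (((hx.hasDerivAt_p hs).fun_add (hx.hasDerivAt_v hs)).const_add K)).fun_neg) (fun s hs => by
      have hrate : 0 ≤ (1 + ε) * (K + (x s .p + x s .v))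
          - (-reducedMean N D (x s) * x s .p + (K + ε * x s .v) + x s .p) := by
        nlinarith [mul_pos (hx.pos_reducedMean P hs) (hx.pos_p P hs), hx.pos_v P hs,
          mul_pos P.ε_pos (hx.pos_p P hs), mul_pos P.ε_pos P.K_pos]
      linarith [mul_nonneg (Real.exp_pos (-(1 + ε) * s)).le hrate]) hlim ht
  rw [neg_mul, Real.exp_neg, inv_mul_le_iff₀ (Real.exp_pos _)] at hle
  linarith [P.K_pos]

end IsReducedSolution

/-! ### Asymptotics of global solutions -/

/-- The quotient of `N - 1 + c + ε/2 f²` by `K + ε v = K - ε u`. The derivatives of numerator and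
denominator are `ε f f'` and `-ε u'`, so its limit at infinity is that of `f f' / (-u')`; the shift
`c` is there to produce bounds from both sides. -/
noncomputable def growthRatio (N : ℕ) (ε K c : ℝ) (z : State) : ℝ :=
  (N - 1 + ε / 2 * z .f ^ 2 + c) / (K + ε * z .v)

/-- The numerator of the derivative of `growthRatio` along solutions, up to the factor `ε`. -/
noncomputable def growthDefect (N : ℕ) (ε K c : ℝ) (z : State) : ℝ :=
  z .f * z .y * (K + ε * z .v) - z .p * (N - 1 + ε / 2 * z .f ^ 2 + c)

lemma growthRatio_eq_add (N : ℕ) (ε K c : ℝ) (z : State) :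
    growthRatio N ε K c z = growthRatio N ε K 0 z + c / (K + ε * z .v) := by
  simp only [growthRatio, add_zero, add_div]

namespace IsReducedSolution

variable {N : ℕ} {D ε K T t : ℝ} {x : ℝ → State}

lemma hasDerivAt_growthDefect (hx : IsReducedSolution N D ε K T x) (c : ℝ) (ht : t ∈ Ioo 0 T) :
    HasDerivAt (fun t => growthDefect N ε K c (x t))
      (-reducedMean N D (x t) * growthDefect N ε K c (x t)
        + (2 * x t .y ^ 2 - c) * (K + ε * x t .v)) t := by
  have hf := (hx.pos_f t ht).ne'
  refine ((((hx.hasDerivAt_f ht).fun_mul (hx.hasDerivAt_y ht)).fun_mul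
    (((hx.hasDerivAt_v ht).const_mul ε).const_add K)).fun_sub
    ((hx.hasDerivAt_p ht).fun_mul (((((hx.hasDerivAt_f ht).fun_pow 2).const_mul
      (ε / 2)).const_add ((N : ℝ) - 1)).add_const c))).congr_deriv ?_
  simp only [reducedMean, growthDefect]
  field_simp
  ring

lemma tendsto_growthDefect (hx : IsReducedSolution N D ε K T x) (c : ℝ) :
    Tendsto (fun t => growthDefect N ε K c (x t)) (𝓝[>] 0) (𝓝 0) := by
  simpa using! ((hx.tendsto_f.mul hx.tendsto_y).mul ((hx.tendsto_v.const_mul ε).const_add K)).sub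
    (hx.tendsto_p.mul ((((hx.tendsto_f.pow 2).const_mul (ε / 2)).const_add ((N : ℝ) - 1)).add_const
      c))

lemma growthDefect_zero_nonneg (hx : IsReducedSolution N D ε K T x) (P : Params N D ε K)
    (ht : t ∈ Ioo 0 T) : 0 ≤ growthDefect N ε K 0 (x t) := by
  refine nonneg_of_neg_mul_le_deriv (fun s hs => hx.hasDerivAt_growthDefect 0 hs)
    (fun s hs => (hx.pos_reducedMean P hs).le) (fun s hs => ?_) (hx.tendsto_growthDefect 0) ht
  have := hx.pos_add_mul_v P hs
  exact le_add_of_nonneg_right (by rw [sub_zero]; positivity)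

lemma growthDefect_nonpos (hx : IsReducedSolution N D ε K T x) (P : Params N D ε K) {c : ℝ}
    (hc : ∀ s ∈ Ioo 0 T, 2 * x s .y ^ 2 ≤ c) (ht : t ∈ Ioo 0 T) :
    growthDefect N ε K c (x t) ≤ 0 := by
  refine neg_nonneg.1 (nonneg_of_neg_mul_le_deriv
    (fun s hs => (hx.hasDerivAt_growthDefect c hs).fun_neg)
    (fun s hs => (hx.pos_reducedMean P hs).le) (fun s hs => ?_)
    (by simpa using (hx.tendsto_growthDefect c).neg) ht)
  linarith [mul_nonneg (sub_nonneg.2 (hc s hs)) (hx.pos_add_mul_v P hs).le]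

lemma hasDerivAt_growthRatio (hx : IsReducedSolution N D ε K T x) (P : Params N D ε K) (c : ℝ)
    (ht : t ∈ Ioo 0 T) :
    HasDerivAt (fun t => growthRatio N ε K c (x t))
      (ε * growthDefect N ε K c (x t) / (K + ε * x t .v) ^ 2) t := by
  refine ((((((hx.hasDerivAt_f ht).fun_pow 2).const_mul (ε / 2)).const_add
    ((N : ℝ) - 1)).add_const c).fun_div (((hx.hasDerivAt_v ht).const_mul ε).const_add K)
    (hx.pos_add_mul_v P ht).ne').congr_deriv ?_
  simp only [growthDefect]
  ring

lemma tendsto_growthRatio_zero (hx : IsReducedSolution N D ε K T x) (hK : K ≠ 0) (c : ℝ) :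
    Tendsto (fun t => growthRatio N ε K c (x t)) (𝓝[>] 0) (𝓝 ((N - 1 + c) / K)) := by
  simpa using! ((((hx.tendsto_f.pow 2).const_mul (ε / 2)).const_add ((N : ℝ) - 1)).add_const c).div
    ((hx.tendsto_v.const_mul ε).const_add K) (by simpa using hK)

lemma deriv_growthRatio_zero_nonneg (hx : IsReducedSolution N D ε K T x) (P : Params N D ε K)
    (ht : t ∈ Ioo 0 T) : 0 ≤ ε * growthDefect N ε K 0 (x t) / (K + ε * x t .v) ^ 2 :=
  div_nonneg (mul_nonneg P.ε_pos.le (hx.growthDefect_zero_nonneg P ht)) (sq_nonneg _)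

lemma deriv_growthRatio_nonpos (hx : IsReducedSolution N D ε K T x) (P : Params N D ε K) {c : ℝ}
    (hc : ∀ s ∈ Ioo 0 T, 2 * x s .y ^ 2 ≤ c) (ht : t ∈ Ioo 0 T) :
    ε * growthDefect N ε K c (x t) / (K + ε * x t .v) ^ 2 ≤ 0 :=
  div_nonpos_of_nonpos_of_nonneg
    (mul_nonpos_of_nonneg_of_nonpos P.ε_pos.le (hx.growthDefect_nonpos P hc ht)) (sq_nonneg _)

lemma le_growthRatio_zero (hx : IsReducedSolution N D ε K T x) (P : Params N D ε K)
    (ht : t ∈ Ioo 0 T) : (N - 1) / K ≤ growthRatio N ε K 0 (x t) := by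
  simpa using le_of_hasDerivAt_nonneg_of_tendsto (fun s hs => hx.hasDerivAt_growthRatio P 0 hs)
    (fun s hs => hx.deriv_growthRatio_zero_nonneg P hs)
    (hx.tendsto_growthRatio_zero P.K_pos.ne' 0) ht

lemma growthRatio_le (hx : IsReducedSolution N D ε K T x) (P : Params N D ε K) {c : ℝ}
    (hc : ∀ s ∈ Ioo 0 T, 2 * x s .y ^ 2 ≤ c) (ht : t ∈ Ioo 0 T) :
    growthRatio N ε K c (x t) ≤ (N - 1 + c) / K :=
  neg_le_neg_iff.1 <| le_of_hasDerivAt_nonneg_of_tendsto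
    (fun _ hs => (hx.hasDerivAt_growthRatio P c hs).fun_neg)
    (fun _ hs => neg_nonneg.2 (hx.deriv_growthRatio_nonpos P hc hs))
    (hx.tendsto_growthRatio_zero P.K_pos.ne' c).neg ht

lemma reducedMean_le_add {s : ℝ} (hx : IsReducedSolution N D ε K T x) (P : Params N D ε K)
    (hs : 0 < s) (hst : s ≤ t) (ht : t < T) :
    reducedMean N D (x t) ≤ reducedMean N D (x s) + ε / 2 * (t - s) := by
  have hmono := le_of_hasDerivAt_nonneg (g := fun r => ε / 2 * r - reducedMean N D (x r)) hst
    (fun r hr => (hasDerivAt_const_mul (ε / 2)).fun_sub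
      (hx.hasDerivAt_reducedMean P ⟨hs.trans_le hr.1, hr.2.trans_lt ht⟩)) fun r _ => by
      have hD := mul_nonneg P.D_nonneg (sq_nonneg (x r .h))
      have hN : 0 ≤ (N : ℝ) * (x r .y / x r .f) ^ 2 := by positivity
      linarith
  linarith

lemma sqrt_le_p_add {q : ℝ} (hx : IsReducedSolution N D ε K T x) (P : Params N D ε K)
    (ht : t ∈ Ioo 0 T) (hy : x t .y / x t .f ≤ q) (hh : x t .h ≤ q) :
    √(K + ε * x t .v) ≤ x t .p + (N + D) * q := by
  have hN := P.two_le_cast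
  have hD := P.D_nonneg
  have hsq : K + ε * x t .v ≤ reducedMean N D (x t) ^ 2 := by
    have hcurv : 0 ≤ (N : ℝ) * (N - 1) / x t .f ^ 2 :=
      div_nonneg (mul_nonneg (by linarith) (by linarith)) (sq_nonneg _)
    have hconst : 0 ≤ (N + D - 1) * (ε / 2) := mul_nonneg (by linarith) (half_pos P.ε_pos).le
    have hsum : 0 ≤ (N : ℝ) * (x t .y / x t .f) ^ 2 + D * x t .h ^ 2 := by positivity
    linarith [hx.conservation P ht]
  calc √(K + ε * x t .v) ≤ reducedMean N D (x t) :=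
        Real.sqrt_le_iff.2 ⟨(hx.pos_reducedMean P ht).le, hsq⟩
    _ ≤ x t .p + N * q + D * q := by unfold reducedMean; gcongr
    _ = x t .p + (N + D) * q := by ring

lemma p_sq_le {q b : ℝ} (hx : IsReducedSolution N D ε K T x) (P : Params N D ε K)
    (ht : t ∈ Ioo 0 T) (hy : x t .y / x t .f ≤ q) (hh : x t .h ≤ q) (hb : 0 < b)
    (hf : b ≤ x t .f) :
    x t .p ^ 2 ≤ K + ε * x t .v
      + ((N + D) * q ^ 2 + N * (N - 1) / b ^ 2 + (N + D - 1) * (ε / 2)) := by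
  have hN := P.two_le_cast
  have hD := P.D_nonneg
  have hyf : 0 < x t .y / x t .f := div_pos (hx.pos_y P ht) (hx.pos_f t ht)
  have hh0 := hx.pos_h P ht
  have hp : x t .p ^ 2 ≤ reducedMean N D (x t) ^ 2 := by
    refine pow_le_pow_left₀ (hx.pos_p P ht).le ?_ 2
    have hsum : 0 ≤ N * (x t .y / x t .f) + D * x t .h := by positivity
    unfold reducedMean
    linarith
  have hysq : (N : ℝ) * (x t .y / x t .f) ^ 2 ≤ N * q ^ 2 := by gcongr
  have hhsq : D * x t .h ^ 2 ≤ D * q ^ 2 := by gcongr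
  have hcurv : (N : ℝ) * (N - 1) / x t .f ^ 2 ≤ N * (N - 1) / b ^ 2 :=
    div_le_div_of_nonneg_left (mul_nonneg (by linarith) (by linarith)) (by positivity)
      (pow_le_pow_left₀ hb.le hf 2)
  linarith [hx.conservation P ht]

end IsReducedSolution

lemma mem_Ioo_zero_add_one {t : ℝ} (ht : 0 < t) : t ∈ Ioo 0 (t + 1) := ⟨ht, lt_add_one t⟩

lemma exists_tendsto_of_monotoneOn_of_antitoneOn {g h : ℝ → ℝ} {a : ℝ}
    (hg : MonotoneOn g (Ioi a)) (hh : AntitoneOn h (Ioi a)) (hgh : ∀ t ∈ Ioi a, g t ≤ h t) :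
    ∃ l, Tendsto g atTop (𝓝 l) ∧ ∀ t ∈ Ioi a, g t ≤ l ∧ l ≤ h t := by
  have hbound : ∀ t ∈ Ioi a, h t ∈ upperBounds (g '' Ioi a) := by
    rintro t ht _ ⟨s, hs, rfl⟩
    have hmax : max s t ∈ Ioi a := mem_Ioi.2 (lt_max_of_lt_left hs)
    exact (hg hs hmax (le_max_left s t)).trans <|
      (hgh _ hmax).trans (hh ht hmax (le_max_right s t))
  have ha : a + 1 ∈ Ioi a := lt_add_one a
  have hne : (g '' Ioi a).Nonempty := ⟨_, mem_image_of_mem g ha⟩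
  have hle : ∀ t ∈ Ioi a, g t ≤ sSup (g '' Ioi a) := fun t ht =>
    le_csSup ⟨_, hbound _ ha⟩ (mem_image_of_mem g ht)
  refine ⟨sSup (g '' Ioi a), tendsto_order.2 ⟨fun l hl => ?_, fun l hl => ?_⟩, fun t ht =>
    ⟨hle t ht, csSup_le hne (hbound t ht)⟩⟩
  · obtain ⟨_, ⟨s, hs, rfl⟩, hls⟩ := exists_lt_of_lt_csSup hne hl
    filter_upwards [eventually_ge_atTop s] with t ht
    exact hls.trans_le (hg hs (lt_of_lt_of_le hs ht) ht)
  · filter_upwards [eventually_gt_atTop a] with t ht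
    exact (hle t ht).trans_lt hl

/-- Solutions of the reduced system on `(0, ∞)` with a smoothly collapsing sphere at `0`. -/
def IsGlobalReducedSolution (N : ℕ) (D ε K : ℝ) (x : ℝ → State) : Prop :=
  ∀ T, IsReducedSolution N D ε K T x

namespace IsGlobalReducedSolution

variable {N : ℕ} {D ε K B t t₀ : ℝ} {x : ℝ → State}

lemma exists_le_p_mul (hx : IsGlobalReducedSolution N D ε K x) (P : Params N D ε K) :
    ∃ c > 0, ∀ t, 1 ≤ t → c ≤ x t .p * t := by
  have hpos : ∀ {t : ℝ}, 1 ≤ t → 0 < t := fun ht => zero_lt_one.trans_le ht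
  set a := reducedMean N D (x 1) + ε
  have ha : 0 < a :=
    add_pos ((hx 2).pos_reducedMean P ⟨one_pos, one_lt_two⟩) P.ε_pos
  have hM : ∀ t, 1 ≤ t → reducedMean N D (x t) ≤ a * t := fun t ht => by
    have hM₁ := (hx 2).pos_reducedMean P ⟨one_pos, one_lt_two⟩
    have hle := (hx (t + 1)).reducedMean_le_add P one_pos ht (lt_add_one t)
    nlinarith [P.ε_pos]
  obtain ⟨c, hc, hc'⟩ := exists_between
    (lt_min ((hx 2).pos_p P ⟨one_pos, one_lt_two⟩) (div_pos P.K_pos ha))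
  have hac : a * c < K := (lt_div_iff₀' ha).1 (hc'.trans_le (min_le_right _ _))
  refine ⟨c, hc, fun t ht => (sub_pos.1 ?_).le⟩
  refine forall_pos_of_deriv_pos_at_first_zero (ι := Unit) (φ := fun _ s => x s .p * s - c)
    (fun _ s hs => (((hx _).hasDerivAt_p (mem_Ioo_zero_add_one (hpos hs.1))).fun_mul
      (hasDerivAt_id s)).sub_const c)
    (fun _ => by simpa using hc'.trans_le (min_le_left _ _)) (fun s hs _ _ _ hzero => ?_)
    t ⟨ht, lt_add_one t⟩ ()
  have hs : 1 ≤ s := hs.1.le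
  have hs' := mem_Ioo_zero_add_one (hpos hs)
  have hMp : reducedMean N D (x s) * (x s .p * s) ≤ a * c * s := by
    rw [sub_eq_zero.1 hzero, mul_right_comm]
    exact mul_le_mul_of_nonneg_right (hM s hs) hc.le
  simp only [id]
  nlinarith [(hx _).pos_p P hs', mul_pos P.ε_pos ((hx _).pos_v P hs')]

lemma tendsto_v (hx : IsGlobalReducedSolution N D ε K x) (P : Params N D ε K) :
    Tendsto (fun t => x t .v) atTop atTop := by
  obtain ⟨c, hc, hp⟩ := hx.exists_le_p_mul P
  have hlog : ∀ t, 1 ≤ t → c * Real.log t ≤ x t .v := fun t ht => by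
    have hmono := le_of_hasDerivAt_nonneg (g := fun t => x t .v - c * Real.log t) ht
      (fun s hs => ((hx _).hasDerivAt_v (mem_Ioo_zero_add_one (one_pos.trans_le hs.1))).fun_sub
        ((Real.hasDerivAt_log (one_pos.trans_le hs.1).ne').const_mul c)) fun s hs => by
        rw [sub_nonneg, ← div_eq_mul_inv, div_le_iff₀ (one_pos.trans hs.1)]
        exact hp s hs.1.le
    simp only [Real.log_one] at hmono
    linarith [(hx 2).pos_v P ⟨one_pos, one_lt_two⟩]
  exact tendsto_atTop_mono' atTop ((eventually_ge_atTop 1).mono hlog)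
    (Real.tendsto_log_atTop.const_mul_atTop hc)

lemma tendsto_add_mul_v (hx : IsGlobalReducedSolution N D ε K x) (P : Params N D ε K) :
    Tendsto (fun t => K + ε * x t .v) atTop atTop :=
  tendsto_atTop_add_const_left _ _ ((hx.tendsto_v P).const_mul_atTop P.ε_pos)

lemma tendsto_div_add_mul_v (hx : IsGlobalReducedSolution N D ε K x) (P : Params N D ε K) (a : ℝ) :
    Tendsto (fun t => a / (K + ε * x t .v)) atTop (𝓝 0) :=
  tendsto_const_nhds.div_atTop (hx.tendsto_add_mul_v P)

lemma exists_trapped (hx : IsGlobalReducedSolution N D ε K x) (P : Params N D ε K) :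
    ∃ B t₀, 1 < B ∧ 0 < t₀ ∧ Trapped N D ε K B (x t₀) := by
  obtain ⟨t, hv, ht⟩ := (((hx.tendsto_add_mul_v P).eventually_gt_atTop
    ((N + D + 1) * (ε / 2))).and (eventually_gt_atTop 0)).exists
  have hp := (hx (t + 1)).pos_p P (mem_Ioo_zero_add_one ht)
  have hlim : Tendsto (fun B : ℝ => ε / (2 * B)) atTop (𝓝 0) :=
    tendsto_const_nhds.div_atTop (tendsto_id.const_mul_atTop two_pos)
  have hf : Tendsto (fun B : ℝ => ε / (2 * B) * x t .f) atTop (𝓝 0) := by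
    simpa using hlim.mul_const (x t .f)
  have hfsq : Tendsto (fun B : ℝ => K + ε * x t .v - (ε / (2 * B)) ^ 2 * x t .f ^ 2) atTop
      (𝓝 (K + ε * x t .v)) := by
    simpa using ((hlim.pow 2).mul_const (x t .f ^ 2)).const_sub (K + ε * x t .v)
  obtain ⟨B, hB, hyB, hpB, hhB, hvB⟩ := ((eventually_gt_atTop 1).and <|
    (eventually_gt_atTop (x t .y)).and <| (hf.eventually_lt_const hp).and <|
    (eventually_gt_atTop (x t .h * x t .f)).and (hfsq.eventually_const_lt hv)).exists
  exact ⟨B, t, hB, ht, hyB, hpB, hhB, hvB⟩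

lemma y_le_of_trapped (hx : IsGlobalReducedSolution N D ε K x) (P : Params N D ε K) (hB : 1 < B)
    (ht₀ : 0 < t₀) (h : Trapped N D ε K B (x t₀)) (ht : 0 < t) :
    x t .y ≤ max B (2 * Real.exp ((1 + ε) * t₀)) := by
  have htT := mem_Ioo_zero_add_one ht
  rcases le_or_gt t₀ t with hle | hlt
  · exact le_max_of_le_left ((hx _).trapped_of_trapped P hB ht₀ h ⟨hle, htT.2⟩).y_lt.le
  · have hε := P.ε_pos
    exact le_max_of_le_right (((hx _).y_lt_exp_and_f_le_exp P htT).1.le.trans (by gcongr))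

lemma two_mul_y_sq_le_of_trapped (hx : IsGlobalReducedSolution N D ε K x) (P : Params N D ε K)
    (hB : 1 < B) (ht₀ : 0 < t₀) (h : Trapped N D ε K B (x t₀)) (ht : 0 < t) :
    2 * x t .y ^ 2 ≤ 2 * max B (2 * Real.exp ((1 + ε) * t₀)) ^ 2 :=
  mul_le_mul_of_nonneg_left (pow_le_pow_left₀ ((hx _).pos_y P (mem_Ioo_zero_add_one ht)).le
    (hx.y_le_of_trapped P hB ht₀ h ht) 2) zero_le_two

lemma exists_tendsto_growthRatio {c : ℝ} (hx : IsGlobalReducedSolution N D ε K x)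
    (P : Params N D ε K) (hc : ∀ t, 0 < t → 2 * x t .y ^ 2 ≤ c) :
    ∃ S, Tendsto (fun t => growthRatio N ε K 0 (x t)) atTop (𝓝 S) ∧
      ∀ t ∈ Ioi 0, growthRatio N ε K 0 (x t) ≤ S ∧ S ≤ growthRatio N ε K c (x t) := by
  have hc₀ : 0 ≤ c := le_trans (by positivity) (hc 1 one_pos)
  have hmono : MonotoneOn (fun t => growthRatio N ε K 0 (x t)) (Ioi 0) :=
    monotoneOn_of_hasDerivAt_nonneg (convex_Ioi 0)
      (fun t ht => (hx _).hasDerivAt_growthRatio P 0 (mem_Ioo_zero_add_one ht))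
      fun t ht => (hx _).deriv_growthRatio_zero_nonneg P (mem_Ioo_zero_add_one ht)
  have hanti : AntitoneOn (fun t => growthRatio N ε K c (x t)) (Ioi 0) := by
    simpa using! (monotoneOn_of_hasDerivAt_nonneg (convex_Ioi 0)
      (fun t ht => ((hx _).hasDerivAt_growthRatio P c (mem_Ioo_zero_add_one ht)).fun_neg)
      fun t ht => neg_nonneg.2 ((hx _).deriv_growthRatio_nonpos P (fun s hs => hc s hs.1)
        (mem_Ioo_zero_add_one ht))).neg
  refine exists_tendsto_of_monotoneOn_of_antitoneOn hmono hanti fun t ht => ?_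
  rw [growthRatio_eq_add N ε K c]
  exact le_add_of_nonneg_right
    (div_nonneg hc₀ ((hx _).pos_add_mul_v P (mem_Ioo_zero_add_one ht)).le)

lemma tendsto_growthRatio_of_tendsto {S : ℝ} (hx : IsGlobalReducedSolution N D ε K x)
    (P : Params N D ε K) (hS : Tendsto (fun t => growthRatio N ε K 0 (x t)) atTop (𝓝 S)) (c : ℝ) :
    Tendsto (fun t => growthRatio N ε K c (x t)) atTop (𝓝 S) := by
  simpa [growthRatio_eq_add N ε K c] using hS.add (hx.tendsto_div_add_mul_v P c)

lemma le_limit_growthRatio {S : ℝ} (hx : IsGlobalReducedSolution N D ε K x) (P : Params N D ε K)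
    (hS : Tendsto (fun t => growthRatio N ε K 0 (x t)) atTop (𝓝 S)) : (N - 1) / K ≤ S := by
  refine ge_of_tendsto hS ?_
  filter_upwards [eventually_gt_atTop 0] with t ht
  exact (hx _).le_growthRatio_zero P (mem_Ioo_zero_add_one ht)

lemma bounds_of_trapped (hx : IsGlobalReducedSolution N D ε K x) (P : Params N D ε K)
    (hB : 1 < B) (ht₀ : 0 < t₀) (h : Trapped N D ε K B (x t₀)) (ht : t₀ ≤ t) :
    x t₀ .f ≤ x t .f ∧ x t .y / x t .f ≤ B / x t₀ .f ∧ x t .h ≤ B / x t₀ .f := by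
  have hpos : ∀ {s}, t₀ ≤ s → s ∈ Ioo 0 (s + 1) := fun hs => mem_Ioo_zero_add_one (ht₀.trans_le hs)
  have hB₀ : 0 < B := zero_lt_one.trans hB
  have hf₀ := (hx _).pos_f t₀ (hpos le_rfl)
  have hmono : x t₀ .f ≤ x t .f := le_of_hasDerivAt_nonneg (g := fun t => x t .f) ht
    (fun s hs => (hx _).hasDerivAt_f (hpos hs.1))
    fun s hs => ((hx _).pos_y P (hpos hs.1.le)).le
  have htrap := (hx _).trapped_of_trapped P hB ht₀ h ⟨ht, lt_add_one t⟩
  refine ⟨hmono, div_le_div₀ hB₀.le htrap.y_lt.le hf₀ hmono, (le_div_iff₀ hf₀).2 ?_⟩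
  exact (mul_le_mul_of_nonneg_left hmono ((hx _).pos_h P (hpos ht)).le).trans htrap.h_mul_f_lt.le

lemma tendsto_p_div_sqrt (hx : IsGlobalReducedSolution N D ε K x) (P : Params N D ε K) :
    Tendsto (fun t => x t .p / √(K + ε * x t .v)) atTop (𝓝 1) := by
  obtain ⟨B, t₀, hB, ht₀, htrap⟩ := hx.exists_trapped P
  set b := x t₀ .f
  set q := B / b
  set c := (N + D) * q ^ 2 + N * (N - 1) / b ^ 2 + (N + D - 1) * (ε / 2)
  have hlower : Tendsto (fun t => 1 - (N + D) * q / √(K + ε * x t .v)) atTop (𝓝 1) := by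
    simpa using (tendsto_const_nhds.div_atTop
      (Real.tendsto_sqrt_atTop.comp (hx.tendsto_add_mul_v P))).const_sub 1
  have hupper : Tendsto (fun t => √(1 + c / (K + ε * x t .v))) atTop (𝓝 1) := by
    simpa using ((hx.tendsto_div_add_mul_v P c).const_add 1).sqrt
  refine tendsto_of_tendsto_of_tendsto_of_le_of_le' hlower hupper ?_ ?_
  all_goals
    filter_upwards [eventually_ge_atTop t₀] with t ht
    obtain ⟨hf, hy, hh⟩ := hx.bounds_of_trapped P hB ht₀ htrap ht
    have htT := mem_Ioo_zero_add_one (ht₀.trans_le ht)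
    have hv := (hx _).pos_add_mul_v P htT
    have hsqrt := Real.sqrt_pos.2 hv
  · rw [le_div_iff₀ hsqrt, sub_mul, div_mul_cancel₀ _ hsqrt.ne', one_mul, sub_le_iff_le_add]
    exact (hx _).sqrt_le_p_add P htT hy hh
  · refine Real.le_sqrt_of_sq_le ?_
    rw [div_pow, Real.sq_sqrt hv.le, div_le_iff₀ hv, add_mul, div_mul_cancel₀ _ hv.ne', one_mul]
    exact (hx _).p_sq_le P htT hy hh ((hx _).pos_f t₀ (mem_Ioo_zero_add_one ht₀)) hf

lemma tendsto_f_mul_y_div_p {c S : ℝ} (hx : IsGlobalReducedSolution N D ε K x)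
    (P : Params N D ε K) (hc : ∀ t, 0 < t → 2 * x t .y ^ 2 ≤ c)
    (hS : Tendsto (fun t => growthRatio N ε K 0 (x t)) atTop (𝓝 S)) :
    Tendsto (fun t => x t .f * x t .y / x t .p) atTop (𝓝 S) := by
  refine tendsto_of_tendsto_of_tendsto_of_le_of_le' hS (hx.tendsto_growthRatio_of_tendsto P hS c)
    ?_ ?_
  all_goals
    filter_upwards [eventually_gt_atTop 0] with t ht
    have htT := mem_Ioo_zero_add_one ht
    have hp := (hx _).pos_p P htT
    have hv := (hx _).pos_add_mul_v P htT
  · have hdefect := (hx _).growthDefect_zero_nonneg P htT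
    rw [growthDefect] at hdefect
    rw [growthRatio, div_le_div_iff₀ hv hp]
    linarith
  · have hdefect := (hx _).growthDefect_nonpos P (fun s hs => hc s hs.1) htT
    rw [growthDefect] at hdefect
    rw [growthRatio, div_le_div_iff₀ hp hv]
    linarith

lemma tendsto_f_div_sqrt {S : ℝ} (hx : IsGlobalReducedSolution N D ε K x) (P : Params N D ε K)
    (hS : Tendsto (fun t => growthRatio N ε K 0 (x t)) atTop (𝓝 S)) :
    Tendsto (fun t => x t .f / √(K + ε * x t .v)) atTop (𝓝 √(2 / ε * S)) := by
  have hε := P.ε_pos.ne'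
  have hsq : Tendsto (fun t => x t .f ^ 2 / (K + ε * x t .v)) atTop (𝓝 (2 / ε * S)) := by
    have hlim := (hS.sub (hx.tendsto_div_add_mul_v P ((N : ℝ) - 1))).const_mul (2 / ε)
    rw [sub_zero] at hlim
    refine hlim.congr fun t => ?_
    rw [growthRatio, add_zero, add_div, add_sub_cancel_left]
    field_simp
  refine hsq.sqrt.congr' ?_
  filter_upwards [eventually_gt_atTop 0] with t ht
  have htT := mem_Ioo_zero_add_one ht
  rw [Real.sqrt_div' _ ((hx _).pos_add_mul_v P htT).le, Real.sqrt_sq ((hx _).pos_f t htT).le]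

lemma tendsto_y {S : ℝ} (hx : IsGlobalReducedSolution N D ε K x) (P : Params N D ε K)
    (hS : Tendsto (fun t => growthRatio N ε K 0 (x t)) atTop (𝓝 S)) :
    Tendsto (fun t => x t .y) atTop (𝓝 √(ε * S / 2)) := by
  obtain ⟨B, t₀, hB, ht₀, htrap⟩ := hx.exists_trapped P
  have hε := P.ε_pos
  have hS₀ : 0 < S :=
    (div_pos (by linarith [P.two_le_cast]) P.K_pos).trans_le (hx.le_limit_growthRatio P hS)
  have hlim := (hx.tendsto_f_mul_y_div_p P
    (fun t ht => hx.two_mul_y_sq_le_of_trapped P hB ht₀ htrap ht) hS).mul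
    ((hx.tendsto_p_div_sqrt P).div (hx.tendsto_f_div_sqrt P hS) (by positivity))
  have hval : S * (1 / √(2 / ε * S)) = √(ε * S / 2) := by
    rw [eq_comm, Real.sqrt_eq_iff_eq_sq (by positivity) (by positivity), mul_pow, div_pow,
      Real.sq_sqrt (by positivity)]
    field_simp
  rw [hval] at hlim
  refine hlim.congr' ?_
  filter_upwards [eventually_gt_atTop 0] with t ht
  have htT := mem_Ioo_zero_add_one ht
  have hsqrt := (Real.sqrt_pos.2 ((hx _).pos_add_mul_v P htT)).ne'
  have hf := ((hx _).pos_f t htT).ne'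
  have hp := ((hx _).pos_p P htT).ne'
  simp only [Pi.div_apply]
  field_simp

end IsGlobalReducedSolution

/-! ### The reduced system near the collapsing sphere -/

/-- The nonlinearity `Q` of the reduced system in the singular variables
`w = (b, η, p, h, θ)` given by `f = t (1 + 2 b)`, `f' = 1 + η`, `-u = 2 t θ`, in which it reads
`t w' + (k + 1) w = Q(t, K, w)`. With these factors `2` the linearization of `Q` at the initial
value is a contraction. -/
noncomputable def singularField (N : ℕ) (D ε : ℝ) (z : (ℝ × ℝ) × State) : State
  | .f => z.2 .y / 2
  | .y => 2 * (N - 1) * z.2 .y + z.1.1 * (-(z.2 .p + D * z.2 .h) * (1 + z.2 .y)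
      + ε / 2 * z.1.1 * (1 + 2 * z.2 .f)) + (N - 1) * (1 - (1 + z.2 .y) ^ 2) / (1 + 2 * z.2 .f)
  | .p => N * z.2 .p - N * z.2 .p * (1 + z.2 .y) / (1 + 2 * z.2 .f)
      + z.1.1 * (-z.2 .p * (z.2 .p + D * z.2 .h) + z.1.2 + 2 * ε * z.1.1 * z.2 .v)
  | .h => N * z.2 .h - N * z.2 .h * (1 + z.2 .y) / (1 + 2 * z.2 .f)
      + z.1.1 * (-z.2 .h * (z.2 .p + D * z.2 .h) + ε / 2)
  | .v => z.2 .p / 2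

/-- The exponents `k` for which the reduced system reads `t w' + (k + 1) w = Q(t, K, w)` in the
singular variables. The subtraction is not truncated, as `2 ≤ N`. -/
def singularExponent (N : ℕ) : Coord → ℕ
  | .f => 0
  | .y => 2 * N - 3
  | .p => N - 1
  | .h => N - 1
  | .v => 0

/-- The state with the given singular variables at time `t`. -/
noncomputable def ofSingular (t : ℝ) (w : State) : State
  | .f => t * (1 + 2 * w .f)
  | .y => 1 + w .y
  | .p => w .p
  | .h => w .h
  | .v => 2 * t * w .v

/-- The singular variables of a state at time `t ≠ 0`. -/
noncomputable def toSingular (t : ℝ) (x : State) : State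
  | .f => (x .f / t - 1) / 2
  | .y => x .y - 1
  | .p => x .p
  | .h => x .h
  | .v => x .v / (2 * t)

lemma ofSingular_toSingular {t : ℝ} (ht : t ≠ 0) (x : State) :
    ofSingular t (toSingular t x) = x := by
  funext i
  cases i <;> simp only [ofSingular, toSingular] <;> field_simp <;> ring

lemma ofSingular_zero_zero : ofSingular 0 0 = Pi.single .y 1 := by
  funext i
  cases i <;> simp [ofSingular]

lemma continuous_ofSingular {X : Type*} [TopologicalSpace X] {t : X → ℝ} {w : X → State}
    (ht : Continuous t) (hw : Continuous w) : Continuous fun a => ofSingular (t a) (w a) := by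
  refine continuous_pi fun i => ?_
  cases i <;> simp only [ofSingular] <;> fun_prop

lemma contDiffAt_singularField (N : ℕ) (D ε K : ℝ) :
    ContDiffAt ℝ 1 (singularField N D ε) ((0, K), 0) := by
  refine contDiffAt_pi.2 fun i => ?_
  cases i <;> simp only [singularField] <;>
    fun_prop (disch := simp)

lemma fderiv_singularField (N : ℕ) (D ε K : ℝ) (w : State) :
    fderiv ℝ (singularField N D ε) ((0, K), 0) (0, w)
      = fun | .f => w .y / 2 | .v => w .p / 2 | _ => 0 := by
  have hdiff := (contDiffAt_singularField N D ε K).differentiableAt one_ne_zero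
  refine (hdiff.hasFDerivAt.hasLineDerivAt (0, w)).unique (hasDerivAt_pi.2 fun i => ?_)
  have hlin : ∀ j, HasDerivAt (fun s => s * w j) (w j) 0 := fun j => hasDerivAt_mul_const (w j)
  have hden : HasDerivAt (fun s => 1 + 2 * (s * w .f)) (2 * w .f) 0 :=
    ((hlin .f).const_mul 2).const_add 1
  have hquot : ∀ j, HasDerivAt (fun s => N * (s * w j) * (1 + s * w .y) / (1 + 2 * (s * w .f)))
      (N * w j) 0 := fun j => by
    simpa using (((hlin j).const_mul (N : ℝ)).fun_mul ((hlin .y).const_add 1)).fun_div hden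
      (by simp)
  cases i
  all_goals simp only [singularField, Prod.smul_mk, Prod.mk_add_mk, smul_zero, add_zero,
    zero_add, Pi.smul_apply, smul_eq_mul, zero_mul, mul_zero]
  case f => exact (hlin .y).div_const 2
  case v => exact (hlin .p).div_const 2
  case y =>
    refine (((hlin .y).const_mul (2 * ((N : ℝ) - 1))).fun_add
      (((((hlin .y).const_add 1).fun_pow 2).const_sub 1 |>.const_mul ((N : ℝ) - 1)).fun_div hden
        (by simp))).congr_deriv ?_
    simp
    ring
  case p => simpa using ((hlin .p).const_mul (N : ℝ)).fun_sub (hquot .p)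
  case h => simpa using ((hlin .h).const_mul (N : ℝ)).fun_sub (hquot .h)

lemma norm_fderiv_singularField_le (N : ℕ) (D ε K : ℝ) (w : State) :
    ‖fderiv ℝ (singularField N D ε) ((0, K), 0) (0, w)‖ ≤ 1 / 2 * ‖w‖ := by
  rw [fderiv_singularField]
  refine (pi_norm_le_iff_of_nonneg (by positivity)).2 fun i => ?_
  have hy := norm_le_pi_norm w .y
  have hp := norm_le_pi_norm w .p
  cases i <;> simp only [norm_div, norm_zero, Real.norm_ofNat] <;> linarith [norm_nonneg w]

lemma singularField_zero (N : ℕ) (D ε K : ℝ) : singularField N D ε ((0, K), 0) = 0 := by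
  funext i
  cases i <;> simp [singularField]

lemma cast_singularExponent_add_one {N : ℕ} (hN : 2 ≤ N) (i : Coord) :
    (singularExponent N i : ℝ) + 1
      = match i with | .f => 1 | .y => 2 * (N - 1) | .p => N | .h => N | .v => 1 := by
  obtain ⟨m, rfl⟩ := Nat.exists_eq_add_of_le hN
  cases i
  all_goals simp only [singularExponent]
  case y => rw [show 2 * (2 + m) - 3 = 2 * m + 1 by omega]; push_cast; ring
  case p => rw [show 2 + m - 1 = m + 1 by omega]; push_cast; ring
  case h => rw [show 2 + m - 1 = m + 1 by omega]; push_cast; ring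
  all_goals simp

lemma hasDerivAt_ofSingular {N : ℕ} (hN : 2 ≤ N) {D ε K : ℝ} {w : ℝ → State} {t : ℝ}
    (ht : t ≠ 0) (hf : 1 + 2 * w t .f ≠ 0)
    (hw : ∀ i, HasDerivAt (fun t => w t i)
      ((singularField N D ε ((t, K), w t) i - (singularExponent N i + 1) * w t i) / t) t) :
    HasDerivAt (fun t => ofSingular t (w t)) (reducedField N D ε K (ofSingular t (w t))) t := by
  simp only [cast_singularExponent_add_one hN] at hw
  refine hasDerivAt_pi.2 fun i => ?_
  cases i
  case f => refine ((hasDerivAt_id t).mul (((hw .f).const_mul 2).const_add 1)).congr_deriv ?_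
            simp only [reducedField, ofSingular, singularField, id]
            field_simp
            ring
  case y => refine ((hw .y).const_add 1).congr_deriv ?_
            simp only [reducedField, ofSingular, singularField]
            field_simp
            ring
  case p => refine (hw .p).congr_deriv ?_
            simp only [reducedField, reducedMean, ofSingular, singularField]
            field_simp
            ring
  case h => refine (hw .h).congr_deriv ?_
            simp only [reducedField, reducedMean, ofSingular, singularField]
            field_simp
            ring
  case v => refine (((hasDerivAt_id t).const_mul 2).mul (hw .v)).congr_deriv ?_
            simp only [reducedField, ofSingular, singularField, id]
            field_simp
            ring

namespace IsReducedSolution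

variable {N : ℕ} {D ε K T : ℝ} {x : ℝ → State}

lemma hasDerivAt_toSingular (hx : IsReducedSolution N D ε K T x) (hN : 2 ≤ N) {t : ℝ}
    (ht : t ∈ Ioo 0 T) (i : Coord) :
    HasDerivAt (fun t => toSingular t (x t) i)
      ((singularField N D ε ((t, K), toSingular t (x t)) i
        - (singularExponent N i + 1) * toSingular t (x t) i) / t) t := by
  have ht₀ := ht.1.ne'
  have hf := (hx.pos_f t ht).ne'
  have hb : 1 + 2 * ((x t .f / t - 1) / 2) = x t .f / t := by ring
  rw [cast_singularExponent_add_one hN]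
  cases i
  case f => refine ((((hx.hasDerivAt_f ht).fun_div (hasDerivAt_id t) ht₀).sub_const 1).div_const
              2).congr_deriv ?_
            simp only [toSingular, singularField, id]
            field_simp
            ring
  case y => refine ((hx.hasDerivAt_y ht).sub_const 1).congr_deriv ?_
            simp only [toSingular, singularField, hb]
            field_simp
            ring
  case p => refine (hx.hasDerivAt_p ht).congr_deriv ?_
            simp only [toSingular, singularField, reducedMean, hb]
            field_simp
            ring
  case h => refine (hx.hasDerivAt_h ht).congr_deriv ?_
            simp only [toSingular, singularField, reducedMean, hb]
            field_simp
            ring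
  case v => refine ((hx.hasDerivAt_v ht).fun_div ((hasDerivAt_id t).const_mul 2)
              (mul_ne_zero two_ne_zero ht₀)).congr_deriv ?_
            simp only [toSingular, singularField, id]
            field_simp

lemma tendsto_f_div (hx : IsReducedSolution N D ε K T x) (hT : 0 < T) :
    Tendsto (fun t => x t .f / t) (𝓝[>] 0) (𝓝 1) :=
  HasDerivAt.lhopital_zero_nhdsGT (g' := fun _ => 1)
    (eventually_of_mem (Ioo_mem_nhdsGT hT) fun t ht => hx.hasDerivAt_f ht)
    (.of_forall hasDerivAt_id) (.of_forall fun _ => one_ne_zero)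
    hx.tendsto_f (tendsto_id.mono_left nhdsWithin_le_nhds) (by simpa using hx.tendsto_y)

lemma tendsto_v_div (hx : IsReducedSolution N D ε K T x) (hT : 0 < T) :
    Tendsto (fun t => x t .v / t) (𝓝[>] 0) (𝓝 0) :=
  HasDerivAt.lhopital_zero_nhdsGT (g' := fun _ => 1)
    (eventually_of_mem (Ioo_mem_nhdsGT hT) fun t ht => hx.hasDerivAt_v ht)
    (.of_forall hasDerivAt_id) (.of_forall fun _ => one_ne_zero)
    hx.tendsto_v (tendsto_id.mono_left nhdsWithin_le_nhds) (by simpa using hx.tendsto_p)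

lemma tendsto_toSingular (hx : IsReducedSolution N D ε K T x) (hT : 0 < T) :
    Tendsto (fun t => toSingular t (x t)) (𝓝[>] 0) (𝓝 0) := by
  refine tendsto_pi_nhds.2 fun i => ?_
  cases i
  case f => simpa [toSingular] using ((hx.tendsto_f_div hT).sub_const 1).div_const 2
  case y => simpa [toSingular] using hx.tendsto_y.sub_const 1
  case p => exact hx.tendsto_p
  case h => exact hx.tendsto_h
  case v => simpa [toSingular, div_div, mul_comm] using (hx.tendsto_v_div hT).div_const 2

end IsReducedSolution

lemma exists_singularField_lipschitz (N : ℕ) (D ε K₀ : ℝ) :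
    ∃ ρ > 0, ContinuousOn (singularField N D ε) (Metric.closedBall ((0, K₀), 0) ρ) ∧
      ∀ z w w', (z, w) ∈ Metric.closedBall ((0, K₀), 0) ρ →
        (z, w') ∈ Metric.closedBall ((0, K₀), 0) ρ →
        ‖singularField N D ε (z, w) - singularField N D ε (z, w')‖ ≤ (3 / 4 : ℝ) * ‖w - w'‖ :=
  exists_closedBall_partial_lipschitz (contDiffAt_singularField N D ε K₀) (by norm_num)
    (norm_fderiv_singularField_le N D ε K₀)

theorem exists_local_family {N : ℕ} (hN : 2 ≤ N) (D ε K₀ : ℝ) :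
    ∃ δ > 0, ∃ x : ℝ → ℝ → State,
      (∀ K ∈ Metric.closedBall K₀ δ, IsReducedSolution N D ε K δ (x K)) ∧
      ∀ t, Continuous fun K => x K t := by
  obtain ⟨ρ, hρ, hcont, hlip⟩ := exists_singularField_lipschitz N D ε K₀
  obtain ⟨δ, hδ, w, hw, hw₀, hsol⟩ := exists_singular_solution (c := 3 / 4) (singularExponent N) hρ
    (by rw [← NNReal.coe_lt_coe]; norm_num) hcont (by simpa using hlip) (singularField_zero N D ε)
  have hden : ∀ᶠ z in 𝓝 ((0 : ℝ), K₀), 0 < 1 + 2 * w z .f := by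
    have : Tendsto (fun z => 1 + 2 * w z .f) (𝓝 ((0 : ℝ), K₀)) (𝓝 (1 + 2 * w (0, K₀) .f)) :=
      Continuous.tendsto (by fun_prop) _
    rw [hw₀ K₀ (Metric.mem_closedBall_self hδ.le)] at this
    exact this.eventually_const_lt (by simp)
  obtain ⟨r, hr, hball⟩ := Metric.nhds_basis_closedBall.mem_iff.1 hden
  refine ⟨min δ r, lt_min hδ hr, fun K t => ofSingular t (w (t, K)), fun K hK => ?_,
    fun t => continuous_ofSingular continuous_const (by fun_prop)⟩
  have hKδ : K ∈ Metric.closedBall K₀ δ := Metric.closedBall_subset_closedBall (min_le_left _ _) hK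
  have hpos : ∀ t ∈ Ioo 0 (min δ r), 0 < 1 + 2 * w (t, K) .f := fun t ht => hball <| by
    rw [Metric.mem_closedBall, Prod.dist_eq, Real.dist_0_eq_abs, abs_of_pos ht.1]
    exact max_le (ht.2.le.trans (min_le_right _ _)) (hK.trans (min_le_right _ _))
  refine ⟨fun t ht => hasDerivAt_ofSingular hN ht.1.ne' (hpos t ht).ne'
    (hsol t ⟨ht.1, ht.2.le.trans (min_le_left _ _)⟩ K hKδ),
    fun t ht => mul_pos ht.1 (hpos t ht), ?_⟩
  have hlim := (continuous_ofSingular continuous_id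
    (by fun_prop : Continuous fun t => w (t, K))).tendsto 0
  simp only [id, hw₀ K hKδ, ofSingular_zero_zero] at hlim
  exact hlim.mono_left nhdsWithin_le_nhds

theorem IsReducedSolution.exists_eqOn {N : ℕ} (hN : 2 ≤ N) {D ε K T : ℝ} (hT : 0 < T)
    {x x' : ℝ → State} (hx : IsReducedSolution N D ε K T x)
    (hx' : IsReducedSolution N D ε K T x') : ∃ δ ∈ Ioc 0 T, EqOn x x' (Ioo 0 δ) := by
  obtain ⟨ρ, hρ, -, hlip⟩ := exists_singularField_lipschitz N D ε K
  have hmem : ∀ {x}, IsReducedSolution N D ε K T x →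
      ∀ᶠ t in 𝓝[>] 0, ((t, K), toSingular t (x t)) ∈ Metric.closedBall (((0 : ℝ), K), 0) ρ :=
    fun hx => ((((tendsto_id.mono_left nhdsWithin_le_nhds).prodMk_nhds
      tendsto_const_nhds).prodMk_nhds (hx.tendsto_toSingular hT)).eventually
      (Metric.closedBall_mem_nhds _ hρ))
  obtain ⟨δ, hδ, hsub⟩ := (mem_nhdsGT_iff_exists_mem_Ioc_Ioo_subset hT).1 ((hmem hx).and (hmem hx'))
  have hT' : ∀ {t}, t ∈ Ioo 0 δ → t ∈ Ioo 0 T := fun ht => Ioo_subset_Ioo_right hδ.2 ht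
  refine ⟨δ, hδ, fun t ht => ?_⟩
  have heq := singular_solution_unique (c := 3 / 4) (w := fun t => toSingular t (x t))
    (w' := fun t => toSingular t (x' t)) (by rw [← NNReal.coe_lt_coe]; norm_num)
    (fun t ht => by simpa using hlip (t, K) _ _ (hsub ht).1 (hsub ht).2)
    (fun t ht i => hx.hasDerivAt_toSingular hN (hT' ht) i)
    (fun t ht i => hx'.hasDerivAt_toSingular hN (hT' ht) i)
    (hx.tendsto_toSingular hT) (hx'.tendsto_toSingular hT) ht
  simpa only [ofSingular_toSingular ht.1.ne'] using congrArg (ofSingular t) heq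

/-! ### Global existence and dependence on the parameter -/

/-- The states with `c ≤ f` and norm at most `R`: for `0 < c` a convex compact set on which the
reduced system is regular. -/
def stateBox (c R : ℝ) : Set State := {z | c ≤ z .f} ∩ Metric.closedBall 0 R

lemma convex_stateBox (c R : ℝ) : Convex ℝ (stateBox c R) :=
  (convex_halfSpace_ge (LinearMap.proj (R := ℝ) (φ := fun _ : Coord => ℝ) .f).isLinear c).inter
    (convex_closedBall _ _)

lemma isCompact_stateBox (c R : ℝ) : IsCompact (stateBox c R) :=
  (isCompact_closedBall _ _).inter_left (isClosed_le continuous_const (continuous_apply _))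

lemma contDiffAt_reducedField (N : ℕ) (D ε K : ℝ) {z : State} (hz : z .f ≠ 0) {n : ℕ∞ω} :
    ContDiffAt ℝ n (reducedField N D ε K) z := by
  refine contDiffAt_pi.2 fun i => ?_
  cases i <;> simp only [reducedField, reducedMean] <;> fun_prop (disch := assumption)

lemma exists_lipschitzOnWith_reducedField (N : ℕ) (D ε K : ℝ) {c : ℝ} (hc : 0 < c) (R : ℝ) :
    ∃ L, LipschitzOnWith L (reducedField N D ε K) (stateBox c R) :=
  ContDiffOn.exists_lipschitzOnWith (n := 1)
    (fun _ hz => (contDiffAt_reducedField N D ε K (hc.trans_le hz.1).ne').contDiffWithinAt)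
    one_ne_zero (convex_stateBox c R) (isCompact_stateBox c R)

lemma dist_reducedField_le (N : ℕ) (D ε K K' : ℝ) (z : State) :
    dist (reducedField N D ε K z) (reducedField N D ε K' z) ≤ |K - K'| := by
  refine (dist_pi_le_iff (abs_nonneg _)).2 fun i => ?_
  cases i <;> simp [reducedField, Real.dist_eq]

/-- A bound for the norm of a solution of the reduced system up to time `T`. -/
noncomputable def stateBound (ε K T : ℝ) : ℝ := (2 + K) * Real.exp ((1 + ε) * T) + ε / 2 * T

namespace IsReducedSolution

variable {N : ℕ} {D ε K T : ℝ} {x x' : ℝ → State}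

lemma f_le_f (hx : IsReducedSolution N D ε K T x) (P : Params N D ε K) {s t : ℝ} (hs : 0 < s)
    (hst : s ≤ t) (ht : t < T) : x s .f ≤ x t .f :=
  le_of_hasDerivAt_nonneg (g := fun t => x t .f) hst
    (fun _ hr => hx.hasDerivAt_f ⟨hs.trans_le hr.1, hr.2.trans_lt ht⟩)
    (fun _ hr => (hx.pos_y P ⟨hs.trans hr.1, hr.2.trans ht⟩).le)

lemma norm_le_stateBound (hx : IsReducedSolution N D ε K T x) (P : Params N D ε K) {t : ℝ}
    (ht : t ∈ Ioo 0 T) : ‖x t‖ ≤ stateBound ε K T := by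
  have hε := P.ε_pos
  have hK := P.K_pos
  have hT : 0 < T := ht.1.trans ht.2
  set E := Real.exp ((1 + ε) * T) with hE
  have hE₀ : 0 < E := Real.exp_pos _
  have hexp : Real.exp ((1 + ε) * t) ≤ E := by
    rw [hE]; gcongr; exact ht.2.le
  obtain ⟨hy, hf⟩ := hx.y_lt_exp_and_f_le_exp P ht
  have hf' : x t .f ≤ 2 * E := hf.trans <|
    mul_le_mul (div_le_self two_pos.le (by linarith)) hexp (Real.exp_pos _).le two_pos.le
  have hh : x t .h ≤ ε / 2 * T := (hx.h_le P ht).trans (by gcongr; exact ht.2.le)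
  have hpv : x t .p + x t .v ≤ K * E := (hx.p_add_v_le P ht).trans (by gcongr)
  have hfpos := hx.pos_f t ht
  have hypos := hx.pos_y P ht
  have hppos := hx.pos_p P ht
  have hhpos := hx.pos_h P ht
  have hvpos := hx.pos_v P ht
  have : 0 < ε / 2 * T := by positivity
  have : 0 < K * E := by positivity
  refine (pi_norm_le_iff_of_nonneg (by unfold stateBound; positivity)).2 fun i => ?_
  rw [Real.norm_eq_abs, stateBound, ← hE, add_mul]
  cases i <;> rw [abs_of_pos (by assumption)] <;> linarith

lemma mem_stateBox (hx : IsReducedSolution N D ε K T x) (P : Params N D ε K) {a t : ℝ}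
    (ha : 0 < a) (ht : t ∈ Ico a T) : x t ∈ stateBox (x a .f) (stateBound ε K T) :=
  ⟨hx.f_le_f P ha ht.1 ht.2,
    mem_closedBall_zero_iff.2 (hx.norm_le_stateBound P ⟨ha.trans_le ht.1, ht.2⟩)⟩

theorem eqOn (hx : IsReducedSolution N D ε K T x) (hx' : IsReducedSolution N D ε K T x')
    (P : Params N D ε K) : EqOn x x' (Ioo 0 T) := by
  intro t ht
  obtain ⟨δ, ⟨hδ, hδT⟩, hnear⟩ := hx.exists_eqOn P.two_le (ht.1.trans ht.2) hx'
  rcases lt_or_ge t δ with h | h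
  · exact hnear ⟨ht.1, h⟩
  obtain ⟨a, ha, haδ⟩ := exists_between hδ
  have haa : x a = x' a := hnear ⟨ha, haδ⟩
  obtain ⟨L, hL⟩ := exists_lipschitzOnWith_reducedField N D ε K
    (hx.pos_f a ⟨ha, haδ.trans_le hδT⟩) (stateBound ε K T)
  have hsub : Icc a t ⊆ Ioo 0 T := fun s hs => ⟨ha.trans_le hs.1, hs.2.trans_lt ht.2⟩
  have hsub' : Ico a t ⊆ Ico a T := Ico_subset_Ico_right ht.2.le
  exact ODE_solution_unique_of_mem_Icc_right (v := fun _ => reducedField N D ε K)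
    (s := fun _ => stateBox (x a .f) (stateBound ε K T)) (fun _ _ => hL)
    (HasDerivAt.continuousOn fun s hs => hx.ode s (hsub hs))
    (fun s hs => (hx.ode s (hsub (Ico_subset_Icc_self hs))).hasDerivWithinAt)
    (fun s hs => hx.mem_stateBox P ha (hsub' hs))
    (HasDerivAt.continuousOn fun s hs => hx'.ode s (hsub hs))
    (fun s hs => (hx'.ode s (hsub (Ico_subset_Icc_self hs))).hasDerivWithinAt)
    (fun s hs => haa ▸ hx'.mem_stateBox P ha (hsub' hs)) haa ⟨haδ.le.trans h, le_rfl⟩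

lemma exists_tendsto_nhdsLT (hx : IsReducedSolution N D ε K T x) (P : Params N D ε K)
    (hT : 0 < T) : ∃ z : State, 0 < z .f ∧ Tendsto x (𝓝[<] T) (𝓝 z) := by
  obtain ⟨a, ha, haT⟩ := exists_between hT
  have hpos := hx.pos_f a ⟨ha, haT⟩
  set B := stateBox (x a .f) (stateBound ε K T)
  have hmem : ∀ t ∈ Ico a T, x t ∈ B := fun t ht => hx.mem_stateBox P ha ht
  obtain ⟨C, hC⟩ := (isCompact_stateBox _ _).exists_bound_of_continuousOn fun z (hz : z ∈ B) =>
    (contDiffAt_reducedField N D ε K (n := 0)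
      (hpos.trans_le hz.1).ne').continuousAt.continuousWithinAt
  have hlip : LipschitzOnWith C.toNNReal x (Ico a T) :=
    (convex_Ico a T).lipschitzOnWith_of_nnnorm_hasDerivWithin_le
      (fun t ht => (hx.ode t ⟨ha.trans_le ht.1, ht.2⟩).hasDerivWithinAt)
      fun t ht => (hC _ (hmem t ht)).trans (Real.le_coe_toNNReal C)
  obtain ⟨g, hg, hgx⟩ := hlip.extend_pi
  have hlim : Tendsto x (𝓝[<] T) (𝓝 (g T)) := by
    refine ((hg.continuous.tendsto T).mono_left nhdsWithin_le_nhds).congr' ?_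
    filter_upwards [Ico_mem_nhdsLT haT] with t ht using (hgx ht).symm
  have hgT : g T ∈ B := (isCompact_stateBox _ _).isClosed.mem_of_tendsto hlim <| by
    filter_upwards [Ico_mem_nhdsLT haT] with t ht using hmem t ht
  exact ⟨g T, hpos.trans_le hgT.1, hlim⟩

end IsReducedSolution

section Gluing

variable {E : Type*} [NormedAddCommGroup E] [NormedSpace ℝ E] {F : E → E} {x β : ℝ → E}
  {a b T : ℝ}

lemma hasDerivAt_ite_lt (hx : ∀ t ∈ Ioo a T, HasDerivAt x (F (x t)) t) (haT : a < T)
    (hxT : Tendsto x (𝓝[<] T) (𝓝 (β T))) (hβ : ∀ t ∈ Ico T b, HasDerivAt β (F (β t)) t)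
    (hF : ContinuousAt F (β T)) {t : ℝ} (ht : t ∈ Ioo a b) :
    HasDerivAt (fun t => if t < T then x t else β t) (F (if t < T then x t else β t)) t := by
  set z : ℝ → E := fun t => if t < T then x t else β t
  have hleft : ∀ t < T, z =ᶠ[𝓝 t] x := fun t ht => by
    filter_upwards [Iio_mem_nhds ht] with s hs using if_pos hs
  have hright : EqOn z β (Ici T) := fun s hs => if_neg (not_lt.2 hs)
  have hode : ∀ t ∈ Ioo a T, HasDerivAt z (F (x t)) t := fun t ht =>
    (hx t ht).congr_of_eventuallyEq (hleft t ht.2)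
  rcases lt_trichotomy t T with h | rfl | h
  · simpa only [if_pos h] using hode t ⟨ht.1, h⟩
  · rw [if_neg (lt_irrefl t)]
    have hIic : HasDerivWithinAt z (F (β t)) (Iic t) t := by
      refine hasDerivWithinAt_Iic_of_tendsto_deriv
        (fun s hs => (hode s hs).differentiableAt.differentiableWithinAt) ?_
        (Ioo_mem_nhdsLT haT) ((hF.tendsto.comp hxT).congr' ?_)
      · rw [ContinuousWithinAt, hright self_mem_Ici]
        refine (hxT.mono_left (nhdsWithin_mono _ fun s hs => hs.2)).congr' ?_
        filter_upwards [self_mem_nhdsWithin] with s hs using (if_pos hs.2).symm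
      · filter_upwards [Ioo_mem_nhdsLT haT] with s hs using (hode s hs).deriv.symm
    have hIci : HasDerivWithinAt z (F (β t)) (Ici t) t :=
      (hβ t ⟨le_rfl, ht.2⟩).hasDerivWithinAt.congr hright (hright self_mem_Ici)
    simpa only [Iic_union_Ici, hasDerivWithinAt_univ] using hIic.union hIci
  · rw [if_neg h.not_gt]
    exact (hβ t ⟨h.le, ht.2⟩).congr_of_eventuallyEq (hright.eventuallyEq_of_mem (Ici_mem_nhds h))

end Gluing

namespace IsReducedSolution

variable {N : ℕ} {D ε K T : ℝ} {x : ℝ → State}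

theorem exists_extension (hx : IsReducedSolution N D ε K T x) (P : Params N D ε K) (hT : 0 < T) :
    ∃ T' > T, ∃ x', IsReducedSolution N D ε K T' x' := by
  obtain ⟨z, hz, hxz⟩ := hx.exists_tendsto_nhdsLT P hT
  have hF := contDiffAt_reducedField N D ε K (n := 1) hz.ne'
  obtain ⟨β, rfl, r, hr, hβ⟩ :=
    hF.exists_forall_mem_closedBall_exists_eq_forall_mem_Ioo_hasDerivAt₀ T
  have hβT : ContinuousAt β T := (hβ T ⟨by linarith, by linarith⟩).continuousAt
  have hpos : ∀ᶠ t in 𝓝 T, 0 < β t .f :=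
    (hβT.tendsto.apply_nhds .f).eventually_const_lt hz
  obtain ⟨s, hs, hβs⟩ := Metric.eventually_nhds_iff_ball.1 hpos
  rw [Real.ball_eq_Ioo] at hβs
  have hrs := min_le_left r s
  have hsr := min_le_right r s
  refine ⟨T + min r s, lt_add_of_pos_right T (lt_min hr hs), fun t => if t < T then x t else β t,
    fun t ht => hasDerivAt_ite_lt hx.ode hT hxz
      (fun t ht => hβ t ⟨by linarith [ht.1], by linarith [ht.2]⟩) hF.continuousAt ht,
    fun t ht => ?_, hx.tendsto.congr' ?_⟩
  · split_ifs with h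
    · exact hx.pos_f t ⟨ht.1, h⟩
    · exact hβs t ⟨by linarith, by linarith [ht.2]⟩
  · filter_upwards [Ioo_mem_nhdsGT hT] with t ht using (if_pos ht.2).symm

theorem glue (P : Params N D ε K) (hT : 0 < T) {X : ℝ → ℝ → State}
    (hX : ∀ t ∈ Ioo 0 T, ∃ τ > t, IsReducedSolution N D ε K τ (X t)) :
    IsReducedSolution N D ε K T fun t => X t t := by
  choose! τ hτ hXτ using hX
  have heq : ∀ t ∈ Ioo 0 T, ∀ s ∈ Ioo 0 T, s < τ t → X t s = X s s := fun t ht s hs hst =>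
    ((hXτ t ht).mono (min_le_left _ (τ s))).eqOn ((hXτ s hs).mono (min_le_right (τ t) _)) P
      ⟨hs.1, lt_min hst (hτ s hs)⟩
  refine ⟨fun t ht => ?_, fun t ht => (hXτ t ht).pos_f t ⟨ht.1, hτ t ht⟩, ?_⟩
  · refine ((hXτ t ht).ode t ⟨ht.1, hτ t ht⟩).congr_of_eventuallyEq ?_
    filter_upwards [Ioo_mem_nhds ht.1 ht.2, Iio_mem_nhds (hτ t ht)] with s hs hst
      using (heq t ht s hs hst).symm
  · obtain ⟨t, ht⟩ := nonempty_Ioo.2 hT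
    refine (hXτ t ht).tendsto.congr' ?_
    filter_upwards [Ioo_mem_nhdsGT hT, Ioo_mem_nhdsGT (ht.1.trans (hτ t ht))] with s hs hst
      using heq t ht s hs hst.2

theorem exists_on (P : Params N D ε K) (T : ℝ) : ∃ x, IsReducedSolution N D ε K T x := by
  obtain ⟨δ, hδ, x₀, hx₀, -⟩ := exists_local_family P.two_le D ε K
  set S : Set ℝ := {T | ∃ x, IsReducedSolution N D ε K T x}
  have hδS : δ ∈ S := ⟨x₀ K, hx₀ K (Metric.mem_closedBall_self hδ.le)⟩
  by_contra hT
  have hS : BddAbove S := ⟨T, fun T' ⟨y, hy⟩ => le_of_not_ge fun h => hT ⟨y, hy.mono h⟩⟩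
  have hsup : 0 < sSup S := hδ.trans_le (le_csSup hS hδS)
  have hex : ∀ t ∈ Ioo 0 (sSup S), ∃ y, ∃ τ > t, IsReducedSolution N D ε K τ y := fun t ht => by
    obtain ⟨τ, ⟨y, hy⟩, hτ⟩ := exists_lt_of_lt_csSup ⟨δ, hδS⟩ ht.2
    exact ⟨y, τ, hτ, hy⟩
  choose! X hX using hex
  obtain ⟨T', hT', hT'S⟩ := (glue P hsup hX).exists_extension P hsup
  exact (le_csSup hS hT'S).not_gt hT'

end IsReducedSolution

section Parameter

variable {E : Type*} [NormedAddCommGroup E] [NormedSpace ℝ E] {F : ℝ → E → E} {s : Set E}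
  {x : ℝ → ℝ → E} {K₀ a b : ℝ} {L : NNReal}

theorem continuousAt_param_of_lipschitzOnWith (hL : LipschitzOnWith L (F K₀) s)
    (hF : ∀ K, ∀ z ∈ s, dist (F K z) (F K₀ z) ≤ |K - K₀|)
    (hx : ∀ᶠ K in 𝓝 K₀, ∀ t ∈ Icc a b, x K t ∈ s ∧ HasDerivAt (x K) (F K (x K t)) t)
    (hab : a ≤ b) (ha : ContinuousAt (fun K => x K a) K₀) :
    ContinuousAt (fun K => x K b) K₀ := by
  refine tendsto_iff_dist_tendsto_zero.2 <| squeeze_zero'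
    (g := fun K => gronwallBound (dist (x K a) (x K₀ a)) (L + 1 : NNReal) (|K - K₀| + 0) (b - a))
    (Eventually.of_forall fun _ => dist_nonneg) ?_ ?_
  · have hx₀ := hx.self_of_nhds
    filter_upwards [hx] with K hK
    exact dist_le_of_approx_trajectories_ODE_of_mem (v := fun _ => F K₀) (s := fun _ => s)
      (fun _ _ => hL.weaken le_self_add)
      (HasDerivAt.continuousOn fun t ht => (hK t ht).2)
      (fun t ht => (hK t (Ico_subset_Icc_self ht)).2.hasDerivWithinAt)
      (fun t ht => hF K _ (hK t (Ico_subset_Icc_self ht)).1)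
      (fun t ht => (hK t (Ico_subset_Icc_self ht)).1)
      (HasDerivAt.continuousOn fun t ht => (hx₀ t ht).2)
      (fun t ht => (hx₀ t (Ico_subset_Icc_self ht)).2.hasDerivWithinAt)
      (fun _ _ => (dist_self _).le)
      (fun t ht => (hx₀ t (Ico_subset_Icc_self ht)).1) le_rfl b ⟨hab, le_rfl⟩
  · have hne : ((L + 1 : NNReal) : ℝ) ≠ 0 := by positivity
    simp only [gronwallBound_of_K_ne_0 hne]
    have hdist : Tendsto (fun K => dist (x K a) (x K₀ a)) (𝓝 K₀) (𝓝 0) :=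
      tendsto_iff_dist_tendsto_zero.1 ha
    have hK : Tendsto (fun K => |K - K₀| + 0) (𝓝 K₀) (𝓝 0) := by
      simpa using! (show Continuous fun K => |K - K₀| + 0 by fun_prop).tendsto K₀
    simpa using (hdist.mul_const _).add ((hK.div_const _).mul_const _)

end Parameter

namespace IsGlobalReducedSolution

variable {N : ℕ} {D ε K : ℝ}

theorem exists_global (P : Params N D ε K) : ∃ x, IsGlobalReducedSolution N D ε K x := by
  choose X hX using fun t => IsReducedSolution.exists_on P (t + 1)
  refine ⟨fun t => X t t, fun T => ?_⟩
  exact (IsReducedSolution.glue P (T := max T 1) (by positivity)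
    fun t _ => ⟨t + 1, lt_add_one t, hX t⟩).mono (le_max_left _ _)

lemma exists_forall_continuousAt_param {x : ℝ → ℝ → State}
    (hx : ∀ K, 0 < K → IsGlobalReducedSolution N D ε K (x K)) (P : Params N D ε K) :
    ∃ δ > 0, ∀ t ∈ Ioo 0 δ, ContinuousAt (fun K => x K t) K := by
  obtain ⟨δ, hδ, z, hz, hzc⟩ := exists_local_family P.two_le D ε K
  refine ⟨δ, hδ, fun t ht => (hzc t).continuousAt.congr ?_⟩
  filter_upwards [lt_mem_nhds P.K_pos, Metric.closedBall_mem_nhds K hδ] with K' hK' hKδ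
  exact (hz K' hKδ).eqOn (hx K' hK' δ) (P.of_pos hK') ht

theorem continuousAt_param {x : ℝ → ℝ → State}
    (hx : ∀ K, 0 < K → IsGlobalReducedSolution N D ε K (x K)) (P : Params N D ε K) {t : ℝ}
    (ht : 0 < t) : ContinuousAt (fun K => x K t) K := by
  obtain ⟨δ, hδ, hsmall⟩ := exists_forall_continuousAt_param hx P
  obtain ⟨a, ha, haδt⟩ := exists_between (lt_min hδ ht)
  obtain ⟨haδ, hat⟩ := lt_min_iff.1 haδt
  have hca := hsmall a ⟨ha, haδ⟩
  obtain ⟨c, hc, hcx⟩ := exists_between ((hx K P.K_pos _).pos_f a (mem_Ioo_zero_add_one ha))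
  obtain ⟨L, hL⟩ := exists_lipschitzOnWith_reducedField N D ε K hc (stateBound ε (K + 1) (t + 1))
  refine continuousAt_param_of_lipschitzOnWith hL
    (fun K' z _ => dist_reducedField_le N D ε K' K z) ?_ hat.le hca
  filter_upwards [lt_mem_nhds P.K_pos, Iic_mem_nhds (lt_add_one K),
    (hca.tendsto.apply_nhds .f).eventually_const_lt hcx] with K' hK' hKK hcK s hs
  have hsT : s ∈ Ico a (t + 1) := ⟨hs.1, hs.2.trans_lt (lt_add_one t)⟩
  obtain ⟨hf, hR⟩ := (hx K' hK' (t + 1)).mem_stateBox (P.of_pos hK') ha hsT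
  refine ⟨⟨hcK.le.trans hf, Metric.closedBall_subset_closedBall ?_ hR⟩,
    (hx K' hK' (t + 1)).ode s ⟨ha.trans_le hs.1, hsT.2⟩⟩
  unfold stateBound
  gcongr
  exact hKK

theorem contDiffOn {x : ℝ → State} (hx : IsGlobalReducedSolution N D ε K x) :
    ContDiffOn ℝ ∞ x (Ioi 0) := by
  have hode : ∀ t ∈ Ioi (0 : ℝ), HasDerivAt x (reducedField N D ε K (x t)) t := fun t ht =>
    (hx (t + 1)).ode t ⟨ht, lt_add_one t⟩
  have hne : ∀ t ∈ Ioi (0 : ℝ), x t .f ≠ 0 := fun t ht =>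
    ((hx (t + 1)).pos_f t ⟨ht, lt_add_one t⟩).ne'
  refine contDiffOn_infty.2 fun n => ?_
  induction n with
  | zero => exact contDiffOn_zero.2 (HasDerivAt.continuousOn hode)
  | succ n ih =>
    rw [Nat.cast_succ, contDiffOn_succ_iff_deriv_of_isOpen isOpen_Ioi]
    refine ⟨fun t ht => (hode t ht).differentiableAt.differentiableWithinAt, by simp, ?_⟩
    exact ContDiffOn.congr (fun t ht => (contDiffAt_reducedField N D ε K
      (hne t ht)).comp_contDiffWithinAt t (ih t ht)) fun t ht => (hode t ht).deriv

end IsGlobalReducedSolution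

/-! ### Realizing every slope at infinity -/

namespace IsGlobalReducedSolution

lemma limit_growthRatio_le {N : ℕ} {D ε K S : ℝ} {x : ℝ → State}
    (hx : IsGlobalReducedSolution N D ε K x) (P : Params N D ε K)
    (hS : Tendsto (fun t => growthRatio N ε K 0 (x t)) atTop (𝓝 S))
    (hK : (N + D + 1) * (ε / 2) < K) : S ≤ (N - 1 + 8) / K := by
  refine le_of_tendsto (hx.tendsto_growthRatio_of_tendsto P hS 8) ?_
  filter_upwards [eventually_gt_atTop 0] with t ht
  refine (hx _).growthRatio_le P (fun s hs => ?_) (mem_Ioo_zero_add_one ht)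
  nlinarith [(hx _).y_lt_two P hK hs, (hx _).pos_y P hs]

section Family

variable {N : ℕ} {D ε K B c t : ℝ} {x : ℝ → ℝ → State}

lemma eventually_trapped (hx : ∀ K, 0 < K → IsGlobalReducedSolution N D ε K (x K))
    (P : Params N D ε K) (ht : 0 < t) (h : Trapped N D ε K B (x K t)) :
    ∀ᶠ K' in 𝓝 K, Trapped N D ε K' B (x K' t) := by
  have hlim : ∀ i, Tendsto (fun K => x K t i) (𝓝 K) (𝓝 (x K t i)) :=
    (continuousAt_param hx P ht).tendsto.apply_nhds
  filter_upwards [(hlim .y).eventually_lt_const h.y_lt,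
    ((hlim .f).const_mul (ε / (2 * B))).eventually_lt (hlim .p) h.lt_p,
    ((hlim .h).mul (hlim .f)).eventually_lt_const h.h_mul_f_lt,
    ((tendsto_id.add ((hlim .v).const_mul ε)).sub
      (((hlim .f).pow 2).const_mul ((ε / (2 * B)) ^ 2))).eventually_const_lt h.lt_add_mul_v]
    with K' hy hp hh hv using ⟨hy, hp, hh, hv⟩

lemma exists_eventually_two_mul_y_sq_le
    (hx : ∀ K, 0 < K → IsGlobalReducedSolution N D ε K (x K)) (P : Params N D ε K) :
    ∃ c, ∀ᶠ K' in 𝓝 K, ∀ t, 0 < t → 2 * x K' t .y ^ 2 ≤ c := by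
  obtain ⟨B, t₀, hB, ht₀, htrap⟩ := (hx K P.K_pos).exists_trapped P
  refine ⟨2 * max B (2 * Real.exp ((1 + ε) * t₀)) ^ 2, ?_⟩
  filter_upwards [eventually_trapped hx P ht₀ htrap, lt_mem_nhds P.K_pos] with K' htrap' hK' t ht
  exact (hx K' hK').two_mul_y_sq_le_of_trapped (P.of_pos hK') hB ht₀ htrap' ht

lemma continuousAt_growthRatio (hx : ∀ K, 0 < K → IsGlobalReducedSolution N D ε K (x K))
    (P : Params N D ε K) (c : ℝ) (ht : 0 < t) :
    ContinuousAt (fun K => growthRatio N ε K c (x K t)) K := by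
  have hcont : ∀ i, ContinuousAt (fun K => x K t i) K :=
    (continuousAt_param hx P ht).tendsto.apply_nhds
  have hne := ((hx K P.K_pos _).pos_add_mul_v P (mem_Ioo_zero_add_one ht)).ne'
  exact (((((hcont .f).pow 2).const_mul (ε / 2)).const_add ((N : ℝ) - 1)).add_const c).div
    (continuousAt_id.add ((hcont .v).const_mul ε)) hne

theorem continuousAt_limit_growthRatio
    (hx : ∀ K, 0 < K → IsGlobalReducedSolution N D ε K (x K)) (P : Params N D ε K) {S : ℝ → ℝ}
    (hS : ∀ K, 0 < K → Tendsto (fun t => growthRatio N ε K 0 (x K t)) atTop (𝓝 (S K))) :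
    ContinuousAt S K := by
  obtain ⟨c, hc⟩ := exists_eventually_two_mul_y_sq_le hx P
  have hbounds : ∀ᶠ K' in 𝓝 K, ∀ t, 0 < t →
      growthRatio N ε K' 0 (x K' t) ≤ S K' ∧ S K' ≤ growthRatio N ε K' c (x K' t) := by
    filter_upwards [hc, lt_mem_nhds P.K_pos] with K' hc hK'
    obtain ⟨S', hS', hb⟩ := (hx K' hK').exists_tendsto_growthRatio (P.of_pos hK') hc
    rwa [tendsto_nhds_unique hS' (hS K' hK')] at hb
  have hSc := (hx K P.K_pos).tendsto_growthRatio_of_tendsto P (hS K P.K_pos) c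
  refine tendsto_order.2 ⟨fun a ha => ?_, fun b hb => ?_⟩
  · obtain ⟨t, hat, ht⟩ :=
      (((hS K P.K_pos).eventually_const_lt ha).and (eventually_gt_atTop 0)).exists
    filter_upwards [hbounds, (continuousAt_growthRatio hx P 0 ht).eventually_const_lt hat]
      with K' hK' haK' using haK'.trans_le (hK' t ht).1
  · obtain ⟨t, htb, ht⟩ := ((hSc.eventually_lt_const hb).and (eventually_gt_atTop 0)).exists
    filter_upwards [hbounds, (continuousAt_growthRatio hx P c ht).eventually_lt_const htb]
      with K' hK' hbK' using (hK' t ht).2.trans_lt hbK'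

end Family

variable {N : ℕ} {D ε : ℝ}

theorem exists_growthRatio_limit_eq (hN : 2 ≤ N) (hD : 0 ≤ D) (hε : 0 < ε) {S₀ : ℝ}
    (hS₀ : 0 < S₀) : ∃ K, Params N D ε K ∧ ∃ x, IsGlobalReducedSolution N D ε K x ∧
      Tendsto (fun t => growthRatio N ε K 0 (x t)) atTop (𝓝 S₀) := by
  have P : ∀ K, 0 < K → Params N D ε K := fun K hK => ⟨hN, hD, hε, hK⟩
  choose! x hx using fun K hK => exists_global (P K hK)
  have hlim : ∀ K, 0 < K →
      ∃ S, Tendsto (fun t => growthRatio N ε K 0 (x K t)) atTop (𝓝 S) := fun K hK => by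
    obtain ⟨c, hc⟩ := exists_eventually_two_mul_y_sq_le hx (P K hK)
    obtain ⟨S, hS, -⟩ := (hx K hK).exists_tendsto_growthRatio (P K hK) hc.self_of_nhds
    exact ⟨S, hS⟩
  choose! S hS using hlim
  have hcont : ContinuousOn S (Ioi 0) := fun K hK =>
    (continuousAt_limit_growthRatio hx (P K hK) hS).continuousWithinAt
  have hN₁ : 0 < (N : ℝ) - 1 := by
    linarith [(P 1 one_pos).two_le_cast]
  set K₁ := ((N : ℝ) - 1) / S₀
  have hK₁ : 0 < K₁ := div_pos hN₁ hS₀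
  obtain ⟨K₂, hK₂, hle⟩ := ((eventually_gt_atTop ((N + D + 1) * (ε / 2))).and
    (eventually_ge_atTop ((N - 1 + 8) / S₀))).exists
  have hK₂₀ : 0 < K₂ := lt_of_le_of_lt (by positivity) hK₂
  obtain ⟨K, hK : 0 < K, rfl⟩ : S₀ ∈ S '' Ioi 0 := by
    refine isPreconnected_Ioi.intermediate_value (a := K₂) (b := K₁) hK₂₀ hK₁ hcont ⟨?_, ?_⟩
    · refine ((hx K₂ hK₂₀).limit_growthRatio_le (P K₂ hK₂₀) (hS K₂ hK₂₀) hK₂).trans ?_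
      rwa [div_le_iff₀ hK₂₀, ← div_le_iff₀' hS₀]
    · simpa only [K₁, div_div_cancel₀ hN₁.ne'] using
        (hx K₁ hK₁).le_limit_growthRatio (P K₁ hK₁) (hS K₁ hK₁)
  exact ⟨K, P K hK, x K, hx K hK, hS K hK⟩

theorem exists_param (hN : 2 ≤ N) (hD : 0 ≤ D) (hε : 0 < ε) {σ : ℝ} (hσ : 0 < σ) :
    ∃ K, Params N D ε K ∧ ∀ x, IsGlobalReducedSolution N D ε K x →
      Tendsto (fun t => x t .y) atTop (𝓝 σ⁻¹) := by
  obtain ⟨K, P, x, hx, hS⟩ :=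
    exists_growthRatio_limit_eq hN hD hε (show 0 < 2 / (ε * σ ^ 2) by positivity)
  have hval : √(ε * (2 / (ε * σ ^ 2)) / 2) = σ⁻¹ := by
    rw [Real.sqrt_eq_iff_eq_sq (by positivity) (by positivity)]
    field_simp
  refine ⟨K, P, fun y hy => (hval ▸ hx.tendsto_y P hS).congr' ?_⟩
  filter_upwards [eventually_gt_atTop 0] with t ht
  rw [(hx _).eqOn (hy _) P (mem_Ioo_zero_add_one ht)]

end IsGlobalReducedSolution

/-! ### Initial behaviour, primitives and changes of time -/

lemma eventually_mul_lt_of_hasDerivAt_neg_mul {p M c : ℝ → ℝ} {T n k a : ℝ} (hT : 0 < T)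
    (hp : ∀ t ∈ Ioo 0 T, HasDerivAt p (-M t * p t + c t) t) (hM : ∀ t ∈ Ioo 0 T, 0 ≤ M t)
    (hMn : Tendsto (fun t => t * M t) (𝓝[>] 0) (𝓝 n)) (hc : Tendsto c (𝓝[>] 0) (𝓝 k))
    (h0 : Tendsto p (𝓝[>] 0) (𝓝 0)) (ha : a * (n + 1) < k) :
    ∀ᶠ t in 𝓝[>] 0, a * t < p t := by
  have hid : Tendsto (fun t : ℝ => t) (𝓝[>] 0) (𝓝 0) := nhdsWithin_le_nhds
  have hgap : Tendsto (fun t => a + a * (t * M t) - c t) (𝓝[>] 0) (𝓝 (a + a * n - k)) :=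
    ((hMn.const_mul a).const_add a).sub hc
  obtain ⟨δ, hδ, hsub⟩ := (mem_nhdsGT_iff_exists_mem_Ioc_Ioo_subset hT).1
    (hgap.eventually_lt_const (by linarith : a + a * n - k < 0))
  have hT' : ∀ t ∈ Ioo 0 δ, t ∈ Ioo 0 T := fun t ht => Ioo_subset_Ioo_right hδ.2 ht
  filter_upwards [Ioo_mem_nhdsGT hδ.1] with t ht
  refine sub_pos.1 (pos_of_neg_mul_lt_deriv (g := fun t => p t - a * t)
    (fun s hs => (hp s (hT' s hs)).fun_sub ((hasDerivAt_id s).const_mul a))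
    (fun s hs => hM s (hT' s hs)) (fun s hs => ?_) (by simpa using h0.sub (hid.const_mul a)) ht)
  have : a + a * (s * M s) - c s < 0 := hsub hs
  linarith

lemma tendsto_div_of_hasDerivAt_neg_mul {p M c : ℝ → ℝ} {T n k : ℝ} (hT : 0 < T)
    (hp : ∀ t ∈ Ioo 0 T, HasDerivAt p (-M t * p t + c t) t) (hM : ∀ t ∈ Ioo 0 T, 0 ≤ M t)
    (hMn : Tendsto (fun t => t * M t) (𝓝[>] 0) (𝓝 n)) (hn : 0 < n + 1)
    (hc : Tendsto c (𝓝[>] 0) (𝓝 k)) (h0 : Tendsto p (𝓝[>] 0) (𝓝 0)) :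
    Tendsto (fun t => p t / t) (𝓝[>] 0) (𝓝 (k / (n + 1))) := by
  refine tendsto_order.2 ⟨fun a ha => ?_, fun a ha => ?_⟩
  · filter_upwards [self_mem_nhdsWithin, eventually_mul_lt_of_hasDerivAt_neg_mul hT hp hM hMn hc h0
      ((lt_div_iff₀ hn).1 ha)] with t ht hlt
    exact (lt_div_iff₀ ht).2 hlt
  · have hneg := eventually_mul_lt_of_hasDerivAt_neg_mul (p := fun t => -p t) (c := fun t => -c t)
      (a := -a) hT (fun t ht => (hp t ht).fun_neg.congr_deriv (by ring)) hM hMn hc.neg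
      (by simpa using h0.neg) (by linarith [(div_lt_iff₀ hn).1 ha])
    filter_upwards [self_mem_nhdsWithin, hneg] with t ht hlt
    exact (div_lt_iff₀ ht).2 (by linarith)

lemma exists_primitive_of_tendsto {h : ℝ → ℝ} {l : ℝ} (hh : ContinuousOn h (Ioi 0))
    (hl : Tendsto h (𝓝[>] 0) (𝓝 l)) :
    ∃ γ : ℝ → ℝ, (∀ t, 0 < t → HasDerivAt γ (h t) t) ∧ Tendsto γ (𝓝[>] 0) (𝓝 0) := by
  set g : ℝ → ℝ := fun t => Function.update h 0 l (max t 0)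
  have hg : Continuous g := by
    have : ContinuousOn (Function.update h 0 l) (Ici 0) :=
      continuousOn_update_iff.2 (by simpa only [Ici_sdiff_left] using ⟨hh, fun _ => hl⟩)
    exact this.comp_continuous (continuous_id.max continuous_const) fun t => le_max_right t 0
  refine ⟨fun t => ∫ r in (0 : ℝ)..t, g r, fun t ht => ?_, ?_⟩
  · refine (hg.integral_hasStrictDerivAt 0 t).hasDerivAt.congr_deriv ?_
    simp only [g, max_eq_left ht.le, Function.update_of_ne ht.ne']
  · simpa using (hg.integral_hasStrictDerivAt 0 0).hasDerivAt.continuousAt.tendsto.mono_left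
      (nhdsWithin_le_nhds (s := Ioi 0))

lemma tendsto_atTop_of_le_deriv {φ g : ℝ → ℝ} {c : ℝ} (hφ : ∀ t, HasDerivAt φ (g t) t)
    (hc : 0 < c) (hg : ∀ᶠ t in atTop, c ≤ g t) : Tendsto φ atTop atTop := by
  obtain ⟨a, ha⟩ := eventually_atTop.1 hg
  refine tendsto_atTop_mono' atTop (f₁ := fun t => (φ a - c * a) + c * t) ?_
    (tendsto_atTop_add_const_left _ _ (tendsto_id.const_mul_atTop hc))
  filter_upwards [eventually_ge_atTop a] with t hat
  have := le_of_hasDerivAt_nonneg (g := fun t => φ t - c * t) hat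
    (fun s _ => (hφ s).fun_sub ((hasDerivAt_id s).const_mul c))
    (fun s hs => by simpa using ha s hs.1.le)
  linarith

lemma exists_hasDerivAt_inv {g : ℝ → ℝ} {c : ℝ} (hg : Continuous g) (hpos : ∀ r, 0 < g r)
    (hc : 0 < c) (hbot : ∀ᶠ r in atBot, c ≤ g r) (htop : ∀ᶠ r in atTop, c ≤ g r) :
    ∃ ψ : ℝ → ℝ, Tendsto ψ atBot atBot ∧ Tendsto ψ atTop atTop ∧
      ∀ s, HasDerivAt ψ (g (ψ s))⁻¹ s := by
  set φ : ℝ → ℝ := fun y => ∫ r in (0 : ℝ)..y, g r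
  have hφ : ∀ y, HasDerivAt φ (g y) y := fun y => (hg.integral_hasStrictDerivAt 0 y).hasDerivAt
  have hmono : StrictMono φ := strictMono_of_deriv_pos fun y => (hφ y).deriv ▸ hpos y
  have hφtop : Tendsto φ atTop atTop := tendsto_atTop_of_le_deriv hφ hc htop
  have hφbot : Tendsto φ atBot atBot := by
    have hneg : Tendsto (fun t => -φ (-t)) atTop atTop :=
      tendsto_atTop_of_le_deriv (g := fun t => g (-t))
        (fun t => ((hφ (-t)).scomp t (hasDerivAt_neg t)).fun_neg.congr_deriv (by simp)) hc
        (tendsto_neg_atTop_atBot.eventually hbot)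
    simpa [Function.comp_def] using
      tendsto_neg_atTop_atBot.comp (hneg.comp tendsto_neg_atBot_atTop)
  have hcont : Continuous φ := continuous_iff_continuousAt.2 fun y => (hφ y).continuousAt
  set e := hmono.orderIsoOfSurjective φ (hcont.surjective hφtop hφbot)
  exact ⟨e.symm, e.symm.tendsto_atBot, e.symm.tendsto_atTop, fun s =>
    HasDerivAt.of_local_left_inverse e.symm.continuous.continuousAt (hφ _) (hpos _).ne'
      (Eventually.of_forall e.apply_symm_apply)⟩

lemma exists_time_change {M : ℝ → ℝ} {c : ℝ} (hM : ContinuousOn M (Ioi 0))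
    (hpos : ∀ t, 0 < t → 0 < M t) (hc : 0 < c) (h0 : ∀ᶠ t in 𝓝[>] 0, c ≤ t * M t)
    (htop : ∀ᶠ t in atTop, c ≤ t * M t) :
    ∃ τ : ℝ → ℝ, (∀ s, 0 < τ s) ∧ Tendsto τ atBot (𝓝 0) ∧ Tendsto τ atTop atTop ∧
      ∀ s, HasDerivAt τ (1 / M (τ s)) s := by
  -- In the variable `log t` the equation `dt/ds = 1 / M(t)` has the coefficient `t * M(t)`, which
  -- is bounded below at both ends, so that its solutions exist on the whole line.
  obtain ⟨ψ, hbot, htop, hψ⟩ := exists_hasDerivAt_inv (g := fun r => Real.exp r * M (Real.exp r))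
    (Real.continuous_exp.mul (hM.comp_continuous Real.continuous_exp Real.exp_pos))
    (fun r => mul_pos (Real.exp_pos r) (hpos _ (Real.exp_pos r))) hc
    (Real.tendsto_exp_atBot_nhdsGT.eventually h0) (Real.tendsto_exp_atTop.eventually htop)
  refine ⟨fun s => Real.exp (ψ s), fun s => Real.exp_pos _, Real.tendsto_exp_atBot.comp hbot,
    Real.tendsto_exp_atTop.comp htop, fun s => (hψ s).exp.congr_deriv ?_⟩
  have hM0 := (hpos _ (Real.exp_pos (ψ s))).ne'
  field_simp

namespace IsReducedSolution

variable {N : ℕ} {D ε K T t : ℝ} {x : ℝ → State}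

lemma tendsto_mul_reducedMean (hx : IsReducedSolution N D ε K T x) (hT : 0 < T) :
    Tendsto (fun t => t * reducedMean N D (x t)) (𝓝[>] 0) (𝓝 N) := by
  have hid : Tendsto (fun t : ℝ => t) (𝓝[>] 0) (𝓝 0) := nhdsWithin_le_nhds
  have hlim := (hid.mul hx.tendsto_p_add_mul_h).add
    ((hx.tendsto_y.mul ((hx.tendsto_f_div hT).inv₀ one_ne_zero)).const_mul (N : ℝ))
  simp only [inv_one, mul_one, mul_zero, zero_add] at hlim
  refine hlim.congr fun t => ?_
  simp only [reducedMean, inv_div]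
  ring

lemma tendsto_add_mul_v (hx : IsReducedSolution N D ε K T x) :
    Tendsto (fun t => K + ε * x t .v) (𝓝[>] 0) (𝓝 K) := by
  simpa using (hx.tendsto_v.const_mul ε).const_add K

lemma tendsto_p_div (hx : IsReducedSolution N D ε K T x) (P : Params N D ε K) (hT : 0 < T) :
    Tendsto (fun t => x t .p / t) (𝓝[>] 0) (𝓝 (K / (N + 1))) :=
  tendsto_div_of_hasDerivAt_neg_mul hT (fun _ ht => hx.hasDerivAt_p ht)
    (fun _ ht => (hx.pos_reducedMean P ht).le) (hx.tendsto_mul_reducedMean hT)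
    (by positivity) hx.tendsto_add_mul_v hx.tendsto_p

lemma tendsto_deriv_p (hx : IsReducedSolution N D ε K T x) (P : Params N D ε K) (hT : 0 < T) :
    Tendsto (fun t => -reducedMean N D (x t) * x t .p + (K + ε * x t .v)) (𝓝[>] 0)
      (𝓝 (K / (N + 1))) := by
  have hlim := ((hx.tendsto_mul_reducedMean hT).mul (hx.tendsto_p_div P hT)).neg.add
    hx.tendsto_add_mul_v
  have hval : -((N : ℝ) * (K / (N + 1))) + K = K / (N + 1) := by
    field_simp
    ring
  rw [hval] at hlim
  refine hlim.congr' ?_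
  filter_upwards [self_mem_nhdsWithin] with t ht
  have ht0 : t ≠ 0 := (mem_Ioi.1 ht).ne'
  field_simp

lemma sqrt_le_reducedMean (hx : IsReducedSolution N D ε K T x) (P : Params N D ε K)
    (ht : t ∈ Ioo 0 T) : √K ≤ reducedMean N D (x t) := by
  have hN := P.two_le_cast
  have hD := P.D_nonneg
  have hε := P.ε_pos
  refine Real.sqrt_le_iff.2 ⟨(hx.pos_reducedMean P ht).le, ?_⟩
  rw [hx.conservation P ht]
  have hv := mul_pos hε (hx.pos_v P ht)
  have hf : 0 ≤ (N : ℝ) * (N - 1) / x t .f ^ 2 :=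
    div_nonneg (mul_nonneg (by linarith) (by linarith)) (sq_nonneg _)
  have hconst : 0 ≤ (N + D - 1) * (ε / 2) := mul_nonneg (by linarith) (by linarith)
  have hsq : 0 ≤ (N : ℝ) * (x t .y / x t .f) ^ 2 + D * x t .h ^ 2 := by positivity
  linarith

end IsReducedSolution

/-! ### From solitons to the reduced system -/

/-- The dimensions and Einstein constants of a round sphere `S^{d 0}` and `m ≥ 1` Ricci flat
factors, for the expanding soliton equation. -/
structure Setting (m : ℕ) (d : Fin (m + 1) → ℕ) (μ : Fin (m + 1) → ℝ) (ε : ℝ) : Prop where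
  one_le_m : 1 ≤ m
  two_le_dim_zero : 2 ≤ d 0
  one_le_dim : ∀ i, 1 ≤ d i
  μ_zero : μ 0 = (d 0 : ℝ) - 1
  μ_succ : ∀ i : Fin m, μ i.succ = 0
  ε_pos : 0 < ε

/-- The dimension of the product of the Ricci flat factors. -/
noncomputable def flatDim {m : ℕ} (d : Fin (m + 1) → ℕ) : ℝ := ∑ i : Fin m, (d i.succ : ℝ)

/-- The state of the reduced system given by a soliton. The eigenvalues of the shape operator on
the flat factors are averaged; only their weighted sum enters the equations of the other
coordinates. -/
noncomputable def reduce {m : ℕ} (d : Fin (m + 1) → ℕ) (f : Fin (m + 1) → ℝ → ℝ) (u : ℝ → ℝ)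
    (t : ℝ) : State
  | .f => f 0 t
  | .y => deriv (f 0) t
  | .p => -deriv u t
  | .h => (∑ i : Fin m, (d i.succ : ℝ) * shape f i.succ t) / flatDim d
  | .v => -u t

variable {m : ℕ} {d : Fin (m + 1) → ℕ} {μ : Fin (m + 1) → ℝ} {ε : ℝ}
  {f : Fin (m + 1) → ℝ → ℝ} {u : ℝ → ℝ} {t : ℝ}

namespace Setting

lemma flatDim_pos (A : Setting m d μ ε) : 0 < flatDim d := by
  have : Nonempty (Fin m) := ⟨⟨0, A.one_le_m⟩⟩
  exact Finset.sum_pos (fun i _ => Nat.cast_pos.2 (A.one_le_dim i.succ)) Finset.univ_nonempty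

lemma dim_zero_pos (A : Setting m d μ ε) : (0 : ℝ) < d 0 := Nat.cast_pos.2 (A.one_le_dim 0)

lemma params (A : Setting m d μ ε) {K : ℝ} (hK : 0 < K) : Params (d 0) (flatDim d) ε K :=
  ⟨A.two_le_dim_zero, A.flatDim_pos.le, A.ε_pos, hK⟩

lemma sum_mu (A : Setting m d μ ε) (g : Fin (m + 1) → ℝ) :
    ∑ i, (d i : ℝ) * μ i * g i = d 0 * (d 0 - 1) * g 0 := by
  simp [Fin.sum_univ_succ, A.μ_zero, A.μ_succ]

end Setting

lemma sum_dim (d : Fin (m + 1) → ℕ) : ∑ i, (d i : ℝ) = d 0 + flatDim d := by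
  rw [Fin.sum_univ_succ, flatDim]

lemma trShape_eq_genMean_add (d : Fin (m + 1) → ℕ) (f : Fin (m + 1) → ℝ → ℝ) (u : ℝ → ℝ) (t : ℝ) :
    trShape d f t = genMean d f u t + deriv u t := by
  simp [genMean]

lemma genMean_eq_reducedMean (A : Setting m d μ ε) (f : Fin (m + 1) → ℝ → ℝ) (u : ℝ → ℝ) (t : ℝ) :
    genMean d f u t = reducedMean (d 0) (flatDim d) (reduce d f u t) := by
  simp only [genMean, trShape, Fin.sum_univ_succ, reducedMean, reduce,
    mul_div_cancel₀ _ A.flatDim_pos.ne', add_assoc]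
  rfl

namespace IsSoliton

lemma hasDerivAt_warp (h : IsSoliton d μ ε f u) (i : Fin (m + 1)) (ht : 0 < t) :
    HasDerivAt (f i) (deriv (f i) t) t :=
  (((h.smooth_f i).differentiableOn (by simp)).differentiableAt (Ioi_mem_nhds ht)).hasDerivAt

lemma hasDerivAt_deriv_warp (h : IsSoliton d μ ε f u) (i : Fin (m + 1)) (ht : 0 < t) :
    HasDerivAt (deriv (f i)) (deriv (deriv (f i)) t) t :=
  ((((contDiffOn_infty_iff_deriv_of_isOpen isOpen_Ioi).1 (h.smooth_f i)).2.differentiableOn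
    (by simp)).differentiableAt (Ioi_mem_nhds ht)).hasDerivAt

lemma hasDerivAt_potential (h : IsSoliton d μ ε f u) (ht : 0 < t) :
    HasDerivAt u (deriv u t) t :=
  ((h.smooth_u.differentiableOn (by simp)).differentiableAt (Ioi_mem_nhds ht)).hasDerivAt

lemma hasDerivAt_deriv_potential (h : IsSoliton d μ ε f u) (ht : 0 < t) :
    HasDerivAt (deriv u) (deriv (deriv u) t) t :=
  ((((contDiffOn_infty_iff_deriv_of_isOpen isOpen_Ioi).1 h.smooth_u).2.differentiableOn
    (by simp)).differentiableAt (Ioi_mem_nhds ht)).hasDerivAt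

lemma hasDerivAt_shape (h : IsSoliton d μ ε f u) (i : Fin (m + 1)) (ht : 0 < t) :
    HasDerivAt (shape f i) (-genMean d f u t * shape f i t + μ i / f i t ^ 2 + ε / 2) t :=
  h.eq_shape i t ht ▸ ((h.hasDerivAt_deriv_warp i ht).div (h.hasDerivAt_warp i ht)
    (h.pos i t ht).ne').differentiableAt.hasDerivAt

lemma hasDerivAt_trShape (h : IsSoliton d μ ε f u) (A : Setting m d μ ε) (ht : 0 < t) :
    HasDerivAt (trShape d f) (-genMean d f u t * trShape d f t + d 0 * (d 0 - 1) / f 0 t ^ 2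
      + (d 0 + flatDim d) * (ε / 2)) t := by
  have hsum : HasDerivAt (trShape d f) (∑ i, (d i : ℝ) * (-genMean d f u t * shape f i t
      + μ i / f i t ^ 2 + ε / 2)) t :=
    HasDerivAt.fun_sum fun i _ => (h.hasDerivAt_shape i ht).const_mul (d i : ℝ)
  refine hsum.congr_deriv ?_
  rw [div_eq_mul_inv (d 0 * (d 0 - 1) : ℝ), ← A.sum_mu fun i => (f i t ^ 2)⁻¹, ← sum_dim,
    Finset.sum_mul, trShape, Finset.mul_sum, ← Finset.sum_add_distrib, ← Finset.sum_add_distrib]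
  exact Finset.sum_congr rfl fun i _ => by ring

lemma hasDerivAt_trShapeSq (h : IsSoliton d μ ε f u) (A : Setting m d μ ε) (ht : 0 < t) :
    HasDerivAt (trShapeSq d f) (-2 * genMean d f u t * trShapeSq d f t
      + 2 * (d 0 * (d 0 - 1) * (shape f 0 t / f 0 t ^ 2)) + ε * trShape d f t) t := by
  have hsum : HasDerivAt (trShapeSq d f) (∑ i, (d i : ℝ) * (2 * shape f i t *
      (-genMean d f u t * shape f i t + μ i / f i t ^ 2 + ε / 2))) t :=
    HasDerivAt.fun_sum fun i _ => by
      simpa using ((h.hasDerivAt_shape i ht).pow 2).const_mul (d i : ℝ)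
  refine hsum.congr_deriv ?_
  rw [← A.sum_mu fun i => shape f i t / f i t ^ 2, trShape, trShapeSq, Finset.mul_sum,
    Finset.mul_sum, Finset.mul_sum, ← Finset.sum_add_distrib, ← Finset.sum_add_distrib]
  exact Finset.sum_congr rfl fun i _ => by ring

lemma hasDerivAt_genMean (h : IsSoliton d μ ε f u) (A : Setting m d μ ε) (ht : 0 < t) :
    HasDerivAt (genMean d f u) (-trShapeSq d f t + ε / 2) t :=
  h.eq_mean t ht ▸ ((h.hasDerivAt_deriv_potential ht).neg.add
    (h.hasDerivAt_trShape A ht)).differentiableAt.hasDerivAt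

end IsSoliton

/-- The first integral of the soliton equation. -/
noncomputable def firstIntegral (d : Fin (m + 1) → ℕ) (ε : ℝ) (f : Fin (m + 1) → ℝ → ℝ)
    (u : ℝ → ℝ) (t : ℝ) : ℝ :=
  genMean d f u t ^ 2 - trShapeSq d f t - d 0 * (d 0 - 1) / f 0 t ^ 2
    - (d 0 + flatDim d - 1) * (ε / 2) + ε * u t

namespace IsSoliton

lemma hasDerivAt_firstIntegral (h : IsSoliton d μ ε f u) (A : Setting m d μ ε) (ht : 0 < t) :
    HasDerivAt (firstIntegral d ε f u) 0 t := by
  have hf := (h.pos 0 t ht).ne'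
  refine ((((((h.hasDerivAt_genMean A ht).pow 2).sub (h.hasDerivAt_trShapeSq A ht)).sub
    ((hasDerivAt_const t ((d 0 : ℝ) * (d 0 - 1))).div ((h.hasDerivAt_warp 0 ht).pow 2)
      (pow_ne_zero 2 hf))).sub_const ((d 0 + flatDim d - 1) * (ε / 2))).add
    ((h.hasDerivAt_potential ht).const_mul ε)).congr_deriv ?_
  simp only [trShape_eq_genMean_add d f u, shape, Pi.pow_apply]
  field_simp
  ring

lemma exists_firstIntegral_eq (h : IsSoliton d μ ε f u) (A : Setting m d μ ε) :
    ∃ c, ∀ t, 0 < t → firstIntegral d ε f u t = c :=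
  ⟨firstIntegral d ε f u 1, fun _ ht => isOpen_Ioi.is_const_of_deriv_eq_zero isPreconnected_Ioi
    (fun _ hs => (h.hasDerivAt_firstIntegral A hs).differentiableAt.differentiableWithinAt)
    (fun _ hs => (h.hasDerivAt_firstIntegral A hs).deriv) ht (mem_Ioi.2 one_pos)⟩

lemma deriv_deriv_potential (h : IsSoliton d μ ε f u) (A : Setting m d μ ε) (ht : 0 < t) :
    deriv (deriv u) t = -(genMean d f u t * deriv u t) + ε * u t - firstIntegral d ε f u t := by
  have huniq := (h.hasDerivAt_genMean A ht).unique
    ((h.hasDerivAt_deriv_potential ht).neg.add (h.hasDerivAt_trShape A ht))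
  rw [trShape_eq_genMean_add d f u] at huniq
  unfold firstIntegral
  linarith

end IsSoliton

namespace HasInitialData

variable {fbar : Fin m → ℝ} {C : ℝ}

lemma tendsto_shape_succ (hi : HasInitialData d fbar C f u) (hfbar : ∀ i, 0 < fbar i)
    (i : Fin m) : Tendsto (shape f i.succ) (𝓝[>] 0) (𝓝 0) := by
  simpa only [zero_div] using! (hi.factor_deriv i).div (hi.factor i) (hfbar i).ne'

lemma tendsto_warp_div (hi : HasInitialData d fbar C f u) (h : IsSoliton d μ ε f u) :
    Tendsto (fun t => f 0 t / t) (𝓝[>] 0) (𝓝 1) :=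
  HasDerivAt.lhopital_zero_nhdsGT (f' := deriv (f 0)) (g' := fun _ => 1)
    (eventually_nhdsWithin_of_forall fun _ ht => h.hasDerivAt_warp 0 ht)
    (Eventually.of_forall hasDerivAt_id) (Eventually.of_forall fun _ => one_ne_zero)
    hi.sphere nhdsWithin_le_nhds (by simpa using hi.sphere_deriv)

lemma tendsto_deriv_potential_div (hi : HasInitialData d fbar C f u) (h : IsSoliton d μ ε f u) :
    Tendsto (fun t => deriv u t / t) (𝓝[>] 0) (𝓝 (C / (d 0 + 1))) :=
  HasDerivAt.lhopital_zero_nhdsGT (f' := deriv (deriv u)) (g' := fun _ => 1)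
    (eventually_nhdsWithin_of_forall fun _ ht => h.hasDerivAt_deriv_potential ht)
    (Eventually.of_forall hasDerivAt_id) (Eventually.of_forall fun _ => one_ne_zero)
    hi.potential_deriv nhdsWithin_le_nhds (by simpa using hi.potential_deriv_two)

lemma tendsto_mul_shape_zero (hi : HasInitialData d fbar C f u) (h : IsSoliton d μ ε f u) :
    Tendsto (fun t => t * shape f 0 t) (𝓝[>] 0) (𝓝 1) := by
  have hlim := hi.sphere_deriv.mul ((hi.tendsto_warp_div h).inv₀ one_ne_zero)
  rw [inv_one, mul_one] at hlim
  refine hlim.congr fun t => ?_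
  simp only [shape, inv_div]
  ring

lemma tendsto_mul_genMean (hi : HasInitialData d fbar C f u) (hfbar : ∀ i, 0 < fbar i)
    (h : IsSoliton d μ ε f u) : Tendsto (fun t => t * genMean d f u t) (𝓝[>] 0) (𝓝 (d 0)) := by
  have hid : Tendsto (fun t : ℝ => t) (𝓝[>] 0) (𝓝 0) := nhdsWithin_le_nhds
  have hflat : Tendsto (fun t => ∑ i : Fin m, (d i.succ : ℝ) * shape f i.succ t) (𝓝[>] 0)
      (𝓝 (∑ i : Fin m, (d i.succ : ℝ) * 0)) :=
    tendsto_finsetSum _ fun i _ => (hi.tendsto_shape_succ hfbar i).const_mul _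
  have hlim := ((hid.mul hi.potential_deriv.neg).add
    ((hi.tendsto_mul_shape_zero h).const_mul (d 0 : ℝ))).add (hid.mul hflat)
  simp only [mul_zero, Finset.sum_const_zero, zero_add, mul_one, add_zero, neg_zero] at hlim
  refine hlim.congr fun t => ?_
  simp only [genMean, trShape, Fin.sum_univ_succ]
  ring

lemma firstIntegral_eq (hi : HasInitialData d fbar C f u) (hfbar : ∀ i, 0 < fbar i)
    (h : IsSoliton d μ ε f u) (A : Setting m d μ ε) (ht : 0 < t) :
    firstIntegral d ε f u t = -C := by
  obtain ⟨c, hc⟩ := h.exists_firstIntegral_eq A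
  have hlim := ((((hi.tendsto_mul_genMean hfbar h).mul (hi.tendsto_deriv_potential_div h)).neg.add
    (hi.potential.const_mul ε)).sub hi.potential_deriv_two)
  have hval : -((d 0 : ℝ) * (C / (d 0 + 1))) + ε * 0 - C / (d 0 + 1) = -C := by
    field_simp
    ring
  rw [hval] at hlim
  refine (hc t ht).trans (tendsto_nhds_unique (tendsto_const_nhds.congr' ?_) hlim)
  filter_upwards [self_mem_nhdsWithin] with s hs
  have hs0 : s ≠ 0 := (mem_Ioi.1 hs).ne'
  rw [h.deriv_deriv_potential A hs, hc s hs]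
  field_simp
  ring

lemma tendsto_reduce (hi : HasInitialData d fbar C f u) (hfbar : ∀ i, 0 < fbar i) :
    Tendsto (reduce d f u) (𝓝[>] 0) (𝓝 (Pi.single .y 1)) := by
  refine tendsto_pi_nhds.2 fun i => ?_
  cases i
  case f => simpa using! hi.sphere
  case y => simpa using! hi.sphere_deriv
  case p => simpa using! hi.potential_deriv.neg
  case h =>
    have : Tendsto (fun t => (∑ i : Fin m, (d i.succ : ℝ) * shape f i.succ t) / flatDim d)
        (𝓝[>] 0) (𝓝 ((∑ i : Fin m, (d i.succ : ℝ) * 0) / flatDim d)) :=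
      (tendsto_finsetSum _ fun i _ => (hi.tendsto_shape_succ hfbar i).const_mul _).div_const _
    simpa using! this
  case v => simpa using! hi.potential.neg

end HasInitialData

namespace IsSoliton

lemma hasDerivAt_reduce_y (h : IsSoliton d μ ε f u) (A : Setting m d μ ε) (ht : 0 < t) (K : ℝ) :
    HasDerivAt (deriv (f 0)) (reducedField (d 0) (flatDim d) ε K (reduce d f u t) .y) t := by
  have hf := (h.pos 0 t ht).ne'
  have hmul : (fun t => shape f 0 t * f 0 t) =ᶠ[𝓝 t] deriv (f 0) := by
    filter_upwards [lt_mem_nhds ht] with s hs using div_mul_cancel₀ _ (h.pos 0 s hs).ne'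
  refine (((h.hasDerivAt_shape 0 ht).fun_mul (h.hasDerivAt_warp 0 ht)).congr_of_eventuallyEq
    hmul.symm).congr_deriv ?_
  rw [genMean_eq_reducedMean A, A.μ_zero]
  simp only [reducedField, reduce, reducedMean, shape]
  field_simp
  ring

lemma hasDerivAt_reduce_h (h : IsSoliton d μ ε f u) (A : Setting m d μ ε) (ht : 0 < t) (K : ℝ) :
    HasDerivAt (fun t => reduce d f u t .h)
      (reducedField (d 0) (flatDim d) ε K (reduce d f u t) .h) t := by
  have hD := A.flatDim_pos.ne'
  refine ((HasDerivAt.fun_sum fun i _ => (h.hasDerivAt_shape i.succ ht).const_mul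
    (d i.succ : ℝ)).div_const (flatDim d)).congr_deriv ?_
  have hsum : ∑ i : Fin m, (d i.succ : ℝ) * (-genMean d f u t * shape f i.succ t
      + μ i.succ / f i.succ t ^ 2 + ε / 2)
      = -genMean d f u t * (∑ i : Fin m, (d i.succ : ℝ) * shape f i.succ t)
        + flatDim d * (ε / 2) := by
    rw [flatDim, Finset.mul_sum, Finset.sum_mul, ← Finset.sum_add_distrib]
    refine Finset.sum_congr rfl fun i _ => ?_
    rw [A.μ_succ i]
    ring
  simp only [hsum, reducedField, ← genMean_eq_reducedMean A, reduce]
  field_simp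

variable {fbar : Fin m → ℝ} {C : ℝ}

lemma hasDerivAt_reduce (h : IsSoliton d μ ε f u) (A : Setting m d μ ε)
    (hi : HasInitialData d fbar C f u) (hfbar : ∀ i, 0 < fbar i) (ht : 0 < t) :
    HasDerivAt (reduce d f u) (reducedField (d 0) (flatDim d) ε (-C) (reduce d f u t)) t := by
  refine hasDerivAt_pi.2 fun i => ?_
  cases i
  case f => exact h.hasDerivAt_warp 0 ht
  case y => exact h.hasDerivAt_reduce_y A ht (-C)
  case p =>
    refine (h.hasDerivAt_deriv_potential ht).neg.congr_deriv ?_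
    rw [h.deriv_deriv_potential A ht, hi.firstIntegral_eq hfbar h A ht]
    simp only [reducedField, ← genMean_eq_reducedMean A, reduce]
    ring
  case h => exact h.hasDerivAt_reduce_h A ht (-C)
  case v => exact (h.hasDerivAt_potential ht).neg

theorem isGlobalReducedSolution_reduce (h : IsSoliton d μ ε f u) (A : Setting m d μ ε)
    (hi : HasInitialData d fbar C f u) (hfbar : ∀ i, 0 < fbar i) :
    IsGlobalReducedSolution (d 0) (flatDim d) ε (-C) (reduce d f u) := fun _ =>
  ⟨fun _ ht => h.hasDerivAt_reduce A hi hfbar ht.1, fun t ht => h.pos 0 t ht.1,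
    hi.tendsto_reduce hfbar⟩

end IsSoliton

/-! ### Regularity of the trajectories -/

namespace HasInitialData

variable {fbar : Fin m → ℝ} {C : ℝ}

lemma genMean_pos (hi : HasInitialData d fbar C f u) (A : Setting m d μ ε)
    (hfbar : ∀ i, 0 < fbar i) (hC : C < 0) (h : IsSoliton d μ ε f u) (ht : 0 < t) :
    0 < genMean d f u t := by
  rw [genMean_eq_reducedMean A]
  exact (h.isGlobalReducedSolution_reduce A hi hfbar _).pos_reducedMean (A.params (neg_pos.2 hC))
    (mem_Ioo_zero_add_one ht)

lemma potential_neg (hi : HasInitialData d fbar C f u) (A : Setting m d μ ε)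
    (hfbar : ∀ i, 0 < fbar i) (hC : C < 0) (h : IsSoliton d μ ε f u) (ht : 0 < t) : u t < 0 :=
  neg_pos.1 <| (h.isGlobalReducedSolution_reduce A hi hfbar _).pos_v (A.params (neg_pos.2 hC))
    (mem_Ioo_zero_add_one ht)

lemma deriv_potential_neg (hi : HasInitialData d fbar C f u) (A : Setting m d μ ε)
    (hfbar : ∀ i, 0 < fbar i) (hC : C < 0) (h : IsSoliton d μ ε f u) (ht : 0 < t) :
    deriv u t < 0 :=
  neg_pos.1 <| (h.isGlobalReducedSolution_reduce A hi hfbar _).pos_p (A.params (neg_pos.2 hC))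
    (mem_Ioo_zero_add_one ht)

lemma shape_pos (hi : HasInitialData d fbar C f u) (A : Setting m d μ ε)
    (hfbar : ∀ i, 0 < fbar i) (hC : C < 0) (h : IsSoliton d μ ε f u) (i : Fin (m + 1))
    (ht : 0 < t) : 0 < shape f i t := by
  refine Fin.cases ?_ (fun i => ?_) i
  · exact div_pos ((h.isGlobalReducedSolution_reduce A hi hfbar _).pos_y
      (A.params (neg_pos.2 hC)) (mem_Ioo_zero_add_one ht)) (h.pos 0 t ht)
  · refine pos_of_neg_mul_lt_deriv (fun s hs => h.hasDerivAt_shape i.succ hs.1)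
      (fun s hs => (hi.genMean_pos A hfbar hC h hs.1).le) (fun s _ => ?_)
      (hi.tendsto_shape_succ hfbar i) (mem_Ioo_zero_add_one ht)
    rw [A.μ_succ i, zero_div]
    linarith [A.ε_pos]

lemma tendsto_inv_mul_genMean (hi : HasInitialData d fbar C f u) (A : Setting m d μ ε)
    (hfbar : ∀ i, 0 < fbar i) (h : IsSoliton d μ ε f u) :
    Tendsto (fun t => (t * genMean d f u t)⁻¹) (𝓝[>] 0) (𝓝 (1 / d 0)) := by
  simpa only [one_div] using (hi.tendsto_mul_genMean hfbar h).inv₀ A.dim_zero_pos.ne'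

lemma tendsto_one_div_genMean (hi : HasInitialData d fbar C f u) (A : Setting m d μ ε)
    (hfbar : ∀ i, 0 < fbar i) (h : IsSoliton d μ ε f u) :
    Tendsto (fun t => 1 / genMean d f u t) (𝓝[>] 0) (𝓝 0) := by
  have hid : Tendsto (fun t : ℝ => t) (𝓝[>] 0) (𝓝 0) := nhdsWithin_le_nhds
  have hlim := hid.mul (hi.tendsto_inv_mul_genMean A hfbar h)
  rw [zero_mul] at hlim
  refine hlim.congr' ?_
  filter_upwards [self_mem_nhdsWithin] with t ht
  have ht0 : t ≠ 0 := (mem_Ioi.1 ht).ne'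
  field_simp

lemma tendsto_shape_zero_div_genMean (hi : HasInitialData d fbar C f u) (A : Setting m d μ ε)
    (hfbar : ∀ i, 0 < fbar i) (h : IsSoliton d μ ε f u) :
    Tendsto (fun t => 1 / genMean d f u t * shape f 0 t) (𝓝[>] 0) (𝓝 (1 / d 0)) := by
  have hlim := (hi.tendsto_inv_mul_genMean A hfbar h).mul (hi.tendsto_mul_shape_zero h)
  rw [mul_one] at hlim
  refine hlim.congr' ?_
  filter_upwards [self_mem_nhdsWithin] with t ht
  have ht0 : t ≠ 0 := (mem_Ioi.1 ht).ne'
  field_simp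

lemma tendsto_one_div_genMean_div_warp_zero (hi : HasInitialData d fbar C f u)
    (A : Setting m d μ ε) (hfbar : ∀ i, 0 < fbar i) (h : IsSoliton d μ ε f u) :
    Tendsto (fun t => 1 / genMean d f u t / f 0 t) (𝓝[>] 0) (𝓝 (1 / d 0)) := by
  have hlim := (hi.tendsto_inv_mul_genMean A hfbar h).mul
    ((hi.tendsto_warp_div h).inv₀ one_ne_zero)
  rw [inv_one, mul_one] at hlim
  refine hlim.congr' ?_
  filter_upwards [self_mem_nhdsWithin] with t ht
  have ht0 : t ≠ 0 := (mem_Ioi.1 ht).ne'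
  field_simp

end HasInitialData

variable {Λ τ : ℝ → ℝ} {X Y : Fin (m + 1) → ℝ → ℝ} {s : ℝ}

lemma sum_dim_mul_eq_mul_trShape (hX : ∀ i, X i s = Λ s * shape f i (τ s)) :
    ∑ i, (d i : ℝ) * X i s = Λ s * trShape d f (τ s) := by
  rw [trShape, Finset.mul_sum]
  exact Finset.sum_congr rfl fun i _ => by rw [hX, mul_left_comm]

lemma sum_dim_mul_sq_eq_mul_trShapeSq (hX : ∀ i, X i s = Λ s * shape f i (τ s)) :
    ∑ i, (d i : ℝ) * X i s ^ 2 = Λ s ^ 2 * trShapeSq d f (τ s) := by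
  rw [trShapeSq, Finset.mul_sum]
  exact Finset.sum_congr rfl fun i _ => by rw [hX, mul_pow, mul_left_comm]

namespace IsSoliton

lemma isTrajectory (h : IsSoliton d μ ε f u) (A : Setting m d μ ε)
    (hM : ∀ t, 0 < t → genMean d f u t ≠ 0) (hI : Induces d f u Λ X Y) :
    IsTrajectory d μ ε Λ X Y := by
  obtain ⟨τ, hτ, -, -, hτ', hΛ, hX, hY⟩ := hI
  have hsum : ∀ s, ∑ j, (d j : ℝ) * X j s ^ 2 = Λ s ^ 2 * trShapeSq d f (τ s) := fun s =>
    sum_dim_mul_sq_eq_mul_trShapeSq fun i => hX i s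
  have hΛM : ∀ s, Λ s * genMean d f u (τ s) = 1 := fun s => by
    rw [hΛ, one_div_mul_cancel (hM _ (hτ s))]
  have hΛ' : ∀ s, HasDerivAt Λ (Λ s ^ 3 * (trShapeSq d f (τ s) - ε / 2)) s := fun s => by
    have hinv := ((h.hasDerivAt_genMean A (hτ s)).comp s (hτ' s)).fun_inv (hM _ (hτ s))
    refine (hinv.congr_of_eventuallyEq (.of_forall fun r => ?_)).congr_deriv ?_
    · exact (hΛ r).trans (one_div _)
    · have hM0 := hM _ (hτ s)
      rw [hΛ s, Function.comp_apply]
      field_simp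
      ring
  refine ⟨fun s => (hΛ' s).congr_deriv ?_, fun i s => ?_, fun i s => ?_⟩
  · rw [hsum]
    ring
  · refine (((hΛ' s).fun_mul ((h.hasDerivAt_shape i (hτ s)).comp s (hτ' s))).congr_of_eventuallyEq
      (.of_forall (hX i))).congr_deriv ?_
    rw [hsum, hX, hY, Function.comp_apply]
    linear_combination (-Λ s * shape f i (τ s)) * hΛM s
  · have hf := (h.pos i _ (hτ s)).ne'
    refine (((hΛ' s).fun_div ((h.hasDerivAt_warp i (hτ s)).comp s (hτ' s))
      hf).congr_of_eventuallyEq (.of_forall (hY i))).congr_deriv ?_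
    rw [hsum, hX, hY, shape, Function.comp_apply]
    field_simp

end IsSoliton

lemma Induces.tendsto_ratio (hI : Induces d f u Λ X Y)
    (hM : ∀ t, 0 < t → genMean d f u t ≠ 0) (h : IsSoliton d μ ε f u) {l : ℝ}
    (hl : Tendsto (deriv (f 0)) atTop (𝓝 l)) : Tendsto (fun s => X 0 s / Y 0 s) atTop (𝓝 l) := by
  obtain ⟨τ, hτ, -, hτtop, -, hΛ, hX, hY⟩ := hI
  refine (hl.comp hτtop).congr fun s => ?_
  have hf := (h.pos 0 _ (hτ s)).ne'
  have hM0 := hM _ (hτ s)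
  rw [hX, hY, hΛ, shape, Function.comp]
  field_simp

namespace HasInitialData

variable {fbar : Fin m → ℝ} {C : ℝ}

lemma S1_neg (hi : HasInitialData d fbar C f u) (A : Setting m d μ ε) (hfbar : ∀ i, 0 < fbar i)
    (hC : C < 0) (h : IsSoliton d μ ε f u) (hI : Induces d f u Λ X Y) (s : ℝ) :
    S1 d μ ε Λ X Y s < 0 := by
  obtain ⟨τ, hτ, -, -, -, hΛ, hX, hY⟩ := hI
  have hM := hi.genMean_pos A hfbar hC h (hτ s)
  have hΛ0 : 0 < Λ s := by simpa only [hΛ] using one_div_pos.2 hM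
  have hΛM : Λ s ^ 2 * genMean d f u (τ s) ^ 2 = 1 := by
    rw [← mul_pow, hΛ, one_div_mul_cancel hM.ne', one_pow]
  -- `S₁` is the first integral, which is larger than `ε * u`, in the new coordinates.
  have hS1 : S1 d μ ε Λ X Y s = -(Λ s ^ 2 * (-C - ε * u (τ s))) := by
    have hG := hi.firstIntegral_eq hfbar h A (hτ s)
    unfold firstIntegral at hG
    rw [S1, sum_dim_mul_sq_eq_mul_trShapeSq fun i => hX i s, A.sum_mu fun i => Y i s ^ 2, sum_dim,
      hY, div_pow]
    linear_combination hΛM - Λ s ^ 2 * hG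
  have hu : ε * u (τ s) < 0 := mul_neg_of_pos_of_neg A.ε_pos (hi.potential_neg A hfbar hC h (hτ s))
  rw [hS1]
  exact neg_neg_of_pos (mul_pos (pow_pos hΛ0 2) (by linarith))

lemma S2_neg (hi : HasInitialData d fbar C f u) (A : Setting m d μ ε) (hfbar : ∀ i, 0 < fbar i)
    (hC : C < 0) (h : IsSoliton d μ ε f u) (hI : Induces d f u Λ X Y) (s : ℝ) : S2 d X s < 0 := by
  obtain ⟨τ, hτ, -, -, -, hΛ, hX, -⟩ := hI
  have hM := hi.genMean_pos A hfbar hC h (hτ s)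
  have hS2 : S2 d X s = 1 / genMean d f u (τ s) * deriv u (τ s) := by
    rw [S2, sum_dim_mul_eq_mul_trShape fun i => hX i s, trShape_eq_genMean_add d f u, hΛ, mul_add,
      one_div_mul_cancel hM.ne', add_sub_cancel_left]
  exact hS2 ▸ mul_neg_of_pos_of_neg (one_div_pos.2 hM) (hi.deriv_potential_neg A hfbar hC h (hτ s))

theorem isRegular (hi : HasInitialData d fbar C f u) (A : Setting m d μ ε)
    (hfbar : ∀ i, 0 < fbar i) (hC : C < 0) (h : IsSoliton d μ ε f u)
    (hI : Induces d f u Λ X Y) : IsRegular d μ ε Λ X Y := by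
  have hM : ∀ t, 0 < t → 0 < genMean d f u t := fun t ht => hi.genMean_pos A hfbar hC h ht
  have htraj := h.isTrajectory A (fun t ht => (hM t ht).ne') hI
  have hS1 := hi.S1_neg A hfbar hC h hI
  have hS2 := hi.S2_neg A hfbar hC h hI
  obtain ⟨τ, hτ, hτbot, -, -, hΛ, hX, hY⟩ := hI
  have hτ0 : Tendsto τ atBot (𝓝[>] 0) := tendsto_nhdsWithin_iff.2 ⟨hτbot, .of_forall hτ⟩
  have hΛ0 : Tendsto Λ atBot (𝓝 0) :=
    ((hi.tendsto_one_div_genMean A hfbar h).comp hτ0).congr fun s => (hΛ s).symm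
  have hΛpos : ∀ s, 0 < Λ s := fun s => by simpa only [hΛ] using one_div_pos.2 (hM _ (hτ s))
  exact {
    trajectory := htraj
    lim_L := hΛ0
    lim_X_zero := ((hi.tendsto_shape_zero_div_genMean A hfbar h).comp hτ0).congr fun s => by
      rw [hX, hΛ, Function.comp_apply]
    lim_Y_zero := ((hi.tendsto_one_div_genMean_div_warp_zero A hfbar h).comp hτ0).congr fun s => by
      rw [hY, hΛ, Function.comp_apply]
    lim_X := fun i => by
      have hlim := hΛ0.mul ((hi.tendsto_shape_succ hfbar i).comp hτ0)
      rw [mul_zero] at hlim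
      exact hlim.congr fun s => (hX _ s).symm
    lim_Y := fun i => by
      have hlim := hΛ0.div ((hi.factor i).comp hτ0) (hfbar i).ne'
      rw [zero_div] at hlim
      exact hlim.congr fun s => (hY _ s).symm
    pos_L := hΛpos
    pos_X := fun i s => by
      simpa only [hX] using mul_pos (hΛpos s) (hi.shape_pos A hfbar hC h i (hτ s))
    pos_Y := fun i s => by simpa only [hY] using div_pos (hΛpos s) (h.pos i _ (hτ s))
    S1_neg := hS1
    S2_neg := hS2 }

end HasInitialData

/-! ### Existence of solitons and trajectories -/

theorem HasInitialData.exists_induces {fbar : Fin m → ℝ} {C : ℝ} (hi : HasInitialData d fbar C f u)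
    (A : Setting m d μ ε) (hfbar : ∀ i, 0 < fbar i) (hC : C < 0) (h : IsSoliton d μ ε f u) :
    ∃ (Λ : ℝ → ℝ) (X Y : Fin (m + 1) → ℝ → ℝ), Induces d f u Λ X Y := by
  have hK : 0 < -C := neg_pos.2 hC
  have hM0 : ∀ᶠ t in 𝓝[>] 0, min 1 √(-C) ≤ t * genMean d f u t := by
    have hd : (1 : ℝ) < d 0 := Nat.one_lt_cast.2 A.two_le_dim_zero
    filter_upwards [(hi.tendsto_mul_genMean hfbar h).eventually (lt_mem_nhds hd)] with t ht
    exact (min_le_left _ _).trans ht.le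
  have hMtop : ∀ᶠ t in atTop, min 1 √(-C) ≤ t * genMean d f u t := by
    filter_upwards [eventually_ge_atTop (1 : ℝ)] with t ht
    have hsqrt : √(-C) ≤ genMean d f u t := by
      rw [genMean_eq_reducedMean A]
      exact (h.isGlobalReducedSolution_reduce A hi hfbar _).sqrt_le_reducedMean (A.params hK)
        (mem_Ioo_zero_add_one (one_pos.trans_le ht))
    exact (min_le_right _ _).trans
      (hsqrt.trans (le_mul_of_one_le_left ((Real.sqrt_nonneg _).trans hsqrt) ht))
  obtain ⟨τ, hτ, hτbot, hτtop, hτ'⟩ := exists_time_change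
    (fun t ht => (h.hasDerivAt_genMean A ht).continuousAt.continuousWithinAt)
    (fun t ht => hi.genMean_pos A hfbar hC h ht) (lt_min one_pos (Real.sqrt_pos.2 hK)) hM0 hMtop
  exact ⟨fun s => 1 / genMean d f u (τ s), fun i s => 1 / genMean d f u (τ s) * shape f i (τ s),
    fun i s => 1 / genMean d f u (τ s) / f i (τ s), τ, hτ, hτbot, hτtop, hτ', fun _ => rfl,
    fun _ _ => rfl, fun _ _ => rfl⟩

/-- The warping functions of the soliton given by a solution `x` of the reduced system and a
primitive `γ` of its coordinate `h`; the soliton has the potential `-x t .v`. -/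
noncomputable def lift (fbar : Fin m → ℝ) (x : ℝ → State) (γ : ℝ → ℝ) : Fin (m + 1) → ℝ → ℝ :=
  Fin.cons (fun t => x t .f) fun i t => fbar i * Real.exp (γ t)

variable {fbar : Fin m → ℝ} {K D : ℝ} {N : ℕ} {x : ℝ → State} {γ : ℝ → ℝ}

lemma deriv_lift_succ (hγ : ∀ t, 0 < t → HasDerivAt γ (x t .h) t) (i : Fin m) (ht : 0 < t) :
    deriv (lift fbar x γ i.succ) t = fbar i * (Real.exp (γ t) * x t .h) :=
  ((hγ t ht).exp.const_mul (fbar i)).deriv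

lemma shape_lift_succ (hγ : ∀ t, 0 < t → HasDerivAt γ (x t .h) t) (hfbar : ∀ i, 0 < fbar i)
    (i : Fin m) (ht : 0 < t) : shape (lift fbar x γ) i.succ t = x t .h := by
  have hf : fbar i * Real.exp (γ t) ≠ 0 := (mul_pos (hfbar i) (Real.exp_pos _)).ne'
  rw [shape, deriv_lift_succ hγ i ht, ← mul_assoc]
  exact mul_div_cancel_left₀ _ hf

namespace IsGlobalReducedSolution

lemma deriv_lift_zero (hx : IsGlobalReducedSolution N D ε K x) (ht : 0 < t) :
    deriv (lift fbar x γ 0) t = x t .y :=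
  ((hx _).hasDerivAt_f (mem_Ioo_zero_add_one ht)).deriv

lemma shape_lift_zero (hx : IsGlobalReducedSolution N D ε K x) (ht : 0 < t) :
    shape (lift fbar x γ) 0 t = x t .y / x t .f := by
  rw [shape, hx.deriv_lift_zero ht]
  rfl

lemma deriv_neg_v (hx : IsGlobalReducedSolution N D ε K x) (ht : 0 < t) :
    deriv (fun t => -x t .v) t = -x t .p :=
  ((hx _).hasDerivAt_v (mem_Ioo_zero_add_one ht)).fun_neg.deriv

lemma genMean_lift (hx : IsGlobalReducedSolution (d 0) (flatDim d) ε K x)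
    (hγ : ∀ t, 0 < t → HasDerivAt γ (x t .h) t) (hfbar : ∀ i, 0 < fbar i) (ht : 0 < t) :
    genMean d (lift fbar x γ) (fun t => -x t .v) t = reducedMean (d 0) (flatDim d) (x t) := by
  rw [genMean, trShape, Fin.sum_univ_succ, hx.deriv_neg_v ht, hx.shape_lift_zero ht, reducedMean,
    flatDim, Finset.sum_mul, neg_neg, add_assoc]
  simp only [shape_lift_succ hγ hfbar _ ht]

lemma trShapeSq_lift (hx : IsGlobalReducedSolution (d 0) (flatDim d) ε K x)
    (hγ : ∀ t, 0 < t → HasDerivAt γ (x t .h) t) (hfbar : ∀ i, 0 < fbar i) (ht : 0 < t) :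
    trShapeSq d (lift fbar x γ) t = d 0 * (x t .y / x t .f) ^ 2 + flatDim d * x t .h ^ 2 := by
  rw [trShapeSq, Fin.sum_univ_succ, hx.shape_lift_zero ht, flatDim, Finset.sum_mul]
  simp only [shape_lift_succ hγ hfbar _ ht]

lemma hasDerivAt_genMean_lift (hx : IsGlobalReducedSolution (d 0) (flatDim d) ε K x)
    (P : Params (d 0) (flatDim d) ε K) (hγ : ∀ t, 0 < t → HasDerivAt γ (x t .h) t)
    (hfbar : ∀ i, 0 < fbar i) (ht : 0 < t) :
    HasDerivAt (genMean d (lift fbar x γ) fun t => -x t .v)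
      (-trShapeSq d (lift fbar x γ) t + ε / 2) t := by
  refine (((hx _).hasDerivAt_reducedMean P (mem_Ioo_zero_add_one ht)).congr_of_eventuallyEq
    ?_).congr_deriv ?_
  · filter_upwards [lt_mem_nhds ht] with s hs using hx.genMean_lift hγ hfbar hs
  · rw [hx.trShapeSq_lift hγ hfbar ht]
    ring

lemma hasDerivAt_shape_lift (hx : IsGlobalReducedSolution (d 0) (flatDim d) ε K x)
    (A : Setting m d μ ε) (hγ : ∀ t, 0 < t → HasDerivAt γ (x t .h) t) (hfbar : ∀ i, 0 < fbar i)
    (i : Fin (m + 1)) (ht : 0 < t) :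
    HasDerivAt (shape (lift fbar x γ) i)
      (-(genMean d (lift fbar x γ) (fun t => -x t .v) t) * shape (lift fbar x γ) i t +
        μ i / lift fbar x γ i t ^ 2 + ε / 2) t := by
  have ht1 := mem_Ioo_zero_add_one ht
  rw [hx.genMean_lift hγ hfbar ht]
  refine Fin.cases ?_ (fun i => ?_) i
  · refine (((hx _).hasDerivAt_y_div_f ht1).congr_of_eventuallyEq ?_).congr_deriv ?_
    · filter_upwards [lt_mem_nhds ht] with s hs using hx.shape_lift_zero hs
    · rw [hx.shape_lift_zero ht, A.μ_zero]
      rfl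
  · refine (((hx _).hasDerivAt_h ht1).congr_of_eventuallyEq ?_).congr_deriv ?_
    · filter_upwards [lt_mem_nhds ht] with s hs using shape_lift_succ hγ hfbar i hs
    · rw [shape_lift_succ hγ hfbar i ht, A.μ_succ, zero_div, add_zero]

lemma contDiffOn_lift (hx : IsGlobalReducedSolution N D ε K x)
    (hγ : ∀ t, 0 < t → HasDerivAt γ (x t .h) t) (i : Fin (m + 1)) :
    ContDiffOn ℝ ∞ (lift fbar x γ i) (Ioi 0) := by
  have hsmooth := contDiffOn_pi.1 hx.contDiffOn
  have hγs : ContDiffOn ℝ ∞ γ (Ioi 0) :=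
    (contDiffOn_infty_iff_deriv_of_isOpen isOpen_Ioi).2
      ⟨fun t ht => (hγ t ht).differentiableAt.differentiableWithinAt,
        (hsmooth .h).congr fun t ht => (hγ t ht).deriv⟩
  exact Fin.cases (hsmooth .f) (fun i => contDiffOn_const.mul hγs.exp) i

theorem isSoliton_lift (hx : IsGlobalReducedSolution (d 0) (flatDim d) ε K x)
    (A : Setting m d μ ε) (hK : 0 < K) (hγ : ∀ t, 0 < t → HasDerivAt γ (x t .h) t)
    (hfbar : ∀ i, 0 < fbar i) :
    IsSoliton d μ ε (lift fbar x γ) (fun t => -x t .v) where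
  smooth_f := hx.contDiffOn_lift hγ
  smooth_u := (contDiffOn_pi.1 hx.contDiffOn .v).neg
  pos i t ht := Fin.cases ((hx _).pos_f t (mem_Ioo_zero_add_one ht))
    (fun i => mul_pos (hfbar i) (Real.exp_pos _)) i
  eq_mean _ ht := (hx.hasDerivAt_genMean_lift (A.params hK) hγ hfbar ht).deriv
  eq_shape i _ ht := (hx.hasDerivAt_shape_lift A hγ hfbar i ht).deriv

theorem hasInitialData_lift (hx : IsGlobalReducedSolution (d 0) D ε K x)
    (P : Params (d 0) D ε K) (hγ : ∀ t, 0 < t → HasDerivAt γ (x t .h) t)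
    (hγ0 : Tendsto γ (𝓝[>] 0) (𝓝 0)) :
    HasInitialData d fbar (-K) (lift fbar x γ) (fun t => -x t .v) := by
  have hexp : Tendsto (fun t => Real.exp (γ t)) (𝓝[>] 0) (𝓝 1) := by
    simpa only [Real.exp_zero] using hγ0.rexp
  refine ⟨(hx 1).tendsto_f, (hx 1).tendsto_y.congr' ?_, fun i => ?_, fun i => ?_, ?_, ?_, ?_⟩
  · filter_upwards [self_mem_nhdsWithin] with t ht using (hx.deriv_lift_zero ht).symm
  · simpa only [mul_one] using! hexp.const_mul (fbar i)
  · have hlim := (hexp.mul (hx 1).tendsto_h).const_mul (fbar i)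
    rw [mul_zero, mul_zero] at hlim
    refine hlim.congr' ?_
    filter_upwards [self_mem_nhdsWithin] with t ht using (deriv_lift_succ hγ i ht).symm
  · simpa only [neg_zero] using (hx 1).tendsto_v.neg
  · have hlim := (hx 1).tendsto_p.neg
    rw [neg_zero] at hlim
    refine hlim.congr' ?_
    filter_upwards [self_mem_nhdsWithin] with t ht using (hx.deriv_neg_v ht).symm
  · have hlim := ((hx 1).tendsto_deriv_p P one_pos).neg
    rw [← neg_div] at hlim
    refine hlim.congr' ?_
    filter_upwards [self_mem_nhdsWithin] with t (ht : 0 < t)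
    have hderiv : deriv (fun t => -x t .v) =ᶠ[𝓝 t] fun t => -x t .p := by
      filter_upwards [lt_mem_nhds ht] with s hs using hx.deriv_neg_v hs
    rw [hderiv.deriv_eq, ((hx _).hasDerivAt_p (mem_Ioo_zero_add_one ht)).fun_neg.deriv]

end IsGlobalReducedSolution

theorem Setting.exists_isSoliton (A : Setting m d μ ε) {fbar : Fin m → ℝ}
    (hfbar : ∀ i, 0 < fbar i) {C : ℝ} (hC : C < 0) :
    ∃ f u, IsSoliton d μ ε f u ∧ HasInitialData d fbar C f u := by
  have P := A.params (neg_pos.2 hC)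
  obtain ⟨x, hx⟩ := IsGlobalReducedSolution.exists_global P
  obtain ⟨γ, hγ, hγ0⟩ := exists_primitive_of_tendsto
    (contDiffOn_pi.1 hx.contDiffOn .h).continuousOn (hx 1).tendsto_h
  exact ⟨_, _, hx.isSoliton_lift A (neg_pos.2 hC) hγ hfbar,
    neg_neg C ▸ hx.hasInitialData_lift P hγ hγ0⟩

end WarpedSoliton

theorem lemma6p1 (m : ℕ) (hm : 1 ≤ m) (d : Fin (m + 1) → ℕ) (hd0 : 2 ≤ d 0)
    (hd : ∀ i, 1 ≤ d i) (μ : Fin (m + 1) → ℝ) (hμ0 : μ 0 = (d 0 : ℝ) - 1)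
    (hμ : ∀ i : Fin m, μ i.succ = 0) (ε : ℝ) (hε : 0 < ε)
    (fbar : Fin m → ℝ) (hfbar : ∀ i, 0 < fbar i) (σ : ℝ) (hσ : 0 < σ) :
    ∃ C : ℝ, C < 0 ∧
      (∃ (f : Fin (m + 1) → ℝ → ℝ) (u Λ : ℝ → ℝ) (X Y : Fin (m + 1) → ℝ → ℝ),
        WarpedSoliton.IsSoliton d μ ε f u ∧ WarpedSoliton.HasInitialData d fbar C f u ∧
        WarpedSoliton.Induces d f u Λ X Y) ∧
      (∀ (f : Fin (m + 1) → ℝ → ℝ) (u Λ : ℝ → ℝ) (X Y : Fin (m + 1) → ℝ → ℝ),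
        WarpedSoliton.IsSoliton d μ ε f u → WarpedSoliton.HasInitialData d fbar C f u →
        WarpedSoliton.Induces d f u Λ X Y →
        WarpedSoliton.IsRegular d μ ε Λ X Y ∧
        Filter.Tendsto (deriv (f 0)) Filter.atTop (nhds σ⁻¹) ∧
        Filter.Tendsto (fun s => X 0 s / Y 0 s) Filter.atTop (nhds σ⁻¹)) := by
  have A : WarpedSoliton.Setting m d μ ε := ⟨hm, hd0, hd, hμ0, hμ, hε⟩
  obtain ⟨K, P, hlim⟩ :=
    WarpedSoliton.IsGlobalReducedSolution.exists_param hd0 A.flatDim_pos.le hε hσ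
  have hC : -K < 0 := neg_lt_zero.2 P.K_pos
  refine ⟨-K, hC, ?_, fun f u Λ X Y h hi hI => ?_⟩
  · obtain ⟨f, u, h, hi⟩ := A.exists_isSoliton hfbar hC
    obtain ⟨Λ, X, Y, hI⟩ := hi.exists_induces A hfbar hC h
    exact ⟨f, u, Λ, X, Y, h, hi, hI⟩
  · have hl : Tendsto (deriv (f 0)) atTop (𝓝 σ⁻¹) := hlim (WarpedSoliton.reduce d f u)
      (neg_neg K ▸ h.isGlobalReducedSolution_reduce A hi hfbar)
    exact ⟨hi.isRegular A hfbar hC h hI, hl,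
      hI.tendsto_ratio (fun t ht => (hi.genMean_pos A hfbar hC h ht).ne') h hl⟩
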